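/- **Setting.** Fix $g>0$, $a\in\mathbb R$, and let $\rho_{g,a}$ be the probability measure on $\mathbb R$ with density proportional to $e^{-gt^4-at^2}$; write $\langle\varphi^k\rangle_0=\int t^k\,d\rho_{g,a}(t)$. Let $V$ be a set, $\mathfrak g\notin V$ a ghost vertex, $J_{x,y}=J_{y,x}\ge 0$ ($x,y\in V$), $h_x\ge 0$ ($x\in V$) and $\beta>0$. Let $\Lambda'\subset\Lambda$ be finite subsets of $V\cup\{\mathfrak g\}$. The measure $\langle\cdot\rangle_{\Lambda,\beta,h}$ on $\mathbb R^{\Lambda\setminus\{\mathfrak g\}}$ has density proportional to $\exp\big(\beta\sum_{\{x,y\}\subset\Lambda\setminus\{\mathfrak g\}}J_{x,y}\varphi_x\varphi_y+\beta\,\mathbf 1_{\mathfrak g\in\Lambda}\sum_{x\in\Lambda\setminus\{\mathfrak g\}}h_x\varphi_x\big)$ with respect to $\bigotimes_x\rho_{g,a}(d\varphi_x)$ (so the field $h$ is present exactly when $\mathfrak g\in\Lambda$). A *current* on $\Lambda$ is a function $\mathbf n$ from pairs of distinct elements of $\Lambda$ to $\mathbb N$; $\Delta\mathbf n(x)=\sum_y\mathbf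 n_{x,y}$ and $\partial\mathbf n=\{x\in\Lambda\setminus\{\mathfrak g\}:\Delta\mathbf n(x)\text{ odd}\}$. Let $\mathcal M(\Lambda)$ be the set of $A\in\mathbb N^\Lambda$ with $\sum_xA_x$ even and, if $\mathfrak g\in\Lambda$, $A_{\mathfrak g}\le1$; put $\partial A=\{x\in\Lambda\setminus\{\mathfrak g\}:A_x\text{ odd}\}$, $\varphi_A=\prod_{x\in\Lambda\setminus\{\mathfrak g\}}\varphi_x^{A_x}$, and $A+B$ is the pointwise sum, taken mod $2$ at $\mathfrak g$. The weight of $\mathbf n$ is $$w_A(\mathbf n)=\prod_{\{x,y\}\subset\Lambda\setminus\{\mathfrak g\}}\frac{(\beta J_{x,y})^{\mathbf n_{x,y}}}{\mathbf n_{x,y}!}\prod_{x\in\Lambda\setminus\{\mathfrak g\}}\frac{(\beta h_x)^{\mathbf n_{x,\mathfrak g}}}{\mathbf n_{x,\mathfrak g}!}\langle\varphi^{\Delta\mathbf n(x)+A_x}\rangle_0 ,$$ with $\mathbf n_{x,\mathfrak g}=0$ if $\mathfrak g\notin\Lambda$. Let $A\in\mathcal M(\Lambda)$ and $B\in\mathcal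 M(\Lambda')$ (extended by $0$ to $\Lambda$). For $z\in\Lambda\setminus\{\mathfrak g\}$ the *block* $\mathcal B_z(\mathbf n,A)$ consists of $\mathbf n_{z,y}$ points $zy(k)$ for each $y\in\Lambda$, and $A_z$ points $za(k)$; $\mathcal B_z(\mathbf n,A,B)$ has in addition $B_z$ points $zb(k)$; the block of $\mathfrak g$ is a single point $\mathfrak g$, which also counts as $\mathfrak gb(1)$ if $B_{\mathfrak g}=1$. A *tangled current* $(\mathbf n,\mathfrak t)$ is a current on $\Lambda$ with, for each $z\in\Lambda\setminus\{\mathfrak g\}$, a partition $\mathfrak t_z$ of $\mathcal B_z(\mathbf n,A,B)$ into sets of even size. Its multigraph has edges $\{xy(k),yx(k)\}$ and $\{x\mathfrak g(k),\mathfrak g\}$, points in one class of $\mathfrak t_z$ being identified. $\mathcal F_B^{\Lambda'}$ is the event that every connected component of the part of this multigraph over $\Lambda'$ contains an even number of the points $zb(k)$. For currents $\mathbf n_1$ on $\Lambda$ and $\mathbf n_2$ on $\Lambda'$, $\mathcal B_z(\mathbf n_1+\mathbf n_2,A,B)$ is the disjoint union of $\mathcal B_z(\mathbf n_1,A)$ and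 $\mathcal B_z(\mathbf n_2,B)$ (the edges of $\mathbf n_1$ being numbered before those of $\mathbf n_2$), and $\mathcal T_{\mathbf n_1,\mathbf n_2,A,B}(z)$ is the set of *admissible* partitions of it: each class meets both of the two parts in an even number of points. The block for $(A+B,\emptyset)$ is identified with the block for $(A,B)$ by $za(A_z+k)\leftrightarrow zb(k)$. **Theorem.** For given $g,a$ there are probability measures $\rho^{\mathbf n_1,\mathbf n_2}_{z,A,B}$ on $\mathcal T_{\mathbf n_1,\mathbf n_2,A,B}(z)$, for $\partial\mathbf n_1=\partial A$, $\partial\mathbf n_2=\partial B$, which up to relabelling of the points of $\mathcal B_z(\mathbf n_1,A)$ and of $\mathcal B_z(\mathbf n_2,B)$ depend only on the sizes $\Delta\mathbf n_1(z)+A_z$ and $\Delta\mathbf n_2(z)+B_z$ of these two sets (and on $g,a$; not on $V,J,h,\beta,\Lambda,\Lambda'$ or the rest of $\mathbf n_1,\mathbf n_2$), such that with $\rho^{\mathbf n_1,\mathbf n_2}_{A,B}=\bigotimes_{z\in\Lambda\setminus\{\mathfrak g\}}\rho^{\mathbf n_1,\mathbf n_2}_{z,A,B}$ the following holds. 1.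 For every bounded function $F$ of tangled currents that does not depend on the numbering of parallel edges, $$\sum_{\substack{\partial\mathbf n_1=\partial A\\ \partial\mathbf n_2=\partial B}}w_A(\mathbf n_1)w_B(\mathbf n_2)\,\rho^{\mathbf n_1,\mathbf n_2}_{A,B}\big[F(\mathbf n_1+\mathbf n_2,\mathfrak t)\big]=\sum_{\substack{\partial\mathbf n_1=\partial(A+B)\\ \partial\mathbf n_2=\emptyset}}w_{A+B}(\mathbf n_1)w_\emptyset(\mathbf n_2)\,\rho^{\mathbf n_1,\mathbf n_2}_{A+B,\emptyset}\big[F(\mathbf n_1+\mathbf n_2,\mathfrak t)\mathbf 1_{\mathcal F_B^{\Lambda'}}\big],$$ where $\mathbf n_1$ and $\mathbf n_2$ range over currents on $\Lambda$ and on $\Lambda'$ respectively, and both series converge absolutely. 2. Let $\mathbf P^{A,B}_{\Lambda,\Lambda'}$ be the law of $(\mathbf n_1+\mathbf n_2,\mathfrak t)$ when $(\mathbf n_1,\mathbf n_2)$ with $\partial\mathbf n_1=\partial A$, $\partial\mathbf n_2=\partial B$ is chosen with probability proportional to $w_A(\mathbf n_1)w_B(\mathbf n_2)$ and then $\mathfrak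 t$ is sampled from $\rho^{\mathbf n_1,\mathbf n_2}_{A,B}$. It is a well-defined probability measure if $\langle\varphi_A\rangle_{\Lambda,\beta,h}$ and $\langle\varphi_B\rangle_{\Lambda',\beta,h}$ are nonzero (otherwise set $\mathbf P^{A,B}_{\Lambda,\Lambda'}=0$). If $\langle\varphi_{A+B}\rangle_{\Lambda,\beta,h}\ne0$, then $\mathbf P^{A+B,\emptyset}_{\Lambda,\Lambda'}$ is a probability measure and, for all $F$ as in 1, $$\frac{\langle\varphi_A\rangle_{\Lambda,\beta,h}\langle\varphi_B\rangle_{\Lambda',\beta,h}}{\langle\varphi_{A+B}\rangle_{\Lambda,\beta,h}}\,\mathbf E^{A,B}_{\Lambda,\Lambda'}[F]=\mathbf E^{A+B,\emptyset}_{\Lambda,\Lambda'}\big[F\,\mathbf 1_{\mathcal F_B^{\Lambda'}}\big],\qquad \frac{\langle\varphi_A\rangle_{\Lambda,\beta,h}\langle\varphi_B\rangle_{\Lambda',\beta,h}}{\langle\varphi_{A+B}\rangle_{\Lambda,\beta,h}}=\mathbf P^{A+B,\emptyset}_{\Lambda,\Lambda'}\big[\mathcal F_B^{\Lambda'}\big].$$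 -/

import Mathlib

open MeasureTheory

universe u

noncomputable section

namespace Phi4

/-! Even and admissible partitions of finite sets -/

/-- Partitions of `X` (given as equivalence relations) all of whose classes have an even
number of elements. -/
def EvenPart (X : Type u) : Type u :=
  {r : Setoid X // ∀ w : X, Even (Set.ncard {x : X | r x w})}

/-- Admissible partitions of the disjoint union of `X` and `Y`: every class meets `X` in an even
number of points, and meets `Y` in an even number of points. -/
def AdmPart (X Y : Type u) : Type u :=
  {r : Setoid (X ⊕ Y) // ∀ w : X ⊕ Y,
    Even (Set.ncard {x : X | r (Sum.inl x) w}) ∧ Even (Set.ncard {y : Y | r (Sum.inr y) w})}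

instance (X Y : Type u) : MeasurableSpace (AdmPart X Y) := ⊤

/-- Transport of an even partition along a bijection. -/
def EvenPart.congr {X X' : Type u} (e : X ≃ X') (r : EvenPart X) : EvenPart X' :=
  ⟨Setoid.comap e.symm r.1, fun w => by
    have h := r.2 (e.symm w)
    have : {x : X' | (Setoid.comap e.symm r.1) x w} = e '' {x : X | r.1 x (e.symm w)} := by
      ext x
      simp [Setoid.comap_rel, Equiv.image_eq_preimage_symm]
    rw [this, Set.ncard_image_of_injective _ e.injective]
    exact h⟩

/-- Transport of an admissible partition along a bijection of each of the two parts. -/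
def AdmPart.congr {X X' Y Y' : Type u} (e : X ≃ X') (f : Y ≃ Y') (r : AdmPart X Y) :
    AdmPart X' Y' :=
  ⟨Setoid.comap (Equiv.sumCongr e f).symm r.1, fun w => by
    have h := r.2 ((Equiv.sumCongr e f).symm w)
    have h1 : {x : X' | (Setoid.comap (Equiv.sumCongr e f).symm r.1) (Sum.inl x) w}
        = e '' {x : X | r.1 (Sum.inl x) ((Equiv.sumCongr e f).symm w)} := by
      ext x
      simp [Setoid.comap_rel, Equiv.image_eq_preimage_symm]
    have h2 : {y : Y' | (Setoid.comap (Equiv.sumCongr e f).symm r.1) (Sum.inr y) w}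
        = f '' {y : Y | r.1 (Sum.inr y) ((Equiv.sumCongr e f).symm w)} := by
      ext x
      simp [Setoid.comap_rel, Equiv.image_eq_preimage_symm]
    rw [h1, h2, Set.ncard_image_of_injective _ e.injective,
      Set.ncard_image_of_injective _ f.injective]
    exact h⟩

/-- An admissible partition of two finite sets is an even partition of their disjoint union. -/
def AdmPart.toEvenPart {X Y : Type u} [Finite X] [Finite Y] (r : AdmPart X Y) :
    EvenPart (X ⊕ Y) :=
  ⟨r.1, fun w => by
    have h := r.2 w
    have : {x : X ⊕ Y | r.1 x w}
        = Sum.inl '' {x : X | r.1 (Sum.inl x) w} ∪ Sum.inr '' {y : Y | r.1 (Sum.inr y) w} := by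
      ext x
      cases x <;> simp
    rw [this, Set.ncard_union_eq (by
        rw [Set.disjoint_left]
        rintro _ ⟨a, _, rfl⟩ ⟨b, _, hb⟩
        cases hb) (Set.toFinite _) (Set.toFinite _),
      Set.ncard_image_of_injective _ Sum.inl_injective,
      Set.ncard_image_of_injective _ Sum.inr_injective]
    exact h.1.add h.2⟩

variable {V : Type u}

/-! The augmented vertex set is `Option V`; the ghost vertex is `none`. -/

/-- The vertices of `Λ` other than the ghost. -/
abbrev Site (Λ : Finset (Option V)) : Type u := {x : V // x ∈ Finset.eraseNone Λ}

/-- `n` is a current on `Λ`: a function on the pairs of distinct vertices of `Λ`, extended by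
zero to all unordered pairs. -/
def IsCurrent (Λ : Finset (Option V)) (n : Sym2 (Option V) → ℕ) : Prop :=
  ∀ e, n e ≠ 0 → ¬ e.IsDiag ∧ ∀ x ∈ e, x ∈ Λ

/-- The degree of the vertex `x` in the current `n`. -/
def degree (Λ : Finset (Option V)) (n : Sym2 (Option V) → ℕ) (x : V) : ℕ :=
  ∑ y ∈ Λ, n s(some x, y)

/-- The sources of the current `n`; the ghost is never a source. -/
def currentSources (Λ : Finset (Option V)) (n : Sym2 (Option V) → ℕ) : Set V :=
  {x | some x ∈ Λ ∧ Odd (degree Λ n x)}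

/-- `A` is an admissible moment on `Λ` (extended by zero outside `Λ`). -/
def IsMoment (Λ : Finset (Option V)) (A : Option V → ℕ) : Prop :=
  (∀ x, x ∉ Λ → A x = 0) ∧ A none ≤ 1 ∧ Even (∑ x ∈ Λ, A x)

/-- The sources of the moment `A`; the ghost is never a source. -/
def momentSources (Λ : Finset (Option V)) (A : Option V → ℕ) : Set V :=
  {x | some x ∈ Λ ∧ Odd (A (some x))}

/-- The sum of two moments, taken modulo 2 at the ghost. -/
def addMoment (A B : Option V → ℕ) : Option V → ℕ
  | some x => A (some x) + B (some x)
  | none => (A none + B none) % 2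

/-! The model -/

/-- The single-site probability measure, with density proportional to `exp (-g t^4 - a t^2)`. -/
def singleSite (g a : ℝ) : Measure ℝ :=
  (volume : Measure ℝ).tilted (fun t => -g * t ^ 4 - a * t ^ 2)

open Classical in
/-- The unordered pairs of distinct vertices of `Λ` other than the ghost. -/
def sitePairs (Λ : Finset (Option V)) : Finset (Sym2 (Site Λ)) :=
  Finset.univ.filter (fun e => ¬ e.IsDiag)

open Classical in
/-- Minus the Hamiltonian on `Λ`. The external field is present if and only if `Λ` contains
the ghost vertex (at which the spin equals `1`). -/
def negHamiltonian (J : Sym2 V → ℝ) (h : V → ℝ) (Λ : Finset (Option V)) (φ : Site Λ → ℝ) : ℝ :=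
  (∑ e ∈ sitePairs Λ, J (e.map Subtype.val) * (e.map φ).mul)
    + if none ∈ Λ then ∑ x : Site Λ, h x * φ x else 0

/-- The finite-volume measure on `Λ` with free boundary condition. -/
def phi4Measure (g a β : ℝ) (J : Sym2 V → ℝ) (h : V → ℝ) (Λ : Finset (Option V)) :
    Measure (Site Λ → ℝ) :=
  (Measure.pi fun _ : Site Λ => singleSite g a).tilted (fun φ => β * negHamiltonian J h Λ φ)

/-- The correlation of the product of the spins of `Λ` raised to the powers `A`. -/
def corr (g a β : ℝ) (J : Sym2 V → ℝ) (h : V → ℝ) (Λ : Finset (Option V))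
    (A : Option V → ℕ) : ℝ :=
  ∫ φ, ∏ x : Site Λ, φ x ^ A (some x.1) ∂(phi4Measure g a β J h Λ)

/-- The weight of the current `n` on `Λ` for the moment `A`. -/
def weight (g a β : ℝ) (J : Sym2 V → ℝ) (h : V → ℝ) (Λ : Finset (Option V))
    (A : Option V → ℕ) (n : Sym2 (Option V) → ℕ) : ℝ :=
  (∏ e ∈ sitePairs Λ,
      (β * J (e.map Subtype.val)) ^ n (e.map fun x => some x.1)
        / (n (e.map fun x => some x.1)).factorial)
    * (∏ x : Site Λ, (β * h x) ^ n s(some x.1, none) / (n s(some x.1, none)).factorial)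
    * ∏ x : Site Λ, ∫ t, t ^ (degree Λ n x + A (some x.1)) ∂(singleSite g a)

/-! Tangled currents -/

/-- The half-edges `zy(k)` of the current `n` at `z`. -/
abbrev HalfEdge (Λ : Finset (Option V)) (n : Sym2 (Option V) → ℕ) (z : V) : Type u :=
  (y : Λ) × Fin (n s(some z, y.1))

/-- The `k` additional points of a block, in the universe of the vertex set. -/
abbrev Pts (k : ℕ) : Type u := ULift.{u} (Fin k)

/-- The block of `z` for a single current `n` and a moment `A`: the half-edges at `z` and the
points `za(k)`. -/
abbrev SBlock (Λ : Finset (Option V)) (n : Sym2 (Option V) → ℕ) (A : Option V → ℕ) (z : V) :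
    Type u :=
  HalfEdge Λ n z ⊕ Pts.{u} (A (some z))

/-- The block of `z` for the current `n` and two moments: the half-edges at `z`, the points
`za(k)` and the points `zb(k)`. -/
abbrev Block (Λ : Finset (Option V)) (n : Sym2 (Option V) → ℕ) (A B : Option V → ℕ) (z : V) :
    Type u :=
  HalfEdge Λ n z ⊕ (Pts.{u} (A (some z)) ⊕ Pts.{u} (B (some z)))

/-- The half-edges of a sum of two currents: those of `n₁` come first, then those of `n₂`. -/
def halfEdgeAdd (Λ : Finset (Option V)) (n₁ n₂ : Sym2 (Option V) → ℕ) (z : V) :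
    HalfEdge Λ n₁ z ⊕ HalfEdge Λ n₂ z ≃ HalfEdge Λ (n₁ + n₂) z :=
  (Equiv.sigmaSumDistrib (fun y : Λ => Fin (n₁ s(some z, y.1)))
    (fun y : Λ => Fin (n₂ s(some z, y.1)))).symm.trans
    (Equiv.sigmaCongrRight fun _ => finSumFinEquiv)

/-- The block of the sum `n₁ + n₂` is the disjoint union of the block of `(n₁, A)` and the block
of `(n₂, B)`. -/
def blockAdd (Λ : Finset (Option V)) (n₁ n₂ : Sym2 (Option V) → ℕ) (A B : Option V → ℕ) (z : V) :
    SBlock Λ n₁ A z ⊕ SBlock Λ n₂ B z ≃ Block Λ (n₁ + n₂) A B z :=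
  (Equiv.sumSumSumComm _ _ _ _).trans (Equiv.sumCongr (halfEdgeAdd Λ n₁ n₂ z) (Equiv.refl _))

/-- In the block for the moments `A + B` and `0`, the first `A` points are called `za(k)` and the
remaining ones `zb(k)`. -/
def blockRegroup (Λ : Finset (Option V)) (n : Sym2 (Option V) → ℕ) (A B : Option V → ℕ) (z : V) :
    Block Λ n (addMoment A B) 0 z ≃ Block Λ n A B z :=
  Equiv.sumCongr (Equiv.refl _)
    ((Equiv.sumCongr Equiv.ulift Equiv.ulift).trans
      ((Equiv.sumEmpty (Fin (A (some z) + B (some z))) (Fin 0)).trans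
        (finSumFinEquiv.symm.trans
          (Equiv.sumCongr Equiv.ulift.symm Equiv.ulift.symm))))

/-- Tangled currents on `Λ` whose blocks carry the additional points given by `A` and `B`: a
current with an even partition of every block. -/
def TangledCurrent (Λ : Finset (Option V)) (A B : Option V → ℕ) : Type u :=
  (n : {n : Sym2 (Option V) → ℕ // IsCurrent Λ n}) × ((z : Site Λ) → EvenPart (Block Λ n.1 A B z))

instance (Λ : Finset (Option V)) (A B : Option V → ℕ) : MeasurableSpace (TangledCurrent Λ A B) :=
  ⊤

/-- The natural identification of the tangled currents for `(A + B, 0)` and for `(A, B)`. -/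
def regroup {Λ : Finset (Option V)} {A B : Option V → ℕ}
    (T : TangledCurrent Λ (addMoment A B) 0) : TangledCurrent Λ A B :=
  ⟨T.1, fun z => (T.2 z).congr (blockRegroup Λ T.1.1 A B z)⟩

/-- Renumbering of the parallel edges: for every pair `e` the edges `1, …, n e` are permuted
by `σ e` (at both endpoints simultaneously). -/
def relabel {Λ : Finset (Option V)} {A B : Option V → ℕ} (T : TangledCurrent Λ A B)
    (σ : (e : Sym2 (Option V)) → Equiv.Perm (Fin (T.1.1 e))) : TangledCurrent Λ A B :=
  ⟨T.1, fun z => (T.2 z).congr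
    (Equiv.sumCongr (Equiv.sigmaCongrRight fun y : Λ => σ s(some z.1, y.1)) (Equiv.refl _))⟩

/-- `F` does not depend on the numbering of parallel edges. -/
def LabelInvariant {Λ : Finset (Option V)} {A B : Option V → ℕ}
    (F : TangledCurrent Λ A B → ℝ) : Prop :=
  ∀ (T : TangledCurrent Λ A B) (σ : (e : Sym2 (Option V)) → Equiv.Perm (Fin (T.1.1 e))),
    F (relabel T σ) = F T

/-- The points of all blocks, and the ghost `none`. -/
abbrev TVertex {Λ : Finset (Option V)} {A B : Option V → ℕ} (T : TangledCurrent Λ A B) : Type u :=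
  Option ((z : Site Λ) × Block Λ T.1.1 A B z)

/-- The links between points over `Λ'`: two points of a block in the same partition class, the
two ends `xy(k)` and `yx(k)` of an edge, and the ends `xg(k)` and `g` of an edge to the ghost. -/
inductive Link {Λ : Finset (Option V)} {A B : Option V → ℕ} (Λ' : Finset (Option V))
    (T : TangledCurrent Λ A B) : TVertex T → TVertex T → Prop
  | tangle (z : Site Λ) (p q : Block Λ T.1.1 A B z) (hz : some z.1 ∈ Λ')
      (hpq : (T.2 z).1 p q) : Link Λ' T (some ⟨z, p⟩) (some ⟨z, q⟩)
  | edge (x y : Site Λ) (hx : some x.1 ∈ Λ') (hy : some y.1 ∈ Λ')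
      (k : Fin (T.1.1 s(some x.1, some y.1))) (l : Fin (T.1.1 s(some y.1, some x.1)))
      (hkl : (k : ℕ) = l) :
      Link Λ' T (some ⟨x, Sum.inl ⟨⟨some y.1, Finset.mem_eraseNone.1 y.2⟩, k⟩⟩)
        (some ⟨y, Sum.inl ⟨⟨some x.1, Finset.mem_eraseNone.1 x.2⟩, l⟩⟩)
  | ghost (x : Site Λ) (hx : some x.1 ∈ Λ') (hg : none ∈ Λ) (hg' : none ∈ Λ')
      (k : Fin (T.1.1 s(some x.1, none))) :
      Link Λ' T (some ⟨x, Sum.inl ⟨⟨none, hg⟩, k⟩⟩) none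

/-- The graph of the tangled current restricted to `Λ'`. Identification of the points of a
partition class is expressed by joining them; points outside `Λ'` are isolated. -/
def tangledGraph {Λ : Finset (Option V)} {A B : Option V → ℕ} (Λ' : Finset (Option V))
    (T : TangledCurrent Λ A B) : SimpleGraph (TVertex T) :=
  SimpleGraph.fromRel (Link Λ' T)

/-- The points `zb(k)`, including the ghost if `B` equals `1` there. -/
def bPoints {Λ : Finset (Option V)} {A B : Option V → ℕ} (T : TangledCurrent Λ A B) :
    Set (TVertex T) :=
  {v | (∃ (z : Site Λ) (k : Pts.{u} (B (some z.1))), v = some ⟨z, Sum.inr (Sum.inr k)⟩) ∨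
    (v = none ∧ B none = 1)}

/-- The event that every connected component of the tangled current restricted to `Λ'` contains
an even number of the points `zb(k)`. -/
def pairingEvent (Λ Λ' : Finset (Option V)) (A B : Option V → ℕ) : Set (TangledCurrent Λ A B) :=
  {T | ∀ C : (tangledGraph Λ' T).ConnectedComponent, Even (Set.ncard (C.supp ∩ bPoints T))}

/-! Double currents and their tanglings -/

/-- Pairs of a current on `Λ` with the sources of `A` and a current on `Λ'` with the sources
of `B`. -/
def CurrentPair (Λ Λ' : Finset (Option V)) (A B : Option V → ℕ) : Type u :=
  {p : (Sym2 (Option V) → ℕ) × (Sym2 (Option V) → ℕ) //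
    IsCurrent Λ p.1 ∧ IsCurrent Λ' p.2 ∧
    currentSources Λ p.1 = momentSources Λ A ∧ currentSources Λ' p.2 = momentSources Λ' B}

/-- The tanglings of a pair of currents: at every `z`, an admissible partition of the union of
the blocks of `z` for `(n₁, A)` and for `(n₂, B)`. -/
abbrev Tangling {Λ Λ' : Finset (Option V)} {A B : Option V → ℕ} (p : CurrentPair Λ Λ' A B) :
    Type u :=
  (z : Site Λ) → AdmPart (SBlock Λ p.1.1 A z) (SBlock Λ p.1.2 B z)

/-- The tangled current `(n₁ + n₂, t)`. -/
def assemble {Λ Λ' : Finset (Option V)} {A B : Option V → ℕ} (hΛ : Λ' ⊆ Λ)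
    (p : CurrentPair Λ Λ' A B) (t : Tangling p) : TangledCurrent Λ A B :=
  ⟨⟨p.1.1 + p.1.2, fun e he => by
      by_cases h1 : p.1.1 e = 0
      · have h2 : p.1.2 e ≠ 0 := fun h2 => he (by simp [h1, h2])
        exact ⟨(p.2.2.1 e h2).1, fun x hx => hΛ ((p.2.2.1 e h2).2 x hx)⟩
      · exact p.2.1 e h1⟩,
    fun z => (t z).toEvenPart.congr (blockAdd Λ p.1.1 p.1.2 A B z)⟩

/-- The product over `z` of the tangling measures of the blocks, for a family `ρ` of measures on
admissible partitions. -/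
def tanglingMeasure (ρ : (X Y : Type u) → Measure (AdmPart X Y)) {Λ Λ' : Finset (Option V)}
    {A B : Option V → ℕ} (p : CurrentPair Λ Λ' A B) : Measure (Tangling p) :=
  Measure.pi fun z : Site Λ => ρ (SBlock Λ p.1.1 A z) (SBlock Λ p.1.2 B z)

/-- The product of the weights of the two currents. -/
def pairWeight (g a β : ℝ) (J : Sym2 V → ℝ) (h : V → ℝ) {Λ Λ' : Finset (Option V)}
    {A B : Option V → ℕ} (p : CurrentPair Λ Λ' A B) : ℝ :=
  weight g a β J h Λ A p.1.1 * weight g a β J h Λ' B p.1.2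

/-- The law of the random tangled current obtained from a pair of currents chosen with
probability proportional to the product of their weights, and independent tanglings of the
blocks. -/
def tangledLaw (ρ : (X Y : Type u) → Measure (AdmPart X Y)) (g a β : ℝ) (J : Sym2 V → ℝ)
    (h : V → ℝ) {Λ Λ' : Finset (Option V)} (hΛ : Λ' ⊆ Λ) (A B : Option V → ℕ) :
    Measure (TangledCurrent Λ A B) :=
  Measure.sum fun p : CurrentPair Λ Λ' A B =>
    ENNReal.ofReal (pairWeight g a β J h p / ∑' q : CurrentPair Λ Λ' A B, pairWeight g a β J h q)
      • (tanglingMeasure ρ p).map (assemble hΛ p)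

end Phi4

end

/-!
The switching identity rests on a statement about a single site, a combinatorial count for a fixed
tangled current, and the random current expansion.

**Single site.** There are nonnegative weights `W` on the even partitions of finite sets, invariant
under bijections, such that for all disjoint `X` and `Y` the product of the moments of orders
`|X|` and `|Y|` is the sum of `W r` over the admissible partitions `r` of `X ⊕ Y`
(`exists_tangling_weight`). What matters for switching is that `W` does not depend on how the set
is split into `X` and `Y`; the tangling measures are `W` normalized (`tanglingLaw`). To find `W`,
let `p`, `q` be two independent spins, `u = p + q` and `v = p - q`. Their joint density is a
function of `p ^ 2 + q ^ 2` times `exp ((g / 4) (u ^ 4 + v ^ 4))` (`twoSite_eq`). For a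
rotation-invariant density, the mixed moments of `u` and `v` are proportional to a number of
monochromatic pairings, as in Wick's formula (`hasPartitionExpansion_radial`). A factor
`u ^ 4 + v ^ 4` adds four points of a common colour and merges the classes containing them
(`HasPartitionExpansion.quart_mul`), so the expansion of the exponential writes the mixed moments
as sums of nonnegative weights over the even partitions with monochromatic classes. Finally,
`p = (u + v) / 2` and `q = (u - v) / 2`; when the product is expanded over the colourings, the
signs cancel for every partition that is not admissible (`sum_colourSign`).

**Fixed tangled current.** The edge weights of two currents multiply to the edge weight of
their sum times binomial coefficients. This turns the sum over the pairs with sum `n` into a sum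
over the subsets of the edges of `n` over `Λ'`, the edges of the second current, and admissibility says that each class contains an even number of
points of the second current (`hasSum_fibre`). Hence a tangled current for `(A, B)` is counted with
the number of edge sets `E` such that each class contains an even number of ends of edges of `E`
and points `zb(k)` together, and for `(A + B, ∅)` with the same number without the points `zb(k)`.
These are the solutions of an inhomogeneous linear system over `ZMod 2` and of the associated
homogeneous one, so the two numbers agree if the first system is solvable, which holds if and only
if each component contains an even number of the points `zb(k)` (`markCount_one`).

**Expansion.** Expanding the exponential of the Hamiltonian gives the unnormalized correlations as
sums of the weights of currents (`hasSum_weight`), hence the absolute convergence of all the series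
and the normalization of the laws in the second part, which then is the first part divided by the
partition functions.
-/

namespace Phi4

variable {V : Type u}

/-! ### Even partitions of finite sets -/

instance instFiniteSetoid {X : Type*} [Finite X] : Finite (Setoid X) :=
  Finite.of_injective (fun r x y => r x y) fun r s h =>
    Setoid.ext fun x y => by simpa using congrFun (congrFun h x) y

instance instFiniteEvenPart {X : Type u} [Finite X] : Finite (EvenPart X) :=
  inferInstanceAs (Finite (Subtype _))

instance instFiniteAdmPart {X Y : Type u} [Finite X] [Finite Y] : Finite (AdmPart X Y) :=
  inferInstanceAs (Finite (Subtype _))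

noncomputable instance instFintypeEvenPart {X : Type u} [Finite X] : Fintype (EvenPart X) :=
  Fintype.ofFinite _

noncomputable instance instFintypeAdmPart {X Y : Type u} [Finite X] [Finite Y] :
    Fintype (AdmPart X Y) :=
  Fintype.ofFinite _

/-- A function that sums to zero over each class of an equivalence relation sums to zero over
every union of classes. -/
theorem sum_saturated_eq_zero {X M : Type*} [Fintype X] [AddCommMonoid M] (r : Setoid X)
    (m : X → M) (A : X → Prop) [DecidablePred A] [DecidableRel fun x y => r x y]
    (hA : ∀ x y, r x y → (A x ↔ A y)) (hm : ∀ w, A w → ∑ x with r x w, m x = 0) :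
    ∑ x with A x, m x = 0 := by
  classical
  rw [← Finset.sum_fiberwise (Finset.univ.filter A) (Quotient.mk r)]
  refine Finset.sum_eq_zero fun q _ => ?_
  induction q using Quotient.inductionOn with
  | h w =>
    by_cases hw : A w
    · rw [← hm w hw, Finset.filter_filter]
      refine Finset.sum_congr (Finset.filter_congr fun x _ => ?_) fun _ _ => rfl
      have : (Quotient.mk r x = Quotient.mk r w) ↔ r x w := Quotient.eq
      rw [this]
      exact ⟨fun h => h.2, fun h => ⟨(hA _ _ h).2 hw, h⟩⟩
    · rw [Finset.filter_filter]
      refine Finset.sum_eq_zero fun x hx => ?_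
      have hx' := (Finset.mem_filter.1 hx).2
      exact absurd ((hA _ _ (Quotient.eq.1 hx'.2)).1 hx'.1) hw

theorem even_ncard_iff_sum {X : Type*} [Fintype X] (p : X → Prop) [DecidablePred p] :
    Even (Set.ncard {x | p x}) ↔ ∑ x with p x, (1 : ZMod 2) = 0 := by
  rw [Finset.sum_const, nsmul_one, ZMod.natCast_eq_zero_iff_even, Set.ncard_eq_toFinset_card',
    Set.toFinset_ofPred]

theorem even_ncard_of_saturated {X : Type*} [Finite X] (r : Setoid X) (A : X → Prop)
    (hr : ∀ w, A w → Even (Set.ncard {x | r x w})) (hA : ∀ x y, r x y → (A x ↔ A y)) :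
    Even (Set.ncard {x | A x}) := by
  classical
  have := Fintype.ofFinite X
  rw [even_ncard_iff_sum]
  exact sum_saturated_eq_zero r _ A hA fun w hw => (even_ncard_iff_sum _).1 (hr w hw)

theorem EvenPart.congr_refl {X : Type u} (r : EvenPart X) : r.congr (Equiv.refl X) = r :=
  Subtype.ext (Setoid.ext fun _ _ => Iff.rfl)

theorem EvenPart.congr_congr {X Y Z : Type u} (e : X ≃ Y) (f : Y ≃ Z) (r : EvenPart X) :
    (r.congr e).congr f = r.congr (e.trans f) :=
  Subtype.ext (Setoid.ext fun _ _ => Iff.rfl)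

theorem EvenPart.congr_rel {X Y : Type u} (e : X ≃ Y) (r : EvenPart X) (x y : Y) :
    (r.congr e).1 x y ↔ r.1 (e.symm x) (e.symm y) := Iff.rfl

/-- Transport along a bijection, as a bijection between the sets of even partitions. -/
def EvenPart.congrEquiv {X Y : Type u} (e : X ≃ Y) : EvenPart X ≃ EvenPart Y where
  toFun := EvenPart.congr e
  invFun := EvenPart.congr e.symm
  left_inv r := by rw [EvenPart.congr_congr, Equiv.self_trans_symm, EvenPart.congr_refl]
  right_inv r := by rw [EvenPart.congr_congr, Equiv.symm_trans_self, EvenPart.congr_refl]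

/-- The colouring `κ` is constant on the classes of `r`. -/
def Respects {X : Type*} (r : Setoid X) (κ : X → Bool) : Prop := ∀ x y, r x y → κ x = κ y

/-- The equivalence relation on `X` obtained from one on `X ⊕ T` by merging all classes
that meet `T`. -/
def collapseSetoid {X T : Type*} (r : Setoid (X ⊕ T)) : Setoid X where
  r x y := r (.inl x) (.inl y) ∨
    ((∃ t, r (.inl x) (.inr t)) ∧ ∃ t, r (.inl y) (.inr t))
  iseqv :=
    { refl := fun x => Or.inl (r.refl _)
      symm := by
        rintro x y (h | h)
        · exact Or.inl (r.symm h)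
        · exact Or.inr h.symm
      trans := by
        rintro x y z (h | ⟨hx, hy⟩) (h' | ⟨hy', hz⟩)
        · exact Or.inl (r.trans h h')
        · obtain ⟨t, ht⟩ := hy'
          exact Or.inr ⟨⟨t, r.trans h ht⟩, hz⟩
        · obtain ⟨t, ht⟩ := hy
          exact Or.inr ⟨hx, ⟨t, r.trans (r.symm h') ht⟩⟩
        · exact Or.inr ⟨hx, hz⟩ }

theorem collapseSetoid_rel {X T : Type*} (r : Setoid (X ⊕ T)) (x y : X) :
    collapseSetoid r x y ↔ r (.inl x) (.inl y) ∨
      ((∃ t, r (.inl x) (.inr t)) ∧ ∃ t, r (.inl y) (.inr t)) := Iff.rfl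

/-- Merging the classes that meet `T`, for even partitions and `T` of even size. -/
def EvenPart.collapse {X T : Type u} [Finite X] [Finite T] (hT : Even (Nat.card T))
    (r : EvenPart (X ⊕ T)) : EvenPart X :=
  ⟨collapseSetoid r.1, fun w => by
    by_cases hw : ∃ t, r.1 (.inl w) (.inr t)
    · have h1 : {x | collapseSetoid r.1 x w} = {x | ∃ t, r.1 (.inl x) (.inr t)} := by
        ext x
        rw [Set.mem_ofPred_eq, collapseSetoid_rel]
        constructor
        · rintro (h | h)
          · obtain ⟨t, ht⟩ := hw
            exact ⟨t, r.1.trans h ht⟩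
          · exact h.1
        · exact fun h => Or.inr ⟨h, hw⟩
      have h2 : Even (Set.ncard {p : X ⊕ T | ∃ t, r.1 p (.inr t)}) :=
        even_ncard_of_saturated r.1 _ (fun w _ => r.2 w) fun x y hxy =>
          ⟨fun ⟨t, ht⟩ => ⟨t, r.1.trans (r.1.symm hxy) ht⟩, fun ⟨t, ht⟩ => ⟨t, r.1.trans hxy ht⟩⟩
      have h3 : {p : X ⊕ T | ∃ t, r.1 p (.inr t)}
          = Sum.inl '' {x | ∃ t, r.1 (.inl x) (.inr t)} ∪ Sum.inr '' (Set.univ : Set T) := by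
        ext (x | t)
        · simp
        · simpa using ⟨t, r.1.refl _⟩
      rw [h3, Set.ncard_union_eq (by
          rw [Set.disjoint_left]
          rintro _ ⟨a, _, rfl⟩ ⟨b, _, hb⟩
          cases hb) (Set.toFinite _) (Set.toFinite _),
        Set.ncard_image_of_injective _ Sum.inl_injective,
        Set.ncard_image_of_injective _ Sum.inr_injective, Set.ncard_univ] at h2
      rw [h1]
      exact (Nat.even_add.1 h2).2 hT
    · have h1 : Sum.inl '' {x | collapseSetoid r.1 x w} = {p : X ⊕ T | r.1 p (.inl w)} := by
        ext (x | t)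
        · simp only [Set.mem_image, Set.mem_ofPred_eq, Sum.inl.injEq, exists_eq_right,
            collapseSetoid_rel]
          exact or_iff_left fun h => hw h.2
        · simp only [Set.mem_image, Set.mem_ofPred_eq, reduceCtorEq, and_false, exists_false,
            false_iff]
          exact fun h => hw ⟨t, r.1.symm h⟩
      rw [← Set.ncard_image_of_injective _ (Sum.inl_injective (β := T)), h1]
      exact r.2 _⟩

open Classical in
/-- A colouring of `X` respects the merged partition if and only if it extends to a colouring of
`X ⊕ T` that is constant on `T` and respects the original partition. The number of such
extensions depends only on whether `T` is a union of classes. -/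
theorem respects_collapse {X T : Type*} [Nonempty T] (r : Setoid (X ⊕ T)) (κ : X → Bool) :
    ((if Respects r (Sum.elim κ fun _ => true) then 1 else 0)
      + if Respects r (Sum.elim κ fun _ => false) then 1 else 0 : ℝ)
    = if Respects (collapseSetoid r) κ then
        (if ∃ x t, r (.inl x) (.inr t) then 1 else 2) else 0 := by
  have key : ∀ b : Bool, Respects r (Sum.elim κ fun _ => b) ↔
      Respects (collapseSetoid r) κ ∧ ∀ x t, r (.inl x) (.inr t) → κ x = b := by
    intro b
    constructor
    · intro h
      have h' : ∀ x t, r (.inl x) (.inr t) → κ x = b := fun x t hxt => h _ _ hxt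
      refine ⟨?_, h'⟩
      rintro x y (hxy | ⟨⟨t, ht⟩, s, hs⟩)
      · exact h _ _ hxy
      · rw [h' x t ht, h' y s hs]
    · rintro ⟨h, h'⟩ (x | t) (y | s) hxy
      · exact h x y (Or.inl hxy)
      · exact h' x s hxy
      · exact (h' y t (r.symm hxy)).symm
      · rfl
  simp only [key]
  by_cases h : Respects (collapseSetoid r) κ
  · by_cases hx : ∃ x t, r (.inl x) (.inr t)
    · obtain ⟨x, t, hxt⟩ := hx
      have hall : ∀ b, (∀ y s, r (.inl y) (.inr s) → κ y = b) ↔ κ x = b := by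
        intro b
        refine ⟨fun h' => h' x t hxt, fun hb y s hys => ?_⟩
        rw [← hb]
        exact h y x (Or.inr ⟨⟨s, hys⟩, t, hxt⟩)
      have hex : ∃ x t, r (.inl x) (.inr t) := ⟨x, t, hxt⟩
      simp only [h, hall, hex, true_and, if_true]
      cases κ x <;> simp
    · have hx' : ∀ x t, ¬ r (.inl x) (.inr t) := fun x t h => hx ⟨x, t, h⟩
      simp only [h, hx', true_and, false_imp_iff, implies_true, if_true, exists_false, if_false]
      norm_num
  · simp [h]

/-! ### Integrability against quartic densities -/

theorem one_add_abs_pow_le (k : ℕ) (x : ℝ) :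
    (1 + |x|) ^ k ≤ k.factorial * Real.exp 2 * Real.exp (x ^ 2) := by
  have h0 : 0 ≤ 1 + |x| := by positivity
  have h1 := Real.pow_div_factorial_le_exp (1 + |x|) h0 k
  rw [div_le_iff₀ (by positivity)] at h1
  calc (1 + |x|) ^ k ≤ Real.exp (1 + |x|) * k.factorial := h1
    _ ≤ Real.exp (2 + x ^ 2) * k.factorial := by
        have : 1 + |x| ≤ 2 + x ^ 2 := by
          nlinarith [sq_nonneg (|x| - 1), sq_abs x, abs_nonneg x]
        gcongr ?_ * _
        exact Real.exp_le_exp.2 this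
    _ = _ := by rw [Real.exp_add]; ring

theorem quartic_le {g : ℝ} (hg : 0 < g) (b x : ℝ) :
    b * x ^ 2 - g * x ^ 4 ≤ (b + 1) ^ 2 / (4 * g) - x ^ 2 := by
  have h : 0 ≤ g * (x ^ 2 - (b + 1) / (2 * g)) ^ 2 := by positivity
  have e : g * (x ^ 2 - (b + 1) / (2 * g)) ^ 2
      = g * x ^ 4 - (b + 1) * x ^ 2 + (b + 1) ^ 2 / (4 * g) := by
    field_simp
    ring
  linarith

/-- The quartic decay dominates polynomials and Gaussian growth. -/
theorem integrable_quartic {g : ℝ} (hg : 0 < g) (a b : ℝ) (k : ℕ) :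
    Integrable fun x : ℝ => (1 + |x|) ^ k * Real.exp (b * x ^ 2)
      * Real.exp (-g * x ^ 4 - a * x ^ 2) := by
  have hG : Integrable fun x : ℝ => Real.exp (-1 * x ^ 2) := integrable_exp_neg_mul_sq one_pos
  refine (hG.const_mul
    (k.factorial * Real.exp 2 * Real.exp ((1 + b - a + 1) ^ 2 / (4 * g)))).mono'
    (by fun_prop) (Filter.Eventually.of_forall fun x => ?_)
  rw [Real.norm_of_nonneg (by positivity)]
  calc (1 + |x|) ^ k * Real.exp (b * x ^ 2) * Real.exp (-g * x ^ 4 - a * x ^ 2)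
      ≤ (k.factorial * Real.exp 2 * Real.exp (x ^ 2)) * Real.exp (b * x ^ 2)
        * Real.exp (-g * x ^ 4 - a * x ^ 2) := by
        gcongr
        exact one_add_abs_pow_le k x
    _ = k.factorial * Real.exp 2 * Real.exp ((1 + b - a) * x ^ 2 - g * x ^ 4) := by
        rw [mul_assoc, mul_assoc, mul_assoc, mul_assoc, ← Real.exp_add, ← Real.exp_add]
        ring_nf
    _ ≤ k.factorial * Real.exp 2 *
        Real.exp ((1 + b - a + 1) ^ 2 / (4 * g) - x ^ 2) := by
        gcongr _ * ?_
        exact Real.exp_le_exp.2 (quartic_le hg _ x)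
    _ = _ := by
        rw [mul_assoc (k.factorial * Real.exp 2), ← Real.exp_add]
        ring_nf

/-! ### Two independent copies of the single-site measure in rotated coordinates -/

/-- The joint density of two independent single-site spins, up to normalization. -/
noncomputable def twoSite (g a : ℝ) (p : ℝ × ℝ) : ℝ :=
  Real.exp (-g * p.1 ^ 4 - a * p.1 ^ 2) * Real.exp (-g * p.2 ^ 4 - a * p.2 ^ 2)

/-- The rotation-invariant part of the density `twoSite`. -/
noncomputable def radial (g a : ℝ) (p : ℝ × ℝ) : ℝ :=
  Real.exp (-(3 * g / 2) * (p.1 ^ 2 + p.2 ^ 2) ^ 2 - a * (p.1 ^ 2 + p.2 ^ 2))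

/-- The sum of the fourth powers of `u = p.1 + p.2` and `v = p.1 - p.2`. -/
def quart (p : ℝ × ℝ) : ℝ := (p.1 + p.2) ^ 4 + (p.1 - p.2) ^ 4

/-- The monomial in `u = p.1 + p.2` and `v = p.1 - p.2` with a factor `u` for each point coloured
`true` and a factor `v` for each point coloured `false`. -/
noncomputable def mixed {X : Type*} [Fintype X] (κ : X → Bool) (p : ℝ × ℝ) : ℝ :=
  ∏ x, if κ x then p.1 + p.2 else p.1 - p.2

theorem quart_nonneg (p : ℝ × ℝ) : 0 ≤ quart p := by unfold quart; positivity

/-- Since `p ^ 4 + q ^ 4 = (3 / 2) (p ^ 2 + q ^ 2) ^ 2 - (u ^ 4 + v ^ 4) / 4`, the density is a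
radial one times the exponential of a polynomial in `u` and `v` with positive coefficients. -/
theorem twoSite_eq (g a : ℝ) (p : ℝ × ℝ) :
    twoSite g a p = Real.exp (g / 4 * quart p) * radial g a p := by
  unfold twoSite radial quart
  rw [← Real.exp_add, ← Real.exp_add]
  congr 1
  ring

theorem radial_nonneg (g a : ℝ) (p : ℝ × ℝ) : 0 ≤ radial g a p := (Real.exp_pos _).le

theorem radial_le_twoSite {g : ℝ} (hg : 0 < g) (a : ℝ) (p : ℝ × ℝ) :
    radial g a p ≤ twoSite g a p := by
  rw [twoSite_eq]
  refine le_mul_of_one_le_left (radial_nonneg g a p) (Real.one_le_exp ?_)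
  have := quart_nonneg p
  positivity

theorem continuous_twoSite (g a : ℝ) : Continuous (twoSite g a) := by unfold twoSite; fun_prop

theorem continuous_radial (g a : ℝ) : Continuous (radial g a) := by unfold radial; fun_prop

theorem continuous_quart : Continuous quart := by unfold quart; fun_prop

theorem continuous_mixed {X : Type*} [Fintype X] (κ : X → Bool) : Continuous (mixed κ) := by
  unfold mixed
  refine continuous_finsetProd _ fun x _ => ?_
  split_ifs <;> fun_prop

/-- Both `|u|` and `|v|` are bounded by this function. -/
noncomputable def growth (p : ℝ × ℝ) : ℝ := (1 + |p.1|) * (1 + |p.2|)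

theorem abs_add_le_growth (p : ℝ × ℝ) : |p.1 + p.2| ≤ growth p := by
  unfold growth
  nlinarith [abs_add_le p.1 p.2, abs_nonneg p.1, abs_nonneg p.2,
    mul_nonneg (abs_nonneg p.1) (abs_nonneg p.2)]

theorem abs_sub_le_growth (p : ℝ × ℝ) : |p.1 - p.2| ≤ growth p := by
  unfold growth
  nlinarith [abs_sub p.1 p.2, abs_nonneg p.1, abs_nonneg p.2,
    mul_nonneg (abs_nonneg p.1) (abs_nonneg p.2)]

theorem abs_mixed_le {X : Type*} [Fintype X] (κ : X → Bool) (p : ℝ × ℝ) :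
    |mixed κ p| ≤ growth p ^ Fintype.card X := by
  unfold mixed
  rw [Finset.abs_prod, ← Finset.card_univ, ← Finset.prod_const]
  refine Finset.prod_le_prod (fun _ _ => abs_nonneg _) fun x _ => ?_
  split_ifs
  · exact abs_add_le_growth p
  · exact abs_sub_le_growth p

theorem quart_le_growth (p : ℝ × ℝ) : quart p ≤ 2 * growth p ^ 4 := by
  have h1 := pow_le_pow_left₀ (abs_nonneg _) (abs_add_le_growth p) 4
  have h2 := pow_le_pow_left₀ (abs_nonneg _) (abs_sub_le_growth p) 4
  rw [Even.pow_abs (by decide)] at h1 h2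
  unfold quart
  linarith

theorem integrable_growth_twoSite {g : ℝ} (hg : 0 < g) (a : ℝ) (k : ℕ) :
    Integrable fun p => growth p ^ k * twoSite g a p := by
  have h : Integrable fun x : ℝ => (1 + |x|) ^ k * Real.exp (-g * x ^ 4 - a * x ^ 2) := by
    simpa using integrable_quartic hg a 0 k
  refine (h.mul_prod h).congr (Filter.Eventually.of_forall fun p => ?_)
  simp only [growth, twoSite, mul_pow]
  ring

theorem integrable_mixed_quart_twoSite {g : ℝ} (hg : 0 < g) (a : ℝ) {X : Type*} [Fintype X]
    (κ : X → Bool) (j : ℕ) : Integrable fun p => mixed κ p * (quart p ^ j * twoSite g a p) := by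
  refine ((integrable_growth_twoSite hg a (Fintype.card X + 4 * j)).const_mul (2 ^ j)).mono'
    ((continuous_mixed κ).mul ((continuous_quart.pow j).mul
      (continuous_twoSite g a))).aestronglyMeasurable (Filter.Eventually.of_forall fun p => ?_)
  have h0 : 0 ≤ growth p := (abs_nonneg _).trans (abs_add_le_growth p)
  have ht : 0 ≤ twoSite g a p := (radial_nonneg g a p).trans (radial_le_twoSite hg a p)
  have hq := quart_nonneg p
  rw [Real.norm_eq_abs, abs_mul, abs_of_nonneg (by positivity : 0 ≤ quart p ^ j * twoSite g a p)]
  calc |mixed κ p| * (quart p ^ j * twoSite g a p)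
      ≤ growth p ^ Fintype.card X * ((2 * growth p ^ 4) ^ j * twoSite g a p) := by
        gcongr
        · exact abs_mixed_le κ p
        · exact quart_le_growth p
    _ = _ := by rw [mul_pow, ← pow_mul, pow_add]; ring

theorem integrable_mixed_quart_radial {g : ℝ} (hg : 0 < g) (a : ℝ) {X : Type*} [Fintype X]
    (κ : X → Bool) (j : ℕ) : Integrable fun p => mixed κ p * (quart p ^ j * radial g a p) := by
  refine (integrable_mixed_quart_twoSite hg a κ j).norm.mono'
    ((continuous_mixed κ).mul ((continuous_quart.pow j).mul
      (continuous_radial g a))).aestronglyMeasurable (Filter.Eventually.of_forall fun p => ?_)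
  have hq := quart_nonneg p
  have hr := radial_nonneg g a p
  have ht := radial_le_twoSite hg a p
  rw [norm_mul, norm_mul (mixed κ p),
    Real.norm_of_nonneg (by positivity : 0 ≤ quart p ^ j * radial g a p),
    Real.norm_of_nonneg (mul_nonneg (pow_nonneg hq j) (hr.trans ht))]
  gcongr

/-! ### Colourings with a given number of points of each colour -/

open Classical in
theorem prod_ite_pow {X : Type*} [Fintype X] (κ : X → Bool) (x : ℝ) :
    ∏ s, (if κ s then x else 1) = x ^ Fintype.card {s // κ s = true} := by
  rw [Finset.prod_ite, Finset.prod_const, Finset.prod_const_one, mul_one, Fintype.card_subtype]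

/-- A function on colourings that is invariant under permutations is determined by its
generating polynomial in the number of points of the first colour. -/
theorem eq_zero_of_generating_eq_zero {X : Type*} [Fintype X] [DecidableEq X]
    (D : (X → Bool) → ℝ)
    (hD : ∀ (σ : Equiv.Perm X) κ, D (κ ∘ σ) = D κ)
    (h : ∀ x : ℝ, ∑ κ, D κ * ∏ s, (if κ s then x else 1) = 0) (κ : X → Bool) : D κ = 0 := by
  classical
  set P : Polynomial ℝ := ∑ κ : X → Bool,
    Polynomial.C (D κ) * Polynomial.X ^ Fintype.card {s // κ s = true} with hP
  have hP0 : P = 0 := by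
    refine Polynomial.funext fun x => ?_
    rw [hP, Polynomial.eval_finsetSum, Polynomial.eval_zero, ← h x]
    refine Finset.sum_congr rfl fun κ _ => ?_
    rw [prod_ite_pow]
    simp
  have hc : P.coeff (Fintype.card {s // κ s = true}) = 0 := by rw [hP0]; simp
  rw [hP, Polynomial.finsetSum_coeff] at hc
  simp only [Polynomial.coeff_C_mul, Polynomial.coeff_X_pow, mul_ite, mul_one, mul_zero] at hc
  rw [← Finset.sum_filter] at hc
  have hconst : ∀ κ' ∈ Finset.univ.filter (fun κ' : X → Bool =>
      Fintype.card {s // κ s = true} = Fintype.card {s // κ' s = true}), D κ' = D κ := by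
    intro κ' hκ'
    have h1 := (Finset.mem_filter.1 hκ').2
    have h2 : Fintype.card {s // κ s = false} = Fintype.card {s // κ' s = false} := by
      have e1 := Fintype.card_subtype_compl (fun s => κ s = true)
      have e2 := Fintype.card_subtype_compl (fun s => κ' s = true)
      simp only [Bool.not_eq_true] at e1 e2
      rw [e1, e2, h1]
    have e : ∀ b, {s // κ' s = b} ≃ {s // κ s = b} := fun b =>
      match b with
      | true => (Fintype.equivOfCardEq h1).symm
      | false => (Fintype.equivOfCardEq h2).symm
    rw [← hD (Equiv.ofFiberEquiv e) κ]
    congr 1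
    funext s
    exact (Equiv.ofFiberEquiv_map e s).symm
  rw [Finset.sum_congr rfl hconst, Finset.sum_const, nsmul_eq_mul] at hc
  refine (mul_eq_zero.1 hc).resolve_left ?_
  refine Nat.cast_ne_zero.2 ?_
  exact Finset.card_ne_zero_of_mem (Finset.mem_filter.2 ⟨Finset.mem_univ κ, rfl⟩)

/-- The mixed monomials, summed over the colourings with a factor `x` for each point coloured
`true`, form the power of a linear form. -/
theorem sum_mixed {X : Type*} [Fintype X] [DecidableEq X] (x : ℝ) (p : ℝ × ℝ) :
    ∑ κ : X → Bool, mixed κ p * ∏ s, (if κ s then x else 1)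
      = ((x + 1) * p.1 + (x - 1) * p.2) ^ Fintype.card X := by
  have h : (x + 1) * p.1 + (x - 1) * p.2
      = ∑ b : Bool, (if b then p.1 + p.2 else p.1 - p.2) * (if b then x else 1) := by
    rw [Fintype.sum_bool]
    simp only [if_true, Bool.false_eq_true, if_false]
    ring
  rw [h, ← Finset.card_univ, ← Finset.prod_const, Finset.prod_univ_sum, Fintype.piFinset_univ]
  refine Finset.sum_congr rfl fun κ _ => ?_
  rw [mixed, ← Finset.prod_mul_distrib]

/-! ### Moments of the radial density -/

/-- A linear form and a multiple of the first coordinate have the same moments under a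
rotation-invariant density. The rotation is multiplication by a complex number of modulus one. -/
theorem integral_linear_pow_radial (g a : ℝ) (N : ℕ) (α β : ℝ) :
    ∫ p : ℝ × ℝ, (α * p.1 + β * p.2) ^ N * radial g a p
      = (Real.sqrt (α ^ 2 + β ^ 2)) ^ N * ∫ p : ℝ × ℝ, p.1 ^ N * radial g a p := by
  have toC : ∀ F : ℝ × ℝ → ℝ, ∫ p : ℝ × ℝ, F p = ∫ z : ℂ, F (z.re, z.im) := fun F =>
    (Complex.volume_preserving_equiv_real_prod.integral_comp'
      (f := Complex.measurableEquivRealProd) F).symm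
  have hrad : ∀ z : ℂ, radial g a (z.re, z.im)
      = Real.exp (-(3 * g / 2) * (‖z‖ ^ 2) ^ 2 - a * ‖z‖ ^ 2) := fun z => by
    rw [← Complex.normSq_eq_norm_sq, Complex.normSq_apply, radial]
    ring_nf
  rw [toC, toC]
  simp only [hrad]
  obtain ⟨c, hc⟩ : ∃ c : Circle, (⟨α, -β⟩ : ℂ) = Real.sqrt (α ^ 2 + β ^ 2) * c := by
    -- The conjugate appears because `α * re z + β * im z` is the real part of `(α - β * I) * z`.
    refine ⟨Circle.exp (Complex.arg ⟨α, -β⟩), ?_⟩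
    have h := Complex.norm_mul_exp_arg_mul_I ⟨α, -β⟩
    rw [Circle.coe_exp, ← h]
    congr 2
    · rw [Complex.norm_def, Complex.normSq_mk]
      ring_nf
    · rw [h]
  have hrot := ((rotation c).measurePreserving.integral_comp'
    (f := (rotation c).toMeasurableEquiv)
    (fun z : ℂ => z.re ^ N * Real.exp (-(3 * g / 2) * (‖z‖ ^ 2) ^ 2 - a * ‖z‖ ^ 2)))
  rw [← hrot, ← integral_const_mul]
  refine integral_congr_ae (Filter.Eventually.of_forall fun z => ?_)
  have h1 : α * z.re + β * z.im = Real.sqrt (α ^ 2 + β ^ 2) * (rotation c z).re := by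
    have h3 : ((Real.sqrt (α ^ 2 + β ^ 2) : ℂ) * (rotation c z)).re
        = α * z.re + β * z.im := by
      rw [rotation_apply, ← mul_assoc, ← hc, Complex.mul_re]
      ring
    rw [← h3, Complex.re_ofReal_mul]
  have h2 : ‖(rotation c).toMeasurableEquiv z‖ = ‖z‖ := (rotation c).norm_map z
  simp only [h2]
  rw [h1, mul_pow, mul_assoc]
  rfl

theorem integral_odd_pow_radial (g a : ℝ) {N : ℕ} (hN : Odd N) :
    ∫ p : ℝ × ℝ, p.1 ^ N * radial g a p = 0 := by
  have h := integral_linear_pow_radial g a N (-1) 0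
  simp only [neg_mul, one_mul, zero_mul, add_zero, hN.neg_pow, integral_neg] at h
  norm_num at h
  linarith

/-! ### Expansion of mixed moments over even partitions -/

open Classical in
/-- The mixed moments of `u` and `v` under the density `f` are given by nonnegative weights on
even partitions: the moment with colouring `κ` is the total weight of the partitions each class of
which has a single colour. -/
def HasPartitionExpansion (f : ℝ × ℝ → ℝ) : Prop :=
  ∀ (X : Type u) [Fintype X], ∃ Q : EvenPart X → ℝ, (∀ r, 0 ≤ Q r) ∧
    ∀ κ : X → Bool, ∫ p, mixed κ p * f p = ∑ r, if Respects r.1 κ then Q r else 0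

/-- The partition into pairs given by a bijection with `Fin n × Bool`. -/
def pairing {X : Type u} {n : ℕ} (e : X ≃ Fin n × Bool) : EvenPart X :=
  ⟨Setoid.ker fun x => (e x).1, fun w => by
    have h : {x | Setoid.ker (fun x => (e x).1) x w}
        = e.symm '' Set.range (fun b : Bool => ((e w).1, b)) := by
      ext x
      simp only [Set.mem_ofPred_eq, Setoid.ker_def, Set.mem_image, Set.mem_range,
        exists_exists_eq_and]
      constructor
      · intro hx
        exact ⟨(e x).2, by rw [← hx]; simp⟩
      · rintro ⟨b, rfl⟩
        simp
    rw [h, Set.ncard_image_of_injective _ e.symm.injective, ← Set.image_univ,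
      Set.ncard_image_of_injective _ (fun b c hbc => (Prod.mk.inj hbc).2), Set.ncard_univ]
    simp⟩

theorem respects_pairing {X : Type u} {n : ℕ} (e : X ≃ Fin n × Bool) (κ : X → Bool) :
    Respects (pairing e).1 κ ↔ ∃ κ' : Fin n → Bool, κ = fun x => κ' (e x).1 := by
  constructor
  · intro h
    refine ⟨fun i => κ (e.symm (i, true)), funext fun x => h _ _ ?_⟩
    change (e x).1 = (e (e.symm ((e x).1, true))).1
    simp
  · rintro ⟨κ', rfl⟩ x y hxy
    have : (e x).1 = (e y).1 := hxy
    simp only [this]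

open Classical in
/-- The generating polynomial of the colourings that are constant on the pairs. Up to a constant, it
is the generating polynomial of the mixed moments of a rotation-invariant density. -/
theorem sum_respects_pairing {X : Type u} [Fintype X] {n : ℕ} (e : X ≃ Fin n × Bool) (x : ℝ) :
    ∑ κ : X → Bool, (if Respects (pairing e).1 κ then 1 else 0) * ∏ s, (if κ s then x else 1)
      = (x ^ 2 + 1) ^ n := by
  have h1 : x ^ 2 + 1 = ∑ b : Bool, (if b then x ^ 2 else 1) := by simp
  have h2 : (x ^ 2 + 1) ^ n = ∑ κ' : Fin n → Bool, ∏ i, (if κ' i then x ^ 2 else 1) := by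
    conv_lhs => rw [h1, ← Fintype.card_fin n, ← Finset.card_univ, ← Finset.prod_const,
      Finset.prod_univ_sum, Fintype.piFinset_univ]
  simp only [ite_mul, one_mul, zero_mul]
  rw [h2, ← Finset.sum_filter]
  symm
  refine Finset.sum_bij (fun κ' _ => fun x => κ' (e x).1) ?_ ?_ ?_ ?_
  · intro κ' _
    exact Finset.mem_filter.2 ⟨Finset.mem_univ _, (respects_pairing e _).2 ⟨κ', rfl⟩⟩
  · intro κ₁ _ κ₂ _ h
    funext i
    simpa using congrFun h (e.symm (i, true))
  · intro κ hκ
    obtain ⟨κ', rfl⟩ := (respects_pairing e κ).1 (Finset.mem_filter.1 hκ).2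
    exact ⟨κ', Finset.mem_univ _, rfl⟩
  · intro κ' _
    rw [Fintype.prod_equiv e _ (fun ib : Fin n × Bool => if κ' ib.1 then x else 1)
      (fun _ => rfl), Fintype.prod_prod_type]
    refine Finset.prod_congr rfl fun i _ => ?_
    simp only [Fintype.prod_bool]
    split_ifs <;> ring

theorem mixed_comp_perm {X : Type*} [Fintype X] (σ : Equiv.Perm X) (κ : X → Bool) (p : ℝ × ℝ) :
    mixed (κ ∘ σ) p = mixed κ p := by
  unfold mixed
  exact Equiv.prod_comp σ fun x => if κ x then p.1 + p.2 else p.1 - p.2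

theorem sum_integral_mixed_radial {g : ℝ} (hg : 0 < g) (a : ℝ) {X : Type*} [Fintype X]
    [DecidableEq X] (x : ℝ) :
    ∑ κ : X → Bool, (∫ p, mixed κ p * radial g a p) * ∏ s, (if κ s then x else 1)
      = Real.sqrt ((x + 1) ^ 2 + (x - 1) ^ 2) ^ Fintype.card X
        * ∫ p : ℝ × ℝ, p.1 ^ Fintype.card X * radial g a p := by
  rw [← integral_linear_pow_radial]
  simp only [← sum_mixed, Finset.sum_mul]
  rw [integral_finsetSum]
  · refine Finset.sum_congr rfl fun κ _ => ?_
    rw [← integral_mul_const]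
    refine integral_congr_ae (Filter.Eventually.of_forall fun p => ?_)
    dsimp only
    ring
  · intro κ _
    have := (integrable_mixed_quart_radial hg a κ 0).mul_const (∏ s, (if κ s then x else 1))
    refine this.congr (Filter.Eventually.of_forall fun p => ?_)
    dsimp only
    ring

/-- For the rotation-invariant density, the weights are uniform over the partitions into
pairs. -/
theorem hasPartitionExpansion_radial {g : ℝ} (hg : 0 < g) (a : ℝ) :
    HasPartitionExpansion.{u} (radial g a) := by
  classical
  intro X _
  rcases Nat.even_or_odd (Fintype.card X) with hN | hN
  · obtain ⟨n, hn⟩ := hN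
    have hn2 : Fintype.card X = 2 * n := by omega
    set c : ℝ := ∫ p : ℝ × ℝ, p.1 ^ Fintype.card X * radial g a p with hc
    have hc0 : 0 ≤ c := integral_nonneg fun p =>
      mul_nonneg ((show Even (Fintype.card X) from ⟨n, hn⟩).pow_nonneg _) (radial_nonneg g a p)
    have hne : Nonempty (X ≃ Fin n × Bool) := ⟨Fintype.equivOfCardEq (by
      rw [Fintype.card_prod, Fintype.card_fin, Fintype.card_bool, hn2, mul_comm])⟩
    set E : ℝ := ((Fintype.card (X ≃ Fin n × Bool) : ℕ) : ℝ) with hE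
    have hE0 : E ≠ 0 := Nat.cast_ne_zero.2 Fintype.card_ne_zero
    set Q : EvenPart X → ℝ := fun r =>
      2 ^ n * c / E * ∑ e : X ≃ Fin n × Bool, if pairing e = r then 1 else 0 with hQ
    have hsum : ∀ κ : X → Bool, (∑ r, if Respects r.1 κ then Q r else 0)
        = 2 ^ n * c / E * ∑ e : X ≃ Fin n × Bool,
          if Respects (pairing e).1 κ then 1 else 0 := by
      intro κ
      have h1 : ∀ r : EvenPart X, (if Respects r.1 κ then Q r else 0)
          = 2 ^ n * c / E * ∑ e : X ≃ Fin n × Bool,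
            if pairing e = r then (if Respects r.1 κ then 1 else 0) else 0 := by
        intro r
        by_cases h : Respects r.1 κ <;> simp [h, hQ]
      rw [Finset.sum_congr rfl fun r _ => h1 r, ← Finset.mul_sum, Finset.sum_comm]
      congr 1
      refine Finset.sum_congr rfl fun e _ => ?_
      simp
    refine ⟨Q, fun r => ?_, fun κ => ?_⟩
    · refine mul_nonneg (by positivity) (Finset.sum_nonneg fun e _ => ?_)
      split_ifs <;> norm_num
    · refine sub_eq_zero.1 (eq_zero_of_generating_eq_zero (fun κ : X → Bool =>
        (∫ p, mixed κ p * radial g a p) - ∑ r, if Respects r.1 κ then Q r else 0) ?_ ?_ κ)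
      · intro σ κ
        simp only [mixed_comp_perm, hsum]
        congr 2
        refine Fintype.sum_equiv (Equiv.equivCongr σ (Equiv.refl _)) _ _ fun e => ?_
        have : Respects (pairing e).1 (κ ∘ σ)
            ↔ Respects (pairing (Equiv.equivCongr σ (Equiv.refl _) e)).1 κ := by
          rw [respects_pairing, respects_pairing]
          refine exists_congr fun κ' => ?_
          constructor
          · intro h
            funext x
            simpa using congrFun h (σ.symm x)
          · intro h
            funext x
            simpa using congrFun h (σ x)
        simp only [this]
      · intro x
        simp only [sub_mul, Finset.sum_sub_distrib]
        rw [sum_integral_mixed_radial hg]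
        simp only [hsum, mul_assoc, Finset.sum_mul]
        rw [← Finset.mul_sum, Finset.sum_comm]
        simp only [sum_respects_pairing, Finset.sum_const, Finset.card_univ, nsmul_eq_mul]
        rw [← hE, ← hc, hn2, pow_mul, Real.sq_sqrt (by positivity),
          show (x + 1) ^ 2 + (x - 1) ^ 2 = 2 * (x ^ 2 + 1) by ring, mul_pow]
        field_simp
        ring
  · refine ⟨fun _ => 0, fun _ => le_rfl, fun κ => ?_⟩
    simp only [ite_self, Finset.sum_const_zero]
    refine eq_zero_of_generating_eq_zero (fun κ : X → Bool => ∫ p, mixed κ p * radial g a p)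
      (fun σ κ => by simp only [mixed_comp_perm]) (fun x => ?_) κ
    rw [sum_integral_mixed_radial hg, integral_odd_pow_radial g a hN, mul_zero]

theorem mixed_elim {X T : Type*} [Fintype X] [Fintype T] (κ : X → Bool) (b : Bool) (p : ℝ × ℝ) :
    mixed (Sum.elim κ fun _ : T => b) p
      = mixed κ p * (if b then p.1 + p.2 else p.1 - p.2) ^ Fintype.card T := by
  cases b <;> simp only [mixed, Fintype.prod_sum_type, Sum.elim_inl, Sum.elim_inr] <;> simp <;>
    exact Or.inl rfl

open Classical in
/-- Multiplication of the density by `u ^ 4 + v ^ 4` adds four points of the same colour, and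
merges the classes containing them. -/
theorem HasPartitionExpansion.quart_mul {f : ℝ × ℝ → ℝ} (hf : HasPartitionExpansion.{u} f)
    (hint : ∀ (X : Type u) [Fintype X] (κ : X → Bool), Integrable fun p => mixed κ p * f p) :
    HasPartitionExpansion.{u} fun p => quart p * f p := by
  intro X _
  obtain ⟨Q, hQ, h⟩ := hf (X ⊕ ULift.{u} (Fin 4))
  have hT : Even (Nat.card (ULift.{u} (Fin 4))) := by
    rw [Nat.card_eq_fintype_card, Fintype.card_ulift, Fintype.card_fin]
    decide
  have : Nonempty (ULift.{u} (Fin 4)) := ⟨⟨0⟩⟩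
  refine ⟨fun r => ∑ r' : EvenPart (X ⊕ ULift.{u} (Fin 4)), if r'.collapse hT = r then
    Q r' * (if ∃ x t, r'.1 (.inl x) (.inr t) then 1 else 2) else 0, fun r => ?_, fun κ => ?_⟩
  · refine Finset.sum_nonneg fun r' _ => ?_
    have := hQ r'
    split_ifs <;> positivity
  · have e1 : ∀ p, mixed κ p * (quart p * f p)
        = mixed (Sum.elim κ fun _ : ULift.{u} (Fin 4) => true) p * f p
          + mixed (Sum.elim κ fun _ : ULift.{u} (Fin 4) => false) p * f p := by
      intro p
      rw [mixed_elim, mixed_elim, quart]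
      simp only [if_true, Bool.false_eq_true, if_false, Fintype.card_ulift, Fintype.card_fin]
      ring
    simp only [e1]
    rw [integral_add (hint _ _) (hint _ _), h, h, ← Finset.sum_add_distrib]
    have e2 : ∀ r : EvenPart X, (if Respects r.1 κ then
        (∑ r' : EvenPart (X ⊕ ULift.{u} (Fin 4)), if r'.collapse hT = r then
          Q r' * (if ∃ x t, r'.1 (.inl x) (.inr t) then 1 else 2) else 0) else 0)
        = ∑ r' : EvenPart (X ⊕ ULift.{u} (Fin 4)), if r'.collapse hT = r then
          (if Respects r.1 κ then
            Q r' * (if ∃ x t, r'.1 (.inl x) (.inr t) then 1 else 2) else 0) else 0 := by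
      intro r
      by_cases hr : Respects r.1 κ <;> simp [hr]
    simp only [e2]
    rw [Finset.sum_comm]
    refine Finset.sum_congr rfl fun r' _ => ?_
    rw [Finset.sum_ite_eq, if_pos (Finset.mem_univ _)]
    have e3 := respects_collapse r'.1 κ
    calc _ = Q r' * ((if Respects r'.1 (Sum.elim κ fun _ => true) then 1 else 0)
            + if Respects r'.1 (Sum.elim κ fun _ => false) then 1 else 0) := by
          simp only [mul_add, mul_ite, mul_one, mul_zero]
      _ = _ := by
          rw [e3, mul_ite, mul_zero]
          change _ = if Respects (collapseSetoid r'.1) κ then _ else _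
          congr

theorem hasPartitionExpansion_quart_pow {g : ℝ} (hg : 0 < g) (a : ℝ) (j : ℕ) :
    HasPartitionExpansion.{u} fun p => quart p ^ j * radial g a p := by
  induction j with
  | zero => simpa using hasPartitionExpansion_radial.{u} hg a
  | succ j ih =>
    have := ih.quart_mul fun X _ κ => integrable_mixed_quart_radial hg a κ j
    simpa only [pow_succ', mul_assoc] using this

/-- All terms of the expansion of `exp ((g / 4) * quart p)` are nonnegative, so the series may be
integrated term by term, with the absolute value of the integrand as the dominating function. -/
theorem hasSum_integral_mixed {g : ℝ} (hg : 0 < g) (a : ℝ) {X : Type*} [Fintype X]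
    (κ : X → Bool) :
    HasSum (fun j : ℕ => (g / 4) ^ j / j.factorial
        * ∫ p, mixed κ p * (quart p ^ j * radial g a p))
      (∫ p, mixed κ p * twoSite g a p) := by
  have hexp : ∀ p, HasSum (fun j : ℕ => (g / 4) ^ j / j.factorial
      * (quart p ^ j * radial g a p)) (twoSite g a p) := by
    intro p
    rw [twoSite_eq]
    have := (NormedSpace.expSeries_div_hasSum_exp (g / 4 * quart p)).mul_right (radial g a p)
    rw [← Real.exp_eq_exp_ℝ] at this
    refine this.congr_fun fun j => ?_
    rw [mul_pow]
    ring
  simp only [← integral_const_mul]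
  refine hasSum_integral_of_dominated_convergence
    (fun (j : ℕ) p => ‖mixed κ p‖ * ((g / 4) ^ j / j.factorial * (quart p ^ j * radial g a p)))
    (fun j => ((integrable_mixed_quart_radial hg a κ j).const_mul _).aestronglyMeasurable)
    (fun j => Filter.Eventually.of_forall fun p => ?_)
    (Filter.Eventually.of_forall fun p => ((hexp p).mul_left _).summable) ?_
    (Filter.Eventually.of_forall fun p => ?_)
  · have := quart_nonneg p
    have := radial_nonneg g a p
    rw [norm_mul, norm_mul (mixed κ p), Real.norm_of_nonneg (by positivity :
      0 ≤ (g / 4) ^ j / (j.factorial : ℝ)), Real.norm_of_nonneg (by positivity :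
      0 ≤ quart p ^ j * radial g a p)]
    exact le_of_eq (by ring)
  · simp only [((hexp _).mul_left _).tsum_eq]
    refine (integrable_mixed_quart_twoSite hg a κ 0).norm.congr
      (Filter.Eventually.of_forall fun p => ?_)
    have : 0 ≤ twoSite g a p := (radial_nonneg g a p).trans (radial_le_twoSite hg a p)
    simp only [pow_zero, one_mul, norm_mul, Real.norm_of_nonneg this]
  · refine ((hexp p).mul_left (mixed κ p)).congr_fun fun j => ?_
    ring

theorem hasPartitionExpansion_twoSite {g : ℝ} (hg : 0 < g) (a : ℝ) :
    HasPartitionExpansion.{u} (twoSite g a) := by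
  classical
  intro X _
  choose Q hQ h using fun j => hasPartitionExpansion_quart_pow.{u} hg a j X
  have hc : ∀ j : ℕ, 0 ≤ (g / 4) ^ j / (j.factorial : ℝ) := fun j => by positivity
  have hs : ∀ r, Summable fun j : ℕ => (g / 4) ^ j / (j.factorial : ℝ) * Q j r := by
    intro r
    refine Summable.of_nonneg_of_le (fun j => mul_nonneg (hc j) (hQ j r)) (fun j => ?_)
      (hasSum_integral_mixed hg a (fun _ : X => true)).summable
    refine mul_le_mul_of_nonneg_left ?_ (hc j)
    have hresp : ∀ r : EvenPart X, Respects r.1 fun _ : X => true := fun _ _ _ _ => rfl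
    rw [h j]
    simp only [hresp, if_true]
    exact Finset.single_le_sum (fun r _ => hQ j r) (Finset.mem_univ r)
  refine ⟨fun r => ∑' j : ℕ, (g / 4) ^ j / (j.factorial : ℝ) * Q j r,
    fun r => tsum_nonneg fun j => mul_nonneg (hc j) (hQ j r), fun κ => ?_⟩
  refine (hasSum_integral_mixed hg a κ).unique ?_
  have : HasSum (fun j : ℕ => ∑ r, if Respects r.1 κ then
      (g / 4) ^ j / (j.factorial : ℝ) * Q j r else 0)
      (∑ r, if Respects r.1 κ then ∑' j : ℕ, (g / 4) ^ j / (j.factorial : ℝ) * Q j r else 0) := by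
    refine hasSum_sum fun r _ => ?_
    split_ifs
    · exact (hs r).hasSum
    · exact hasSum_zero
  refine this.congr_fun fun j => ?_
  rw [h j, Finset.mul_sum]
  refine Finset.sum_congr rfl fun r _ => ?_
  split_ifs <;> simp

/-! ### Moments of the single-site measure -/

/-- The moments of the single-site measure. -/
noncomputable def spinMoment (g a : ℝ) (k : ℕ) : ℝ := ∫ t, t ^ k ∂(singleSite g a)

theorem integrable_exp_quartic {g : ℝ} (hg : 0 < g) (a : ℝ) :
    Integrable fun t : ℝ => Real.exp (-g * t ^ 4 - a * t ^ 2) := by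
  simpa using integrable_quartic hg a 0 0

theorem isProbabilityMeasure_singleSite {g : ℝ} (hg : 0 < g) (a : ℝ) :
    IsProbabilityMeasure (singleSite g a) :=
  isProbabilityMeasure_tilted (integrable_exp_quartic hg a)

/-- The normalization of the single-site measure. -/
noncomputable def siteNorm (g a : ℝ) : ℝ := ∫ t : ℝ, Real.exp (-g * t ^ 4 - a * t ^ 2)

theorem siteNorm_pos {g : ℝ} (hg : 0 < g) (a : ℝ) : 0 < siteNorm g a :=
  integral_exp_pos (integrable_exp_quartic hg a)

theorem integral_singleSite (g a : ℝ) (f : ℝ → ℝ) :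
    ∫ t, f t ∂(singleSite g a)
      = (∫ t, f t * Real.exp (-g * t ^ 4 - a * t ^ 2)) / siteNorm g a := by
  rw [singleSite, integral_tilted, ← integral_div]
  refine integral_congr_ae (Filter.Eventually.of_forall fun t => ?_)
  simp only [smul_eq_mul, siteNorm]
  ring

theorem integrable_singleSite {g : ℝ} (hg : 0 < g) (a b : ℝ) (k : ℕ) :
    Integrable (fun t : ℝ => (1 + |t|) ^ k * Real.exp (b * t ^ 2)) (singleSite g a) := by
  rw [singleSite, integrable_tilted_iff (integrable_exp_quartic hg a)]
  refine (integrable_quartic hg a b k).congr (Filter.Eventually.of_forall fun t => ?_)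
  simp only [smul_eq_mul]
  ring

theorem spinMoment_zero {g : ℝ} (hg : 0 < g) (a : ℝ) : spinMoment g a 0 = 1 := by
  have := isProbabilityMeasure_singleSite hg a
  simp [spinMoment]

theorem spinMoment_odd (g a : ℝ) {k : ℕ} (hk : Odd k) : spinMoment g a k = 0 := by
  rw [spinMoment, integral_singleSite]
  have h := integral_neg_eq_self (fun t : ℝ => t ^ k * Real.exp (-g * t ^ 4 - a * t ^ 2)) volume
  have e4 : ∀ t : ℝ, (-t) ^ 4 = t ^ 4 := fun t => by ring
  have e2 : ∀ t : ℝ, (-t) ^ 2 = t ^ 2 := fun t => by ring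
  simp only [hk.neg_pow, e4, e2, neg_mul (_ ^ k), integral_neg] at h
  rw [show ∫ t : ℝ, t ^ k * Real.exp (-g * t ^ 4 - a * t ^ 2) = 0 by linarith, zero_div]

theorem spinMoment_pos {g : ℝ} (hg : 0 < g) (a : ℝ) {k : ℕ} (hk : Even k) :
    0 < spinMoment g a k := by
  rw [spinMoment, integral_singleSite]
  refine div_pos ?_ (siteNorm_pos hg a)
  have hint : Integrable fun t : ℝ => t ^ k * Real.exp (-g * t ^ 4 - a * t ^ 2) := by
    refine (integrable_quartic hg a 0 k).mono' (by fun_prop)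
      (Filter.Eventually.of_forall fun t => ?_)
    rw [zero_mul, Real.exp_zero, mul_one, norm_mul, norm_pow,
      Real.norm_of_nonneg (Real.exp_nonneg _)]
    gcongr
    rw [Real.norm_eq_abs]
    linarith
  rw [integral_pos_iff_support_of_nonneg (fun t => mul_nonneg (hk.pow_nonneg t)
    (Real.exp_nonneg _)) hint]
  refine lt_of_lt_of_le ?_ (measure_mono (show Set.Ioi (0 : ℝ) ⊆ _ from fun t ht => ?_))
  · simp
  · have ht' : (0 : ℝ) < t := ht
    exact (mul_pos (pow_pos ht' k) (Real.exp_pos _)).ne'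

theorem spinMoment_nonneg {g : ℝ} (hg : 0 < g) (a : ℝ) (k : ℕ) : 0 ≤ spinMoment g a k := by
  rcases Nat.even_or_odd k with hk | hk
  · exact (spinMoment_pos hg a hk).le
  · exact (spinMoment_odd g a hk).ge

theorem spinMoment_mul (g a : ℝ) (i j : ℕ) :
    spinMoment g a i * spinMoment g a j
      = (∫ p : ℝ × ℝ, p.1 ^ i * p.2 ^ j * twoSite g a p) / siteNorm g a ^ 2 := by
  rw [spinMoment, spinMoment, integral_singleSite, integral_singleSite, div_mul_div_comm,
    ← integral_prod_mul, ← Measure.volume_eq_prod, sq]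
  congr 1
  refine integral_congr_ae (Filter.Eventually.of_forall fun p => ?_)
  simp only [twoSite]
  ring

/-! ### Weights on partitions representing products of two moments -/

/-- The sign with which a colouring enters the expansion of `(u + v) ^ i * (u - v) ^ j`, where the
second group of factors is indexed by the points with `τ x = false`. -/
noncomputable def colourSign {X : Type*} [Fintype X] (τ κ : X → Bool) : ℝ :=
  ∏ x, if τ x || κ x then 1 else -1

/-- The expansion of `(u + v) ^ i * (u - v) ^ j = (2 * p.1) ^ i * (2 * p.2) ^ j` over the
colourings. -/
theorem sum_mixed_mul_sign {X : Type*} [Fintype X] [DecidableEq X] (τ : X → Bool) (p : ℝ × ℝ) :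
    ∑ κ : X → Bool, mixed κ p * colourSign τ κ
      = 2 ^ Fintype.card X * (p.1 ^ Fintype.card {x // τ x = true}
        * p.2 ^ Fintype.card {x // τ x = false}) := by
  have h : ∀ x, (if τ x then 2 * p.1 else 2 * p.2)
      = ∑ b : Bool, (if b then p.1 + p.2 else p.1 - p.2) * (if τ x || b then 1 else -1) := by
    intro x
    rw [Fintype.sum_bool]
    cases τ x <;> simp <;> ring
  have h2 : ∏ x, (if τ x then 2 * p.1 else 2 * p.2)
      = 2 ^ Fintype.card X * (p.1 ^ Fintype.card {x // τ x = true}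
        * p.2 ^ Fintype.card {x // τ x = false}) := by
    have : ∀ x, (if τ x then 2 * p.1 else 2 * p.2)
        = 2 * ((if τ x = true then p.1 else 1) * (if τ x = false then p.2 else 1)) := by
      intro x
      cases τ x <;> simp
    simp only [this]
    rw [Finset.prod_mul_distrib, Finset.prod_mul_distrib, Finset.prod_const, Finset.card_univ,
      Finset.prod_ite, Finset.prod_ite, Finset.prod_const, Finset.prod_const,
      one_pow, mul_one, Finset.prod_const, Finset.prod_const_one, mul_one, Fintype.card_subtype,
      Fintype.card_subtype]
  rw [← h2]
  simp only [h]
  rw [Finset.prod_univ_sum, Fintype.piFinset_univ]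
  refine Finset.sum_congr rfl fun κ _ => ?_
  rw [mixed, colourSign, ← Finset.prod_mul_distrib]

/-- Every class of `r` contains an even number of the points with `τ x = false`. -/
def SplitsEvenly {X : Type*} (r : Setoid X) (τ : X → Bool) : Prop :=
  ∀ w, Even (Set.ncard {x | r x w ∧ τ x = false})

theorem prod_ite_neg_one {X : Type*} [Fintype X] (P : X → Prop) [DecidablePred P] :
    ∏ x, (if P x then (-1 : ℝ) else 1) = if Even (Set.ncard {x | P x}) then 1 else -1 := by
  rw [Finset.prod_ite, Finset.prod_const, Finset.prod_const_one, mul_one,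
    Set.ncard_eq_toFinset_card', Set.toFinset_ofPred]
  split_ifs with h
  · exact h.neg_one_pow
  · exact (Nat.not_even_iff_odd.1 h).neg_one_pow

open Classical in
/-- Flipping the colours of a class that contains an odd number of points with `τ x = false`
changes the sign, so the signs cancel unless `r` splits evenly; in that case all are one. -/
theorem sum_colourSign {X : Type*} [Fintype X] (r : Setoid X) (τ : X → Bool) :
    ∑ κ : X → Bool, (if Respects r κ then colourSign τ κ else 0)
      = if SplitsEvenly r τ then (Fintype.card {κ : X → Bool // Respects r κ} : ℝ) else 0 := by
  split_ifs with h
  · have h1 : ∀ κ : X → Bool, Respects r κ → colourSign τ κ = 1 := by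
      intro κ hκ
      have e : colourSign τ κ = ∏ x, (if κ x = false ∧ τ x = false then (-1 : ℝ) else 1) := by
        refine Finset.prod_congr rfl fun x _ => ?_
        cases τ x <;> cases κ x <;> simp
      rw [e, prod_ite_neg_one, if_pos]
      rw [even_ncard_iff_sum]
      have := sum_saturated_eq_zero r (fun x => if τ x = false then (1 : ZMod 2) else 0)
        (fun x => κ x = false) (fun x y hxy => by rw [hκ x y hxy]) (fun w _ => by
          have := (even_ncard_iff_sum _).1 (h w)
          simpa only [Finset.sum_filter, ite_and] using this)
      simpa only [Finset.sum_filter, ite_and] using this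
    rw [← Finset.sum_filter, Finset.sum_congr rfl fun κ hκ => h1 κ (Finset.mem_filter.1 hκ).2,
      Finset.sum_const, nsmul_one, Fintype.card_subtype]
  · obtain ⟨w, hw⟩ := not_forall.1 h
    have hflip : ∀ κ : X → Bool, Respects r κ →
        Respects r fun x => if r x w then !κ x else κ x := by
      intro κ hκ x y hxy
      have : r x w ↔ r y w := ⟨r.trans (r.symm hxy), r.trans hxy⟩
      simp only [this, hκ x y hxy]
    have hinv : ∀ κ : X → Bool, (fun x => if r x w then !(if r x w then !κ x else κ x) else
        (if r x w then !κ x else κ x)) = κ := by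
      intro κ
      funext x
      by_cases hx : r x w <;> simp [hx]
    rw [← Finset.sum_filter]
    refine Finset.sum_involution (fun κ _ x => if r x w then !κ x else κ x) ?_ ?_ ?_ ?_
    · intro κ hκ
      have e : colourSign τ (fun x => if r x w then !κ x else κ x)
          = colourSign τ κ * ∏ x, (if r x w ∧ τ x = false then (-1 : ℝ) else 1) := by
        rw [colourSign, colourSign, ← Finset.prod_mul_distrib]
        refine Finset.prod_congr rfl fun x _ => ?_
        by_cases hx : r x w <;> cases τ x <;> cases κ x <;> simp [hx]
      rw [e, prod_ite_neg_one, if_neg hw]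
      ring
    · intro κ hκ _ heq
      have := congrFun heq w
      simp only [r.refl w, if_true] at this
      cases hk : κ w <;> simp [hk] at this
    · intro κ hκ
      exact Finset.mem_filter.2 ⟨Finset.mem_univ _, hflip κ (Finset.mem_filter.1 hκ).2⟩
    · intro κ hκ
      exact hinv κ

theorem integrable_mixed_twoSite {g : ℝ} (hg : 0 < g) (a : ℝ) {X : Type*} [Fintype X]
    (κ : X → Bool) : Integrable fun p => mixed κ p * twoSite g a p := by
  simpa using integrable_mixed_quart_twoSite hg a κ 0

open Classical in
/-- The weights on the even partitions of `X` obtained from the mixed moments of `u` and `v` serve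
all splittings `τ` of `X` into two parts. -/
theorem exists_splitting_weight {g : ℝ} (hg : 0 < g) (a : ℝ) (X : Type u) [Fintype X] :
    ∃ W : EvenPart X → ℝ, (∀ r, 0 ≤ W r) ∧ ∀ τ : X → Bool,
      spinMoment g a (Fintype.card {x // τ x = true})
        * spinMoment g a (Fintype.card {x // τ x = false})
      = ∑ r, if SplitsEvenly r.1 τ then W r else 0 := by
  obtain ⟨Q, hQ, h⟩ := hasPartitionExpansion_twoSite.{u} hg a X
  refine ⟨fun r => Q r * (Fintype.card {κ : X → Bool // Respects r.1 κ} : ℝ)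
    / (2 ^ Fintype.card X * siteNorm g a ^ 2), fun r => ?_, fun τ => ?_⟩
  · have := hQ r
    positivity
  · have hZ := (siteNorm_pos hg a).ne'
    have e1 : 2 ^ Fintype.card X * ∫ p : ℝ × ℝ, p.1 ^ Fintype.card {x // τ x = true}
          * p.2 ^ Fintype.card {x // τ x = false} * twoSite g a p
        = ∑ r, if SplitsEvenly r.1 τ then
          Q r * (Fintype.card {κ : X → Bool // Respects r.1 κ} : ℝ) else 0 := by
      calc _ = ∫ p, ∑ κ : X → Bool, colourSign τ κ * (mixed κ p * twoSite g a p) := by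
            rw [← integral_const_mul]
            refine integral_congr_ae (Filter.Eventually.of_forall fun p => ?_)
            dsimp only
            rw [← mul_assoc, ← sum_mixed_mul_sign, Finset.sum_mul]
            exact Finset.sum_congr rfl fun κ _ => by ring
        _ = ∑ κ : X → Bool, colourSign τ κ * ∑ r, if Respects r.1 κ then Q r else 0 := by
            rw [integral_finsetSum _ fun κ _ => (integrable_mixed_twoSite hg a κ).const_mul _]
            simp only [integral_const_mul, h]
        _ = ∑ r, Q r * ∑ κ : X → Bool, if Respects r.1 κ then colourSign τ κ else 0 := by
            simp only [Finset.mul_sum]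
            rw [Finset.sum_comm]
            refine Finset.sum_congr rfl fun r _ => Finset.sum_congr rfl fun κ _ => ?_
            split_ifs <;> ring
        _ = _ := by
            refine Finset.sum_congr rfl fun r _ => ?_
            rw [sum_colourSign]
            split_ifs <;> simp
    rw [spinMoment_mul, div_eq_iff (by positivity), Finset.sum_mul]
    refine mul_left_cancel₀ (pow_ne_zero (Fintype.card X) two_ne_zero) (e1.trans ?_)
    rw [Finset.mul_sum]
    refine Finset.sum_congr rfl fun r _ => ?_
    split_ifs
    · field_simp
    · simp

theorem AdmPart.toEvenPart_injective {X Y : Type u} [Finite X] [Finite Y] :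
    Function.Injective (AdmPart.toEvenPart (X := X) (Y := Y)) := fun _ _ h =>
  Subtype.ext (congrArg (fun r : EvenPart (X ⊕ Y) => r.1) h)

theorem splitsEvenly_isLeft {X Y : Type u} (r : Setoid (X ⊕ Y)) :
    SplitsEvenly r Sum.isLeft ↔ ∀ w, Even (Set.ncard {y : Y | r (.inr y) w}) := by
  refine forall_congr' fun w => ?_
  have : {x : X ⊕ Y | r x w ∧ x.isLeft = false} = Sum.inr '' {y : Y | r (.inr y) w} := by
    ext (x | y) <;> simp
  rw [this, Set.ncard_image_of_injective _ Sum.inr_injective]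

/-- In an even partition of a disjoint union, it suffices to count the points of the second
part. -/
theorem exists_toEvenPart_eq {X Y : Type u} [Finite X] [Finite Y] (r : EvenPart (X ⊕ Y)) :
    (∃ s : AdmPart X Y, s.toEvenPart = r)
      ↔ ∀ w, Even (Set.ncard {y : Y | r.1 (.inr y) w}) := by
  constructor
  · rintro ⟨s, rfl⟩ w
    exact (s.2 w).2
  · intro h
    refine ⟨⟨r.1, fun w => ⟨?_, h w⟩⟩, rfl⟩
    have h1 := r.2 w
    have h2 : {x : X ⊕ Y | r.1 x w}
        = Sum.inl '' {x : X | r.1 (.inl x) w} ∪ Sum.inr '' {y : Y | r.1 (.inr y) w} := by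
      ext (x | y) <;> simp
    rw [h2, Set.ncard_union_eq (by
        rw [Set.disjoint_left]
        rintro _ ⟨a, _, rfl⟩ ⟨b, _, hb⟩
        cases hb) (Set.toFinite _) (Set.toFinite _),
      Set.ncard_image_of_injective _ Sum.inl_injective,
      Set.ncard_image_of_injective _ Sum.inr_injective] at h1
    exact (Nat.even_add.1 h1).2 (h w)

open Classical in
theorem sum_admPart {X Y : Type u} [Finite X] [Finite Y] (f : EvenPart (X ⊕ Y) → ℝ) :
    ∑ r : AdmPart X Y, f r.toEvenPart
      = ∑ r : EvenPart (X ⊕ Y),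
        if ∀ w, Even (Set.ncard {y : Y | r.1 (.inr y) w}) then f r else 0 := by
  rw [← Finset.sum_filter]
  refine Finset.sum_bij (fun r _ => r.toEvenPart) ?_ ?_ ?_ ?_
  · exact fun r _ => Finset.mem_filter.2 ⟨Finset.mem_univ _, (exists_toEvenPart_eq _).1 ⟨r, rfl⟩⟩
  · exact fun r _ s _ h => AdmPart.toEvenPart_injective h
  · intro r hr
    obtain ⟨s, rfl⟩ := (exists_toEvenPart_eq r).2 (Finset.mem_filter.1 hr).2
    exact ⟨s, Finset.mem_univ _, rfl⟩
  · exact fun r _ => rfl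

theorem splitsEvenly_congr {X Y : Type u} (e : X ≃ Y) (r : EvenPart X) (τ : X → Bool) :
    SplitsEvenly (r.congr e).1 (τ ∘ e.symm) ↔ SplitsEvenly r.1 τ := by
  refine e.symm.forall_congr fun {w} => ?_
  have : {x | (r.congr e).1 x w ∧ (τ ∘ e.symm) x = false}
      = e '' {x | r.1 x (e.symm w) ∧ τ x = false} := by
    ext x
    rw [Equiv.image_eq_preimage_symm]
    rfl
  rw [this, Set.ncard_image_of_injective _ e.injective]

/-- **Tangling weights.** There are nonnegative weights on even partitions, invariant under
bijections, such that the product of two moments is the total weight of the admissible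
partitions. The same weights serve for all ways of splitting a set into two parts. -/
theorem exists_tangling_weight {g : ℝ} (hg : 0 < g) (a : ℝ) :
    ∃ W : (X : Type u) → EvenPart X → ℝ, (∀ X r, 0 ≤ W X r) ∧
      (∀ (X Y : Type u) (e : X ≃ Y) (r : EvenPart X), W Y (r.congr e) = W X r) ∧
      ∀ (X Y : Type u) [Finite X] [Finite Y],
        spinMoment g a (Nat.card X) * spinMoment g a (Nat.card Y)
          = ∑ r : AdmPart X Y, W (X ⊕ Y) r.toEvenPart := by
  classical
  choose W₀ hW₀ h using fun N : ℕ => exists_splitting_weight hg a (ULift.{u} (Fin N))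
  -- Averaging over all numberings of the points makes the weights invariant.
  refine ⟨fun X r => (∑ᶠ e : X ≃ ULift.{u} (Fin (Nat.card X)), W₀ _ (r.congr e))
    / (Nat.card X).factorial, fun X r => ?_, fun X Y e r => ?_, fun X Y _ _ => ?_⟩
  · exact div_nonneg (finsum_nonneg fun e => hW₀ _ _) (Nat.cast_nonneg _)
  · have hXY := Nat.card_congr e
    dsimp only
    rw [← hXY]
    congr 1
    rw [← finsum_comp_equiv (Equiv.equivCongr e (Equiv.refl (ULift.{u} (Fin (Nat.card X)))))]
    refine finsum_congr fun f => ?_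
    rw [EvenPart.congr_congr]
    congr 2
    ext x
    simp
  · have := Fintype.ofFinite X
    have := Fintype.ofFinite Y
    refine Eq.trans ?_ (sum_admPart fun r => (∑ᶠ e : X ⊕ Y ≃ ULift.{u} (Fin (Nat.card (X ⊕ Y))),
      W₀ _ (r.congr e)) / ((Nat.card (X ⊕ Y)).factorial : ℝ)).symm
    have hcard : Fintype.card (X ⊕ Y) = Fintype.card (ULift.{u} (Fin (Nat.card (X ⊕ Y)))) := by
      rw [Fintype.card_ulift, Fintype.card_fin, Nat.card_eq_fintype_card]
    have e0 := Fintype.equivOfCardEq hcard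
    have hE : Fintype.card (X ⊕ Y ≃ ULift.{u} (Fin (Nat.card (X ⊕ Y))))
        = (Nat.card (X ⊕ Y)).factorial := by
      rw [Fintype.card_equiv e0, Nat.card_eq_fintype_card]
    have key : ∀ e : X ⊕ Y ≃ ULift.{u} (Fin (Nat.card (X ⊕ Y))),
        ∑ r : EvenPart (X ⊕ Y), (if SplitsEvenly r.1 Sum.isLeft then W₀ _ (r.congr e) else 0)
          = spinMoment g a (Nat.card X) * spinMoment g a (Nat.card Y) := by
      intro e
      have h1 : Fintype.card {x // (Sum.isLeft ∘ e.symm) x = true} = Nat.card X := by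
        rw [← Nat.card_eq_fintype_card]
        refine Nat.card_congr ((e.symm.subtypeEquiv (q := fun x => Sum.isLeft x = true)
          (fun _ => Iff.rfl)).trans
          ⟨fun x => x.1.getLeft x.2, fun x => ⟨.inl x, rfl⟩, ?_, fun x => rfl⟩)
        rintro ⟨x | y, hx⟩
        · rfl
        · cases hx
      have h2 : Fintype.card {x // (Sum.isLeft ∘ e.symm) x = false} = Nat.card Y := by
        rw [← Nat.card_eq_fintype_card]
        refine Nat.card_congr ((e.symm.subtypeEquiv (q := fun x => Sum.isRight x = true)
          (fun x => by cases h : e.symm x <;> simp [h])).trans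
          ⟨fun x => x.1.getRight x.2, fun x => ⟨.inr x, rfl⟩, ?_, fun x => rfl⟩)
        rintro ⟨x | y, hx⟩
        · cases hx
        · rfl
      rw [← h1, ← h2, h]
      refine Fintype.sum_equiv (EvenPart.congrEquiv e) _ _ fun r => ?_
      have := splitsEvenly_congr e r Sum.isLeft
      change _ = if SplitsEvenly (r.congr e).1 _ then W₀ _ (r.congr e) else 0
      simp only [this]
    have hN : ((Nat.card (X ⊕ Y)).factorial : ℝ) ≠ 0 :=
      Nat.cast_ne_zero.2 (Nat.factorial_ne_zero _)
    simp only [← splitsEvenly_isLeft, finsum_eq_sum_of_fintype]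
    have e2 : ∀ r : EvenPart (X ⊕ Y), (if SplitsEvenly r.1 Sum.isLeft then
        (∑ e : X ⊕ Y ≃ ULift.{u} (Fin (Nat.card (X ⊕ Y))), W₀ _ (r.congr e))
          / ((Nat.card (X ⊕ Y)).factorial : ℝ) else 0)
        = (∑ e : X ⊕ Y ≃ ULift.{u} (Fin (Nat.card (X ⊕ Y))),
          if SplitsEvenly r.1 Sum.isLeft then W₀ _ (r.congr e) else 0)
          / ((Nat.card (X ⊕ Y)).factorial : ℝ) := by
      intro r
      split_ifs <;> simp
    simp only [e2]
    rw [← Finset.sum_div, Finset.sum_comm, Finset.sum_congr rfl fun e _ => key e,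
      Finset.sum_const, Finset.card_univ, hE, nsmul_eq_mul, mul_div_cancel_left₀ _ hN]

/-! ### Pairs of vertices, couplings and weights -/

/-- The unordered pairs of distinct vertices of `Λ`, the ghost included. -/
noncomputable def pairsIn (Λ : Finset (Option V)) : Finset (Sym2 (Option V)) :=
  open Classical in Λ.sym2.filter fun e => ¬ e.IsDiag

theorem mem_pairsIn {Λ : Finset (Option V)} {e : Sym2 (Option V)} :
    e ∈ pairsIn Λ ↔ ¬ e.IsDiag ∧ ∀ x ∈ e, x ∈ Λ := by
  classical
  rw [pairsIn, Finset.mem_filter, Finset.mem_sym2_iff, and_comm]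

theorem IsCurrent.mem_pairsIn {Λ : Finset (Option V)} {n : Sym2 (Option V) → ℕ}
    (hn : IsCurrent Λ n) {e : Sym2 (Option V)} (he : n e ≠ 0) : e ∈ pairsIn Λ :=
  Phi4.mem_pairsIn.2 (hn e he)

theorem IsCurrent.eq_zero {Λ : Finset (Option V)} {n : Sym2 (Option V) → ℕ}
    (hn : IsCurrent Λ n) {e : Sym2 (Option V)} (he : e ∉ pairsIn Λ) : n e = 0 := by
  by_contra h
  exact he (hn.mem_pairsIn h)

theorem pairsIn_mono {Λ Λ' : Finset (Option V)} (h : Λ' ⊆ Λ) : pairsIn Λ' ⊆ pairsIn Λ :=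
  fun _ he => mem_pairsIn.2 ⟨(mem_pairsIn.1 he).1, fun x hx => h ((mem_pairsIn.1 he).2 x hx)⟩

/-- The coupling constants, the external field being the coupling to the ghost. -/
def coupling (β : ℝ) (J : Sym2 V → ℝ) (h : V → ℝ) : Sym2 (Option V) → ℝ :=
  Sym2.lift ⟨fun x y => match x, y with
    | some x, some y => β * J s(x, y)
    | some x, none => β * h x
    | none, some y => β * h y
    | none, none => 0, by
    rintro (_ | x) (_ | y)
    · rfl
    · rfl
    · rfl
    · change β * J s(x, y) = β * J s(y, x)
      rw [Sym2.eq_swap]⟩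

theorem coupling_nonneg {β : ℝ} (hβ : 0 < β) {J : Sym2 V → ℝ} (hJ : ∀ e, 0 ≤ J e) {h : V → ℝ}
    (hh : ∀ x, 0 ≤ h x) (e : Sym2 (Option V)) : 0 ≤ coupling β J h e := by
  induction e with
  | _ x y =>
    rcases x with _ | x <;> rcases y with _ | y
    · exact le_rfl
    · exact mul_nonneg hβ.le (hh y)
    · exact mul_nonneg hβ.le (hh x)
    · exact mul_nonneg hβ.le (hJ _)

/-- The factor of the weight of a current that comes from its edges. -/
noncomputable def edgeWeight (c : Sym2 (Option V) → ℝ) (Λ : Finset (Option V))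
    (n : Sym2 (Option V) → ℕ) : ℝ :=
  ∏ e ∈ pairsIn Λ, c e ^ n e / (n e).factorial

theorem prod_site {M : Type*} [CommMonoid M] (Λ : Finset (Option V)) (f : Option V → M)
    (hf : f none = 1) : ∏ x : Site Λ, f (some x.1) = ∏ x ∈ Λ, f x := by
  classical
  rw [Finset.prod_coe_sort (Finset.eraseNone Λ) fun x => f (some x),
    ← Finset.prod_erase Λ hf, ← Finset.map_some_eraseNone, Finset.prod_map]
  rfl

open Classical in
/-- A product over pairs of vertices splits into the pairs of sites and the pairs with the ghost. -/
theorem prod_pairsIn {M : Type*} [CommMonoid M] (Λ : Finset (Option V))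
    (f : Sym2 (Option V) → M) :
    ∏ e ∈ pairsIn Λ, f e = (∏ e ∈ sitePairs Λ, f (e.map fun x => some x.1))
      * if none ∈ Λ then ∏ x : Site Λ, f s(some x.1, none) else 1 := by
  rw [← Finset.prod_filter_not_mul_prod_filter (pairsIn Λ) fun e => none ∈ e]
  congr 1
  · symm
    have hinj : Function.Injective fun x : Site Λ => some x.1 :=
      (Option.some_injective V).comp Subtype.val_injective
    refine Finset.prod_bij (fun e _ => e.map fun x => some x.1) ?_ ?_ ?_ fun _ _ => rfl
    · intro e he
      have hd : ¬ e.IsDiag := (Finset.mem_filter.1 he).2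
      refine Finset.mem_filter.2 ⟨mem_pairsIn.2 ⟨?_, ?_⟩, ?_⟩
      · rwa [Sym2.isDiag_map hinj]
      · intro x hx
        obtain ⟨y, _, rfl⟩ := Sym2.mem_map.1 hx
        exact Finset.mem_eraseNone.1 y.2
      · intro h
        obtain ⟨y, _, hy⟩ := Sym2.mem_map.1 h
        cases hy
    · exact fun e _ e' _ h => Sym2.map.injective hinj h
    · intro e he
      obtain ⟨he, hne⟩ := Finset.mem_filter.1 he
      obtain ⟨hd, hΛ⟩ := mem_pairsIn.1 he
      induction e with
      | _ x y =>
        rcases x with _ | x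
        · exact absurd (Sym2.mem_mk_left _ _) hne
        rcases y with _ | y
        · exact absurd (Sym2.mem_mk_right _ _) hne
        have hx := hΛ _ (Sym2.mem_mk_left _ _)
        have hy := hΛ _ (Sym2.mem_mk_right _ _)
        refine ⟨s(⟨x, Finset.mem_eraseNone.2 hx⟩, ⟨y, Finset.mem_eraseNone.2 hy⟩),
          Finset.mem_filter.2 ⟨Finset.mem_univ _, fun h => hd ?_⟩, rfl⟩
        rw [Sym2.mk_isDiag_iff] at h ⊢
        exact congrArg (fun z : Site Λ => some z.1) h
  · split_ifs with hg
    · symm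
      refine Finset.prod_bij (fun x _ => s(some x.1, none)) ?_ ?_ ?_ fun _ _ => rfl
      · intro x _
        refine Finset.mem_filter.2 ⟨mem_pairsIn.2 ⟨?_, ?_⟩, Sym2.mem_mk_right _ _⟩
        · rw [Sym2.mk_isDiag_iff]
          simp
        · intro y hy
          rcases Sym2.mem_iff.1 hy with rfl | rfl
          · exact Finset.mem_eraseNone.1 x.2
          · exact hg
      · intro x _ y _ h
        rcases Sym2.eq_iff.1 h with h | h
        · exact Subtype.ext (Option.some_injective _ h.1)
        · cases h.1
      · intro e he
        obtain ⟨he, hne⟩ := Finset.mem_filter.1 he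
        obtain ⟨y, rfl⟩ := Sym2.mem_iff_exists.1 hne
        obtain ⟨hd, hΛ⟩ := mem_pairsIn.1 he
        rcases y with _ | y
        · exact absurd (Sym2.mk_isDiag_iff.2 rfl) hd
        · exact ⟨⟨y, Finset.mem_eraseNone.2 (hΛ _ (Sym2.mem_mk_right _ _))⟩,
            Finset.mem_univ _, Sym2.eq_swap⟩
    · refine Finset.prod_eq_one fun e he => absurd ?_ hg
      obtain ⟨he, hne⟩ := Finset.mem_filter.1 he
      exact (mem_pairsIn.1 he).2 _ hne

/-- If the ghost is not in `Λ`, the factors of the external field in `weight` are all equal to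
one, because a current on `Λ` has no edges to the ghost. -/
theorem weight_eq (g a β : ℝ) (J : Sym2 V → ℝ) (h : V → ℝ) {Λ : Finset (Option V)}
    (A : Option V → ℕ) {n : Sym2 (Option V) → ℕ} (hn : IsCurrent Λ n) :
    weight g a β J h Λ A n = edgeWeight (coupling β J h) Λ n
      * ∏ x : Site Λ, spinMoment g a (degree Λ n x + A (some x.1)) := by
  classical
  rw [weight, edgeWeight, prod_pairsIn]
  congr 2
  · refine Finset.prod_congr rfl fun e _ => ?_
    induction e with
    | _ x y => rfl
  · split_ifs with hg
    · rfl
    · refine Finset.prod_eq_one fun x _ => ?_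
      rw [hn.eq_zero fun he => hg ((mem_pairsIn.1 he).2 _ (Sym2.mem_mk_right _ _))]
      simp

/-- The spin configuration extended by `1` to the ghost and to the vertices outside `Λ`. -/
noncomputable def extendSpin {Λ : Finset (Option V)} (φ : Site Λ → ℝ) : Option V → ℝ
  | none => 1
  | some x => open Classical in if hx : x ∈ Finset.eraseNone Λ then φ ⟨x, hx⟩ else 1

theorem extendSpin_site {Λ : Finset (Option V)} (φ : Site Λ → ℝ) (x : Site Λ) :
    extendSpin φ (some x.1) = φ x := by
  classical
  exact dif_pos x.2

/-- The external field as an interaction with a spin equal to one at the ghost. -/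
theorem beta_mul_negHamiltonian (β : ℝ) (J : Sym2 V → ℝ) (h : V → ℝ) (Λ : Finset (Option V))
    (φ : Site Λ → ℝ) :
    β * negHamiltonian J h Λ φ
      = ∑ e ∈ pairsIn Λ, coupling β J h e * (e.map (extendSpin φ)).mul := by
  classical
  -- The decomposition of products applies to sums through the additive group written
  -- multiplicatively.
  have key := prod_pairsIn (M := Multiplicative ℝ) Λ
    fun e => Multiplicative.ofAdd (coupling β J h e * (e.map (extendSpin φ)).mul)
  have key' : ∑ e ∈ pairsIn Λ, coupling β J h e * (e.map (extendSpin φ)).mul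
      = (∑ e ∈ sitePairs Λ, coupling β J h (e.map fun x => some x.1)
          * ((e.map fun x => some x.1).map (extendSpin φ)).mul)
        + if none ∈ Λ then ∑ x : Site Λ, coupling β J h s(some x.1, none)
          * (s(some x.1, none).map (extendSpin φ)).mul else 0 := by
    apply Multiplicative.ofAdd.injective
    rw [ofAdd_add, ofAdd_sum, ofAdd_sum, key]
    congr 1
  rw [key', negHamiltonian, mul_add, Finset.mul_sum, mul_ite, mul_zero, Finset.mul_sum]
  congr 1
  · refine Finset.sum_congr rfl fun e _ => ?_
    induction e with
    | _ x y =>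
      simp only [Sym2.map_mk, Sym2.mul_mk, extendSpin_site]
      rw [← mul_assoc]
      rfl
  · refine if_congr Iff.rfl (Finset.sum_congr rfl fun x _ => ?_) rfl
    simp only [Sym2.map_mk, Sym2.mul_mk, extendSpin_site]
    rw [← mul_assoc, ← mul_assoc]
    exact (mul_one _).symm

/-! ### The current expansion -/

theorem hasSum_mul_of_norm {ι κ : Type*} {f : ι → ℝ} {f' : κ → ℝ} {a b : ℝ} (hf : HasSum f a)
    (hf' : HasSum f' b) (nf : Summable fun i => ‖f i‖) (nf' : Summable fun k => ‖f' k‖) :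
    HasSum (fun p : ι × κ => f p.1 * f' p.2) (a * b) :=
  hf.mul hf' (summable_mul_of_summable_norm nf nf')

/-- The product of finitely many exponential series. -/
theorem hasSum_prod_exp {ι : Type*} [Fintype ι] (x : ι → ℝ) :
    HasSum (fun n : ι → ℕ => ∏ i, x i ^ n i / (n i).factorial) (Real.exp (∑ i, x i)) := by
  revert x
  refine Fintype.induction_empty_option (P := fun ι _ => ∀ x : ι → ℝ,
    HasSum (fun n : ι → ℕ => ∏ i, x i ^ n i / (n i).factorial) (Real.exp (∑ i, x i)))
    ?_ ?_ ?_ ι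
  · intro α β _ e ih x
    let _ := Fintype.ofEquiv β e.symm
    have h := ih (x ∘ e)
    rw [show ∑ i, (x ∘ e) i = ∑ i, x i from Equiv.sum_comp e x,
      ← (Equiv.arrowCongr e.symm (Equiv.refl ℕ)).hasSum_iff] at h
    refine h.congr_fun fun n => ?_
    exact (Equiv.prod_comp e fun i => x i ^ n i / ((n i).factorial : ℝ)).symm
  · intro x
    convert hasSum_unique _ using 1
    · simp
    · infer_instance
  · intro α _ ih x
    rw [Fintype.sum_option, Real.exp_add]
    have h0 : HasSum (fun k : ℕ => x none ^ k / k.factorial) (Real.exp (x none)) := by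
      rw [Real.exp_eq_exp_ℝ]
      exact NormedSpace.expSeries_div_hasSum_exp (x none)
    have h1 := ih fun i => x (some i)
    have n0 : Summable fun k : ℕ => ‖x none ^ k / (k.factorial : ℝ)‖ :=
      NormedSpace.norm_expSeries_div_summable (x none)
    have n1 : Summable fun n : α → ℕ => ‖∏ i, x (some i) ^ n i / ((n i).factorial : ℝ)‖ := by
      refine (ih fun i => |x (some i)|).summable.congr fun n => ?_
      rw [norm_prod]
      refine Finset.prod_congr rfl fun i _ => ?_
      rw [norm_div, norm_pow, Real.norm_eq_abs, Real.norm_natCast]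
    have h2 := (Equiv.piOptionEquivProd (β := fun _ : Option α => ℕ)).hasSum_iff.2
      (hasSum_mul_of_norm h0 h1 n0 n1)
    refine h2.congr_fun fun n => ?_
    rw [Fintype.prod_option]
    rfl

/-- Currents on `Λ` as arbitrary functions on the pairs of distinct vertices of `Λ`. -/
noncomputable def currentEquiv (Λ : Finset (Option V)) :
    {n : Sym2 (Option V) → ℕ // IsCurrent Λ n} ≃ (pairsIn Λ → ℕ) where
  toFun n e := n.1 e.1
  invFun m := ⟨fun e => open Classical in if he : e ∈ pairsIn Λ then m ⟨e, he⟩ else 0,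
    fun e he => by
      by_cases h : e ∈ pairsIn Λ
      · exact mem_pairsIn.1 h
      · simp [h] at he⟩
  left_inv n := by
    classical
    refine Subtype.ext (funext fun e => ?_)
    by_cases h : e ∈ pairsIn Λ
    · simp [h]
    · simp [h, n.2.eq_zero h]
  right_inv m := by
    funext e
    simp

instance instCountableCurrent (Λ : Finset (Option V)) :
    Countable {n : Sym2 (Option V) → ℕ // IsCurrent Λ n} :=
  (currentEquiv Λ).injective.countable

theorem hasSum_edgeWeight (Λ : Finset (Option V)) (y : Sym2 (Option V) → ℝ) :
    HasSum (fun n : {n : Sym2 (Option V) → ℕ // IsCurrent Λ n} => edgeWeight y Λ n.1)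
      (Real.exp (∑ e ∈ pairsIn Λ, y e)) := by
  have h := hasSum_prod_exp fun e : pairsIn Λ => y e.1
  rw [Finset.sum_coe_sort (pairsIn Λ) y, ← (currentEquiv Λ).hasSum_iff] at h
  refine h.congr_fun fun n => ?_
  exact (Finset.prod_coe_sort (pairsIn Λ) fun e => y e ^ n.1 e / ((n.1 e).factorial : ℝ)).symm

theorem sum_pairsIn_mem {Λ : Finset (Option V)} {n : Sym2 (Option V) → ℕ} (hn : IsCurrent Λ n)
    (x : Option V) (hx : x ∈ Λ) [DecidablePred fun e : Sym2 (Option V) => x ∈ e] :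
    ∑ e ∈ pairsIn Λ with x ∈ e, n e = ∑ y ∈ Λ, n s(x, y) := by
  classical
  have h1 : ∑ y ∈ Λ, n s(x, y) = ∑ y ∈ Λ.erase x, n s(x, y) := by
    refine (Finset.sum_erase Λ ?_).symm
    exact hn.eq_zero fun h => (mem_pairsIn.1 h).1 (Sym2.mk_isDiag_iff.2 rfl)
  rw [h1]
  symm
  refine Finset.sum_bij (fun y _ => s(x, y)) ?_ ?_ ?_ fun _ _ => rfl
  · intro y hy
    obtain ⟨hyx, hyΛ⟩ := Finset.mem_erase.1 hy
    refine Finset.mem_filter.2 ⟨mem_pairsIn.2 ⟨?_, ?_⟩, Sym2.mem_mk_left _ _⟩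
    · rw [Sym2.mk_isDiag_iff]
      exact fun h => hyx h.symm
    · intro z hz
      rcases Sym2.mem_iff.1 hz with rfl | rfl
      · exact hx
      · exact hyΛ
  · exact fun y _ z _ h => Sym2.congr_right.1 h
  · intro e he
    obtain ⟨he, hxe⟩ := Finset.mem_filter.1 he
    obtain ⟨y, rfl⟩ := Sym2.mem_iff_exists.1 hxe
    obtain ⟨hd, hΛ⟩ := mem_pairsIn.1 he
    exact ⟨y, Finset.mem_erase.2 ⟨fun h => hd (Sym2.mk_isDiag_iff.2 h.symm),
      hΛ _ (Sym2.mem_mk_right _ _)⟩, rfl⟩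

/-- The product over the edges of the spins at their ends, collected at the vertices. -/
theorem prod_edges_eq {Λ : Finset (Option V)} {n : Sym2 (Option V) → ℕ} (hn : IsCurrent Λ n)
    (ψ : Option V → ℝ) :
    ∏ e ∈ pairsIn Λ, (e.map ψ).mul ^ n e = ∏ x ∈ Λ, ψ x ^ ∑ y ∈ Λ, n s(x, y) := by
  classical
  have h1 : ∀ e ∈ pairsIn Λ, (e.map ψ).mul ^ n e
      = ∏ x ∈ Λ, if x ∈ e then ψ x ^ n e else 1 := by
    intro e he
    obtain ⟨hd, hΛ⟩ := mem_pairsIn.1 he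
    induction e with
    | _ x y =>
      have hxy : x ≠ y := fun h => hd (Sym2.mk_isDiag_iff.2 h)
      have hx := hΛ _ (Sym2.mem_mk_left x y)
      have hy := hΛ _ (Sym2.mem_mk_right x y)
      rw [← Finset.prod_filter, show Λ.filter (fun z => z ∈ s(x, y)) = {x, y} from ?_,
        Finset.prod_pair hxy, Sym2.map_mk, Sym2.mul_mk, mul_pow]
      ext z
      simp only [Finset.mem_filter, Sym2.mem_iff, Finset.mem_insert, Finset.mem_singleton]
      constructor
      · exact fun h => h.2
      · rintro (rfl | rfl)
        · exact ⟨hx, Or.inl rfl⟩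
        · exact ⟨hy, Or.inr rfl⟩
  rw [Finset.prod_congr rfl h1, Finset.prod_comm]
  refine Finset.prod_congr rfl fun x hx => ?_
  rw [← Finset.prod_filter, Finset.prod_pow_eq_pow_sum, sum_pairsIn_mem hn x hx]

theorem edgeWeight_spin {Λ : Finset (Option V)} {n : Sym2 (Option V) → ℕ} (hn : IsCurrent Λ n)
    (c : Sym2 (Option V) → ℝ) (φ : Site Λ → ℝ) :
    edgeWeight (fun e => c e * (e.map (extendSpin φ)).mul) Λ n
      = edgeWeight c Λ n * ∏ x : Site Λ, φ x ^ degree Λ n x := by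
  have h1 : ∏ x : Site Λ, φ x ^ degree Λ n x
      = ∏ x : Site Λ, extendSpin φ (some x.1) ^ ∑ y ∈ Λ, n s(some x.1, y) :=
    Finset.prod_congr rfl fun x _ => by rw [extendSpin_site, degree]
  rw [h1, prod_site Λ (fun x => extendSpin φ x ^ ∑ y ∈ Λ, n s(x, y)) (one_pow _),
    ← prod_edges_eq hn, edgeWeight, edgeWeight, ← Finset.prod_mul_distrib]
  refine Finset.prod_congr rfl fun e _ => ?_
  rw [mul_pow]
  ring

theorem edgeWeight_nonneg {c : Sym2 (Option V) → ℝ} (hc : ∀ e, 0 ≤ c e) (Λ : Finset (Option V))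
    (n : Sym2 (Option V) → ℕ) : 0 ≤ edgeWeight c Λ n :=
  Finset.prod_nonneg fun e _ => div_nonneg (pow_nonneg (hc e) _) (Nat.cast_nonneg _)

/-! ### Correlations as sums over currents -/

/-- The unnormalized correlation of the spins of `Λ` raised to the powers `A`. -/
noncomputable def partFun (g a β : ℝ) (J : Sym2 V → ℝ) (h : V → ℝ) (Λ : Finset (Option V))
    (A : Option V → ℕ) : ℝ :=
  ∫ φ : Site Λ → ℝ, (∏ x : Site Λ, φ x ^ A (some x.1)) * Real.exp (β * negHamiltonian J h Λ φ)
    ∂(Measure.pi fun _ : Site Λ => singleSite g a)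

theorem abs_edge_le {Λ : Finset (Option V)} (φ : Site Λ → ℝ) (e : Sym2 (Option V)) :
    |(e.map (extendSpin φ)).mul| ≤ 1 + ∑ x, φ x ^ 2 := by
  have h1 : ∀ x, extendSpin φ x ^ 2 ≤ 1 + ∑ x, φ x ^ 2 := by
    have h0 : 0 ≤ ∑ x, φ x ^ 2 := Finset.sum_nonneg fun x _ => sq_nonneg _
    rintro (_ | x)
    · simpa [extendSpin] using h0
    · by_cases hx : x ∈ Finset.eraseNone Λ
      · rw [show extendSpin φ (some x) = φ ⟨x, hx⟩ from extendSpin_site φ ⟨x, hx⟩]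
        have := Finset.single_le_sum (f := fun x => φ x ^ 2) (fun x _ => sq_nonneg _)
          (Finset.mem_univ (⟨x, hx⟩ : Site Λ))
        linarith
      · have : extendSpin φ (some x) = 1 := by
          classical
          exact dif_neg hx
        rw [this]
        linarith
  induction e with
  | _ x y =>
    rw [Sym2.map_mk, Sym2.mul_mk, abs_mul]
    nlinarith [h1 x, h1 y, sq_nonneg (|extendSpin φ x| - |extendSpin φ y|),
      sq_abs (extendSpin φ x), sq_abs (extendSpin φ y)]

theorem continuous_edge {Λ : Finset (Option V)} (e : Sym2 (Option V)) :
    Continuous fun φ : Site Λ → ℝ => (e.map (extendSpin φ)).mul := by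
  have h1 : ∀ x, Continuous fun φ : Site Λ → ℝ => extendSpin φ x := by
    rintro (_ | x)
    · exact continuous_const
    · by_cases hx : x ∈ Finset.eraseNone Λ
      · have : (fun φ : Site Λ → ℝ => extendSpin φ (some x)) = fun φ => φ ⟨x, hx⟩ :=
          funext fun φ => extendSpin_site φ ⟨x, hx⟩
        rw [this]
        exact continuous_apply _
      · have : (fun φ : Site Λ → ℝ => extendSpin φ (some x)) = fun φ => 1 := by
          classical
          exact funext fun φ => dif_neg hx
        rw [this]
        exact continuous_const
  induction e with
  | _ x y => exact (h1 x).mul (h1 y)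

/-- The interaction grows at most quadratically, and is dominated by the quartic decay of the
single-site measure. -/
theorem integrable_spins {g : ℝ} (hg : 0 < g) (a : ℝ) {Λ : Finset (Option V)}
    {c : Sym2 (Option V) → ℝ} (hc : ∀ e, 0 ≤ c e) (k : Site Λ → ℕ) :
    Integrable (fun φ : Site Λ → ℝ => (∏ x, |φ x| ^ k x)
      * Real.exp (∑ e ∈ pairsIn Λ, c e * |(e.map (extendSpin φ)).mul|))
      (Measure.pi fun _ : Site Λ => singleSite g a) := by
  have := isProbabilityMeasure_singleSite hg a
  set C : ℝ := ∑ e ∈ pairsIn Λ, c e with hC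
  have h1 : Integrable (fun φ : Site Λ → ℝ => ∏ x, ((1 + |φ x|) ^ k x * Real.exp (C * φ x ^ 2)))
      (Measure.pi fun _ : Site Λ => singleSite g a) :=
    Integrable.fintype_prod fun x => integrable_singleSite hg a C (k x)
  refine (h1.const_mul (Real.exp C)).mono' (Continuous.aestronglyMeasurable ?_)
    (Filter.Eventually.of_forall fun φ => ?_)
  · refine (continuous_finsetProd _ fun x _ => by fun_prop).mul (Real.continuous_exp.comp ?_)
    exact continuous_finsetSum _ fun e _ => continuous_const.mul (continuous_edge e).abs
  · have hp : 0 ≤ ∏ x, |φ x| ^ k x := Finset.prod_nonneg fun x _ => by positivity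
    rw [Real.norm_of_nonneg (mul_nonneg hp (Real.exp_nonneg _)), Finset.prod_mul_distrib,
      ← Real.exp_sum, mul_left_comm, ← Real.exp_add]
    have h2 : ∑ e ∈ pairsIn Λ, c e * |(e.map (extendSpin φ)).mul|
        ≤ C + ∑ x, C * φ x ^ 2 := by
      rw [← Finset.mul_sum, hC, Finset.sum_mul, ← Finset.sum_add_distrib]
      refine Finset.sum_le_sum fun e _ => ?_
      have := mul_le_mul_of_nonneg_left (abs_edge_le φ e) (hc e)
      linarith
    have h3 : ∏ x, |φ x| ^ k x ≤ ∏ x, (1 + |φ x|) ^ k x :=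
      Finset.prod_le_prod (fun x _ => pow_nonneg (abs_nonneg (φ x)) (k x)) fun x _ =>
        pow_le_pow_left₀ (abs_nonneg (φ x)) (by linarith : |φ x| ≤ 1 + |φ x|) (k x)
    exact mul_le_mul h3 (Real.exp_le_exp.2 h2) (Real.exp_nonneg _) (hp.trans h3)

/-- The **random current expansion**, with no restriction on the sources. -/
theorem hasSum_weight {g : ℝ} (hg : 0 < g) (a : ℝ) {β : ℝ} (hβ : 0 < β) {J : Sym2 V → ℝ}
    (hJ : ∀ e, 0 ≤ J e) {h : V → ℝ} (hh : ∀ x, 0 ≤ h x) (Λ : Finset (Option V))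
    (A : Option V → ℕ) :
    HasSum (fun n : {n : Sym2 (Option V) → ℕ // IsCurrent Λ n} => weight g a β J h Λ A n.1)
      (partFun g a β J h Λ A) := by
  have := isProbabilityMeasure_singleSite hg a
  have hc := coupling_nonneg hβ hJ hh
  set c := coupling β J h with hcdef
  set T : {n : Sym2 (Option V) → ℕ // IsCurrent Λ n} → (Site Λ → ℝ) → ℝ := fun n φ =>
    (∏ x, φ x ^ A (some x.1)) * edgeWeight (fun e => c e * (e.map (extendSpin φ)).mul) Λ n.1
    with hT
  have hTeq : ∀ n φ, T n φ
      = edgeWeight c Λ n.1 * ∏ x : Site Λ, φ x ^ (degree Λ n.1 x + A (some x.1)) := by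
    intro n φ
    simp only [hT, edgeWeight_spin n.2, pow_add, Finset.prod_mul_distrib]
    ring
  have hint : ∀ n, ∫ φ, T n φ ∂(Measure.pi fun _ : Site Λ => singleSite g a)
      = weight g a β J h Λ A n.1 := by
    intro n
    simp only [hTeq]
    rw [integral_const_mul, weight_eq g a β J h A n.2,
      integral_fintype_prod_eq_prod (fun (x : Site Λ) (t : ℝ) =>
        t ^ (degree Λ n.1 x + A (some x.1)))]
    rfl
  have hmeas : ∀ n, Continuous (T n) := by
    intro n
    rw [show T n = _ from funext (hTeq n)]
    fun_prop
  rw [show (fun n : {n : Sym2 (Option V) → ℕ // IsCurrent Λ n} => weight g a β J h Λ A n.1)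
    = fun n => ∫ φ, T n φ ∂(Measure.pi fun _ : Site Λ => singleSite g a) from
      funext fun n => (hint n).symm]
  have hbound : ∀ φ : Site Λ → ℝ, HasSum (fun n : {n : Sym2 (Option V) → ℕ // IsCurrent Λ n} =>
      (∏ x, |φ x| ^ A (some x.1)) * edgeWeight (fun e => c e * |(e.map (extendSpin φ)).mul|) Λ n.1)
      ((∏ x, |φ x| ^ A (some x.1))
        * Real.exp (∑ e ∈ pairsIn Λ, c e * |(e.map (extendSpin φ)).mul|)) := fun φ =>
    (hasSum_edgeWeight Λ fun e => c e * |(e.map (extendSpin φ)).mul|).mul_left _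
  refine hasSum_integral_of_dominated_convergence
    (fun n φ => (∏ x, |φ x| ^ A (some x.1))
      * edgeWeight (fun e => c e * |(e.map (extendSpin φ)).mul|) Λ n.1)
    (fun n => (hmeas n).aestronglyMeasurable)
    (fun n => Filter.Eventually.of_forall fun φ => ?_)
    (Filter.Eventually.of_forall fun φ => (hbound φ).summable) ?_
    (Filter.Eventually.of_forall fun φ => ?_)
  · refine le_of_eq ?_
    simp only [hT, edgeWeight, norm_mul, norm_prod, norm_div, norm_pow, Real.norm_eq_abs,
      Nat.abs_cast]
    congr 1
    refine Finset.prod_congr rfl fun e _ => ?_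
    rw [abs_of_nonneg (hc e)]
  · simp only [(hbound _).tsum_eq]
    exact integrable_spins hg a hc fun x => A (some x.1)
  · rw [beta_mul_negHamiltonian]
    exact (hasSum_edgeWeight Λ fun e => c e * (e.map (extendSpin φ)).mul).mul_left _

theorem integrable_exp_hamiltonian {g : ℝ} (hg : 0 < g) (a : ℝ) {β : ℝ} (hβ : 0 < β)
    {J : Sym2 V → ℝ} (hJ : ∀ e, 0 ≤ J e) {h : V → ℝ} (hh : ∀ x, 0 ≤ h x)
    (Λ : Finset (Option V)) :
    Integrable (fun φ : Site Λ → ℝ => Real.exp (β * negHamiltonian J h Λ φ))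
      (Measure.pi fun _ : Site Λ => singleSite g a) := by
  have hc := coupling_nonneg hβ hJ hh
  have h1 := integrable_spins hg a (Λ := Λ) hc fun _ => 0
  simp only [pow_zero, Finset.prod_const_one, one_mul] at h1
  simp only [beta_mul_negHamiltonian]
  refine h1.mono' (Continuous.aestronglyMeasurable ?_) (Filter.Eventually.of_forall fun φ => ?_)
  · exact Real.continuous_exp.comp
      (continuous_finsetSum _ fun e _ => continuous_const.mul (continuous_edge e))
  · rw [Real.norm_of_nonneg (Real.exp_nonneg _)]
    refine Real.exp_le_exp.2 (Finset.sum_le_sum fun e _ => ?_)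
    exact mul_le_mul_of_nonneg_left (le_abs_self _) (hc e)

theorem partFun_zero_pos {g : ℝ} (hg : 0 < g) (a : ℝ) {β : ℝ} (hβ : 0 < β)
    {J : Sym2 V → ℝ} (hJ : ∀ e, 0 ≤ J e) {h : V → ℝ} (hh : ∀ x, 0 ≤ h x)
    (Λ : Finset (Option V)) : 0 < partFun g a β J h Λ 0 := by
  have := isProbabilityMeasure_singleSite hg a
  have h1 := integral_exp_pos (integrable_exp_hamiltonian hg a hβ hJ hh Λ)
  simpa [partFun] using h1

theorem corr_eq (g a β : ℝ) (J : Sym2 V → ℝ) (h : V → ℝ) (Λ : Finset (Option V))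
    (A : Option V → ℕ) :
    corr g a β J h Λ A = partFun g a β J h Λ A / partFun g a β J h Λ 0 := by
  rw [corr, phi4Measure, integral_tilted, partFun, partFun, ← integral_div]
  refine integral_congr_ae (Filter.Eventually.of_forall fun φ => ?_)
  simp only [smul_eq_mul, Pi.zero_apply, pow_zero, Finset.prod_const_one, one_mul]
  ring

theorem weight_nonneg {g : ℝ} (hg : 0 < g) (a : ℝ) {β : ℝ} (hβ : 0 < β) {J : Sym2 V → ℝ}
    (hJ : ∀ e, 0 ≤ J e) {h : V → ℝ} (hh : ∀ x, 0 ≤ h x) {Λ : Finset (Option V)}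
    (A : Option V → ℕ) {n : Sym2 (Option V) → ℕ} (hn : IsCurrent Λ n) :
    0 ≤ weight g a β J h Λ A n := by
  rw [weight_eq g a β J h A hn]
  exact mul_nonneg (edgeWeight_nonneg (coupling_nonneg hβ hJ hh) Λ n)
    (Finset.prod_nonneg fun x _ => spinMoment_nonneg hg a _)

theorem even_degree_add {Λ : Finset (Option V)} {A : Option V → ℕ} {n : Sym2 (Option V) → ℕ}
    (h : currentSources Λ n = momentSources Λ A) (x : Site Λ) :
    Even (degree Λ n x + A (some x.1)) := by
  have h1 := Set.ext_iff.1 h x.1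
  simp only [currentSources, momentSources, Set.mem_ofPred_eq, Finset.mem_eraseNone.1 x.2,
    true_and] at h1
  rw [Nat.even_add, ← Nat.not_odd_iff_even, ← Nat.not_odd_iff_even, h1]

theorem sources_eq_of_even {Λ : Finset (Option V)} {A : Option V → ℕ}
    {n : Sym2 (Option V) → ℕ} (h : ∀ x : Site Λ, Even (degree Λ n x + A (some x.1))) :
    currentSources Λ n = momentSources Λ A := by
  ext x
  simp only [currentSources, momentSources, Set.mem_ofPred_eq]
  refine and_congr_right fun hx => ?_
  have := h ⟨x, Finset.mem_eraseNone.2 hx⟩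
  rwa [Nat.even_add, ← Nat.not_odd_iff_even, ← Nat.not_odd_iff_even, not_iff_not] at this

/-- Currents with other sources have weight zero, because the odd moments of the single-site
measure vanish. -/
theorem hasSum_weight_sources {g : ℝ} (hg : 0 < g) (a : ℝ) {β : ℝ} (hβ : 0 < β) {J : Sym2 V → ℝ}
    (hJ : ∀ e, 0 ≤ J e) {h : V → ℝ} (hh : ∀ x, 0 ≤ h x) (Λ : Finset (Option V))
    (A : Option V → ℕ) :
    HasSum (fun n : {n : Sym2 (Option V) → ℕ //
        IsCurrent Λ n ∧ currentSources Λ n = momentSources Λ A} => weight g a β J h Λ A n.1)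
      (partFun g a β J h Λ A) := by
  have h1 : Function.Injective fun n : {n : Sym2 (Option V) → ℕ //
      IsCurrent Λ n ∧ currentSources Λ n = momentSources Λ A} =>
      (⟨n.1, n.2.1⟩ : {n : Sym2 (Option V) → ℕ // IsCurrent Λ n}) :=
    fun n m hnm => Subtype.ext
      (congrArg (fun q : {n : Sym2 (Option V) → ℕ // IsCurrent Λ n} => q.1) hnm)
  refine (h1.hasSum_iff (f := fun n : {n : Sym2 (Option V) → ℕ // IsCurrent Λ n} =>
    weight g a β J h Λ A n.1) fun n hn => ?_).2 (hasSum_weight hg a hβ hJ hh Λ A)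
  rw [weight_eq g a β J h A n.2]
  by_contra h0
  refine hn ⟨⟨n.1, n.2, sources_eq_of_even fun x => ?_⟩, rfl⟩
  by_contra hodd
  refine h0 (mul_eq_zero_of_right _ (Finset.prod_eq_zero (Finset.mem_univ x) ?_))
  exact spinMoment_odd g a (Nat.not_even_iff_odd.1 hodd)

/-- Pairs of currents as a product of two sets of currents with prescribed sources. -/
def currentPairEquiv (Λ Λ' : Finset (Option V)) (A B : Option V → ℕ) :
    CurrentPair Λ Λ' A B ≃
      {n : Sym2 (Option V) → ℕ // IsCurrent Λ n ∧ currentSources Λ n = momentSources Λ A}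
      × {n : Sym2 (Option V) → ℕ //
        IsCurrent Λ' n ∧ currentSources Λ' n = momentSources Λ' B} where
  toFun p := (⟨p.1.1, p.2.1, p.2.2.2.1⟩, ⟨p.1.2, p.2.2.1, p.2.2.2.2⟩)
  invFun q := ⟨(q.1.1, q.2.1), q.1.2.1, q.2.2.1, q.1.2.2, q.2.2.2⟩
  left_inv _ := rfl
  right_inv _ := rfl

theorem hasSum_pairWeight {g : ℝ} (hg : 0 < g) (a : ℝ) {β : ℝ} (hβ : 0 < β) {J : Sym2 V → ℝ}
    (hJ : ∀ e, 0 ≤ J e) {h : V → ℝ} (hh : ∀ x, 0 ≤ h x) (Λ Λ' : Finset (Option V))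
    (A B : Option V → ℕ) :
    HasSum (fun p : CurrentPair Λ Λ' A B => pairWeight g a β J h p)
      (partFun g a β J h Λ A * partFun g a β J h Λ' B) := by
  have h1 := hasSum_weight_sources hg a hβ hJ hh Λ A
  have h2 := hasSum_weight_sources hg a hβ hJ hh Λ' B
  exact (currentPairEquiv Λ Λ' A B).hasSum_iff.2 (hasSum_mul_of_norm h1 h2 h1.summable.norm
    h2.summable.norm)

theorem pairWeight_nonneg {g : ℝ} (hg : 0 < g) (a : ℝ) {β : ℝ} (hβ : 0 < β) {J : Sym2 V → ℝ}
    (hJ : ∀ e, 0 ≤ J e) {h : V → ℝ} (hh : ∀ x, 0 ≤ h x) {Λ Λ' : Finset (Option V)}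
    {A B : Option V → ℕ} (p : CurrentPair Λ Λ' A B) : 0 ≤ pairWeight g a β J h p :=
  mul_nonneg (weight_nonneg hg a hβ hJ hh A p.2.1) (weight_nonneg hg a hβ hJ hh B p.2.2.1)

/-! ### Marked edges -/

/-- A mark in `ZMod 2` for each of the edges of `n` over `Λ'`: the indicator of the set of edges
assigned to the second current. -/
abbrev EdgeMarks (Λ' : Finset (Option V)) (n : Sym2 (Option V) → ℕ) : Type u :=
  (e : pairsIn Λ') → Fin (n e.1) → ZMod 2

open Classical in
/-- The marks extended by zero to the edges that are not over `Λ'`. -/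
noncomputable def extendMark {Λ' : Finset (Option V)} {n : Sym2 (Option V) → ℕ}
    (ε : EdgeMarks Λ' n) (e : Sym2 (Option V)) (k : Fin (n e)) : ZMod 2 :=
  if he : e ∈ pairsIn Λ' then ε ⟨e, he⟩ k else 0

theorem extendMark_add {Λ' : Finset (Option V)} {n : Sym2 (Option V) → ℕ}
    (ε ε' : EdgeMarks Λ' n) (e : Sym2 (Option V)) (k : Fin (n e)) :
    extendMark (ε + ε') e k = extendMark ε e k + extendMark ε' e k := by
  unfold extendMark
  split_ifs <;> simp

/-- The marks of the points of a block: those of the edges at the half-edges, `0` at the points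
`za(k)` and `b` at the points `zb(k)`. -/
def blockMark {Λ : Finset (Option V)} {n : Sym2 (Option V) → ℕ} {A B : Option V → ℕ}
    (δ : (e : Sym2 (Option V)) → Fin (n e) → ZMod 2) (b : ZMod 2) (z : V) :
    Block Λ n A B z → ZMod 2 :=
  Sum.elim (fun q => δ s(some z, q.1.1) q.2) (Sum.elim (fun _ => 0) fun _ => b)

open Classical in
/-- Every class of the tangled current contains an even number of marked points. -/
def Balanced {Λ : Finset (Option V)} {A B : Option V → ℕ} (T : TangledCurrent Λ A B)
    (δ : (e : Sym2 (Option V)) → Fin (T.1.1 e) → ZMod 2) (b : ZMod 2) : Prop :=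
  ∀ (z : Site Λ) (w : Block Λ T.1.1 A B z), ∑ x with (T.2 z).1 x w, blockMark δ b z.1 x = 0

/-- The number of ways of marking edges over `Λ'` for which every class contains an even number
of marked points. -/
noncomputable def markCount {Λ : Finset (Option V)} (Λ' : Finset (Option V))
    {A B : Option V → ℕ} (T : TangledCurrent Λ A B) (b : ZMod 2) : ℕ :=
  Nat.card {ε : EdgeMarks Λ' T.1.1 // Balanced T (extendMark ε) b}

/-! ### The switching principle for a tangled current -/

section Switching

variable {Λ Λ' : Finset (Option V)} {A B : Option V → ℕ} (T : TangledCurrent Λ A B)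

open Classical in
/-- The sum of a function on the points over the partition class of `w`. -/
noncomputable def boundary (μ : TVertex T → ZMod 2) (z : Site Λ) (w : Block Λ T.1.1 A B z) :
    ZMod 2 :=
  ∑ x with (T.2 z).1 x w, μ (some ⟨z, x⟩)

theorem boundary_add (μ ν : TVertex T → ZMod 2) (z : Site Λ) (w : Block Λ T.1.1 A B z) :
    boundary T (μ + ν) z w = boundary T μ z w + boundary T ν z w :=
  Finset.sum_add_distrib

theorem boundary_congr {μ ν : TVertex T → ZMod 2} (h : ∀ q, μ (some q) = ν (some q)) (z : Site Λ)
    (w : Block Λ T.1.1 A B z) : boundary T μ z w = boundary T ν z w :=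
  Finset.sum_congr rfl fun _ _ => h _

/-- The marks of the half-edges, as a function on all points. -/
noncomputable def vertexMark (ε : EdgeMarks Λ' T.1.1) : TVertex T → ZMod 2 :=
  fun v => v.elim 0 fun q => blockMark (extendMark ε) 0 q.1.1 q.2

theorem vertexMark_add (ε ε' : EdgeMarks Λ' T.1.1) :
    vertexMark T (ε + ε') = vertexMark T ε + vertexMark T ε' := by
  funext v
  rcases v with _ | ⟨z, q | q | q⟩
  · simp [vertexMark]
  · simp [vertexMark, blockMark, extendMark_add]
  · simp [vertexMark, blockMark]
  · simp [vertexMark, blockMark]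

theorem vertexMark_zero : vertexMark T (0 : EdgeMarks Λ' T.1.1) = 0 := by
  have h := vertexMark_add T (0 : EdgeMarks Λ' T.1.1) 0
  rw [add_zero] at h
  exact left_eq_add.1 h

open Classical in
/-- The indicator function of the points `zb(k)`. -/
noncomputable def bIndicator : TVertex T → ZMod 2 := fun v => if v ∈ bPoints T then 1 else 0

theorem balanced_zero_iff (ε : EdgeMarks Λ' T.1.1) :
    Balanced T (extendMark ε) 0 ↔ ∀ z w, boundary T (vertexMark T ε) z w = 0 := Iff.rfl

theorem notMem_bPoints_inl (z : Site Λ) (q : HalfEdge Λ T.1.1 z.1) :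
    (some ⟨z, .inl q⟩ : TVertex T) ∉ bPoints T := by
  rintro (⟨z', k, h⟩ | ⟨h, _⟩)
  · obtain ⟨rfl, h⟩ := Sigma.mk.inj (Option.some.inj h)
    cases eq_of_heq h
  · cases h

theorem notMem_bPoints_inr_inl (z : Site Λ) (q : Pts.{u} (A (some z.1))) :
    (some ⟨z, .inr (.inl q)⟩ : TVertex T) ∉ bPoints T := by
  rintro (⟨z', k, h⟩ | ⟨h, _⟩)
  · obtain ⟨rfl, h⟩ := Sigma.mk.inj (Option.some.inj h)
    cases eq_of_heq h
  · cases h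

theorem mem_bPoints_inr_inr (z : Site Λ) (q : Pts.{u} (B (some z.1))) :
    (some ⟨z, .inr (.inr q)⟩ : TVertex T) ∈ bPoints T :=
  Or.inl ⟨z, q, rfl⟩

theorem balanced_one_iff (ε : EdgeMarks Λ' T.1.1) :
    Balanced T (extendMark ε) 1
      ↔ ∀ z w, boundary T (vertexMark T ε) z w = boundary T (bIndicator T) z w := by
  refine forall_congr' fun z => forall_congr' fun w => ?_
  refine Iff.trans ?_ CharTwo.add_eq_zero
  refine Iff.trans (Eq.congr ?_ rfl) (Eq.congr (boundary_add T _ _ z w) rfl)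
  refine Finset.sum_congr rfl fun x _ => ?_
  rw [Pi.add_apply, bIndicator]
  rcases x with q | q | q
  · rw [if_neg (notMem_bPoints_inl T z q), add_zero]
    rfl
  · rw [if_neg (notMem_bPoints_inr_inl T z q), add_zero]
    rfl
  · rw [if_pos (mem_bPoints_inr_inr T z q)]
    rfl

open Classical in
/-- The function equal to one at the point `v` and zero elsewhere. -/
noncomputable def pointMass (v : TVertex T) : TVertex T → ZMod 2 :=
  fun v' => if v' = v then 1 else 0

theorem boundary_pointMass_eq (z : Site Λ) {p q : Block Λ T.1.1 A B z} (h : (T.2 z).1 p q)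
    (z' : Site Λ) (w : Block Λ T.1.1 A B z') :
    boundary T (pointMass T (some ⟨z, p⟩)) z' w = boundary T (pointMass T (some ⟨z, q⟩)) z' w := by
  classical
  unfold boundary
  by_cases hz : z = z'
  · subst hz
    have h1 : ∀ p : Block Λ T.1.1 A B z,
        ∑ x with (T.2 z).1 x w, pointMass T (some ⟨z, p⟩) (some ⟨z, x⟩)
          = if (T.2 z).1 p w then 1 else 0 := by
      intro p
      have h2 : ∀ x : Block Λ T.1.1 A B z,
          pointMass T (some ⟨z, p⟩) (some ⟨z, x⟩) = if x = p then 1 else 0 := by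
        intro x
        refine if_congr ⟨fun h => ?_, fun h => by rw [h]⟩ rfl rfl
        exact eq_of_heq (Sigma.mk.inj (Option.some.inj h)).2
      simp only [h2, Finset.sum_ite_eq', Finset.mem_filter, Finset.mem_univ, true_and]
    refine (h1 p).trans (Eq.trans (if_congr ⟨fun h' => ?_, fun h' => ?_⟩ rfl rfl) (h1 q).symm)
    · exact (T.2 z).1.trans ((T.2 z).1.symm h) h'
    · exact (T.2 z).1.trans h h'
  · have h1 : ∀ p x, pointMass T (some ⟨z, p⟩) (some ⟨z', x⟩) = 0 := fun p x =>
      if_neg fun h => hz (Sigma.mk.inj (Option.some.inj h)).1.symm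
    simp only [h1]

theorem some_inl_eq_iff (z x : Site Λ) (q : HalfEdge Λ T.1.1 z.1) (q' : HalfEdge Λ T.1.1 x.1) :
    (some ⟨z, .inl q⟩ : TVertex T) = some ⟨x, .inl q'⟩
      ↔ z = x ∧ q.1.1 = q'.1.1 ∧ (q.2 : ℕ) = q'.2 := by
  constructor
  · intro h
    obtain ⟨rfl, h⟩ := Sigma.mk.inj (Option.some.inj h)
    cases Sum.inl.inj (eq_of_heq h)
    exact ⟨rfl, rfl, rfl⟩
  · obtain ⟨⟨y, hy⟩, i⟩ := q
    obtain ⟨⟨y', hy'⟩, i'⟩ := q'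
    rintro ⟨rfl, h, hi⟩
    cases h
    cases Fin.ext hi
    rfl

open Classical in
/-- The marking of the single edge `e₀` with number `k`. -/
noncomputable def singleMark (Λ' : Finset (Option V)) (n : Sym2 (Option V) → ℕ)
    (e₀ : Sym2 (Option V)) (k : ℕ) : EdgeMarks Λ' n :=
  fun e i => if e.1 = e₀ ∧ (i : ℕ) = k then 1 else 0

open Classical in
theorem vertexMark_singleMark_inl {e₀ : Sym2 (Option V)} (he : e₀ ∈ pairsIn Λ') (k : ℕ)
    (z : Site Λ) (q : HalfEdge Λ T.1.1 z.1) :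
    vertexMark T (singleMark Λ' T.1.1 e₀ k) (some ⟨z, .inl q⟩)
      = if s(some z.1, q.1.1) = e₀ ∧ (q.2 : ℕ) = k then 1 else 0 := by
  have h : vertexMark T (singleMark Λ' T.1.1 e₀ k) (some ⟨z, .inl q⟩)
      = extendMark (singleMark Λ' T.1.1 e₀ k) s(some z.1, q.1.1) q.2 := rfl
  rw [h, extendMark]
  by_cases h1 : s(some z.1, q.1.1) ∈ pairsIn Λ'
  · rw [dif_pos h1]
    rfl
  · rw [dif_neg h1, if_neg]
    rintro ⟨rfl, -⟩
    exact h1 he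

theorem pointMass_inr (x z : Site Λ) (q' : HalfEdge Λ T.1.1 x.1)
    (q : Pts.{u} (A (some z.1)) ⊕ Pts.{u} (B (some z.1))) :
    pointMass T (some ⟨x, .inl q'⟩) (some ⟨z, .inr q⟩) = 0 := by
  refine if_neg fun h => ?_
  obtain ⟨rfl, h⟩ := Sigma.mk.inj (Option.some.inj h)
  cases eq_of_heq h

theorem vertexMark_inr (ε : EdgeMarks Λ' T.1.1) (z : Site Λ)
    (q : Pts.{u} (A (some z.1)) ⊕ Pts.{u} (B (some z.1))) :
    vertexMark T ε (some ⟨z, .inr q⟩) = 0 := by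
  rcases q with q | q <;> rfl

open Classical in
/-- The two ends of an edge over `Λ'`, or the end different from the ghost, are the boundary of
a marking; so are two points of the same class. -/
theorem exists_marks_of_link {v v' : TVertex T} (h : Link Λ' T v v') :
    ∃ ε : EdgeMarks Λ' T.1.1, ∀ z w,
      boundary T (vertexMark T ε) z w = boundary T (pointMass T v + pointMass T v') z w := by
  cases h with
  | tangle z p q hz hpq =>
    refine ⟨0, fun z' w => ?_⟩
    rw [vertexMark_zero, boundary_add, boundary_pointMass_eq T z hpq, CharTwo.add_self_eq_zero]
    exact Finset.sum_const_zero
  | edge x y hx hy k l hkl =>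
    have he : s(some x.1, some y.1) ∈ pairsIn Λ' := by
      refine mem_pairsIn.2 ⟨(T.1.2 _ (fun h0 => ?_)).1, fun w hw => ?_⟩
      · exact (Fin.cast h0 k).elim0
      · rcases Sym2.mem_iff.1 hw with rfl | rfl
        · exact hx
        · exact hy
    have hxy : x ≠ y := fun h => (mem_pairsIn.1 he).1 (by rw [h]; exact Sym2.mk_isDiag_iff.2 rfl)
    refine ⟨singleMark Λ' T.1.1 s(some x.1, some y.1) k, fun z w => ?_⟩
    refine boundary_congr T (fun q => ?_) z w
    obtain ⟨z, q | q⟩ := q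
    · rw [vertexMark_singleMark_inl T he, Pi.add_apply, pointMass, pointMass]
      have h1 := some_inl_eq_iff T z x q ⟨⟨some y.1, Finset.mem_eraseNone.1 y.2⟩, k⟩
      have h2 := some_inl_eq_iff T z y q ⟨⟨some x.1, Finset.mem_eraseNone.1 x.2⟩, l⟩
      have h3 : s(some z.1, q.1.1) = s(some x.1, some y.1)
          ↔ (z = x ∧ q.1.1 = some y.1) ∨ (z = y ∧ q.1.1 = some x.1) := by
        rw [Sym2.eq_iff, Option.some_inj, Option.some_inj, ← Subtype.ext_iff, ← Subtype.ext_iff]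
      simp only [h1, h2, h3]
      by_cases hz : z = x
      · have hy' : z ≠ y := fun h => hxy (hz.symm.trans h)
        simp only [hz, hxy, true_and, false_and, or_false, if_false, add_zero]
      · simp only [hz, false_and, false_or, if_false, zero_add, hkl, and_assoc]
    · rw [vertexMark_inr, Pi.add_apply, pointMass_inr, pointMass_inr, add_zero]
  | ghost x hx hg hg' k =>
    have he : s(some x.1, none) ∈ pairsIn Λ' := by
      refine mem_pairsIn.2 ⟨fun h => ?_, fun w hw => ?_⟩
      · cases Sym2.mk_isDiag_iff.1 h
      · rcases Sym2.mem_iff.1 hw with rfl | rfl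
        · exact hx
        · exact hg'
    refine ⟨singleMark Λ' T.1.1 s(some x.1, none) k, fun z w => ?_⟩
    refine boundary_congr T (fun q => ?_) z w
    have h0 : pointMass T none (some q) = 0 := if_neg (Option.some_ne_none q)
    rw [Pi.add_apply, h0, add_zero]
    obtain ⟨z, q | q⟩ := q
    · rw [vertexMark_singleMark_inl T he, pointMass]
      have h1 := some_inl_eq_iff T z x q ⟨⟨none, hg⟩, k⟩
      have h3 : s(some z.1, q.1.1) = s(some x.1, none) ↔ z = x ∧ q.1.1 = none := by
        rw [Sym2.eq_iff, Option.some_inj, ← Subtype.ext_iff]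
        exact or_iff_left fun h => by cases h.1
      simp only [h1, h3, and_assoc]
    · rw [vertexMark_inr, pointMass_inr]

open Classical in
theorem exists_marks_of_reachable {v v' : TVertex T} (h : (tangledGraph Λ' T).Reachable v v') :
    ∃ ε : EdgeMarks Λ' T.1.1, ∀ z w,
      boundary T (vertexMark T ε) z w = boundary T (pointMass T v + pointMass T v') z w := by
  rw [SimpleGraph.reachable_iff_reflTransGen] at h
  induction h with
  | refl =>
    refine ⟨0, fun z w => ?_⟩
    rw [vertexMark_zero, boundary_add, CharTwo.add_self_eq_zero]
    exact Finset.sum_const_zero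
  | @tail b c _ hbc ih =>
    obtain ⟨ε, hε⟩ := ih
    have h1 : ∃ ε : EdgeMarks Λ' T.1.1, ∀ z w,
        boundary T (vertexMark T ε) z w = boundary T (pointMass T b + pointMass T c) z w := by
      rcases ((SimpleGraph.fromRel_adj _ _ _).1 hbc).2 with h | h
      · exact exists_marks_of_link T h
      · rw [add_comm]
        exact exists_marks_of_link T h
    obtain ⟨ε', hε'⟩ := h1
    refine ⟨ε + ε', fun z w => ?_⟩
    rw [vertexMark_add, boundary_add, hε, hε']
    simp only [boundary_add]
    rw [add_assoc, CharTwo.add_cancel_left]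

end Switching

/-- A function summed over a set that meets every component of a graph in an even number of points
is unchanged modulo two if the points are moved to a root of their component and added. -/
theorem sum_add_root {X : Type*} [Fintype X] (G : SimpleGraph X) (b : Set X)
    [DecidablePred (· ∈ b)] (hb : ∀ C : G.ConnectedComponent, Even (Set.ncard (C.supp ∩ b)))
    (pm : X → X → ZMod 2) (h1 : ∀ v, pm v v = 1) (h0 : ∀ v v', v ≠ v' → pm v v' = 0) (v : X) :
    ∑ x with x ∈ b, (pm x v + pm (G.connectedComponentMk x).out v) = if v ∈ b then 1 else 0 := by
  classical
  have hpm : ∀ v v', pm v v' = if v = v' then 1 else 0 := by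
    intro v v'
    split_ifs with h
    · rw [h, h1]
    · exact h0 v v' h
  have hmk : ∀ v, G.connectedComponentMk (G.connectedComponentMk v).out
      = G.connectedComponentMk v := fun v => Quot.out_eq _
  simp only [hpm]
  rw [Finset.sum_add_distrib, Finset.sum_ite_eq', ← Finset.sum_filter, Finset.filter_filter]
  simp only [Finset.mem_filter, Finset.mem_univ, true_and]
  rw [add_eq_left]
  by_cases hv : (G.connectedComponentMk v).out = v
  · have h3 := (even_ncard_iff_sum (fun x => x ∈ (G.connectedComponentMk v).supp ∩ b)).1
      (hb (G.connectedComponentMk v))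
    rw [← h3]
    refine Finset.sum_congr (Finset.filter_congr fun x _ => ?_) fun _ _ => rfl
    rw [and_comm, Set.mem_inter_iff]
    refine and_congr_left fun _ => ?_
    rw [SimpleGraph.ConnectedComponent.mem_supp_iff]
    constructor
    · intro hx
      rw [← hmk x, hx]
    · intro hx
      rw [hx, hv]
  · refine Finset.sum_eq_zero fun x hx => absurd ?_ hv
    have hx' := (Finset.mem_filter.1 hx).2.2
    have hc : G.connectedComponentMk v = G.connectedComponentMk x := by rw [← hmk x, hx']
    rw [hc, hx']

section Switching

variable {Λ Λ' : Finset (Option V)} {A B : Option V → ℕ} (T : TangledCurrent Λ A B)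

open Classical in
theorem exists_marks_of_finset (f : TVertex T → TVertex T)
    (hf : ∀ v, (tangledGraph Λ' T).Reachable v (f v)) (s : Finset (TVertex T)) :
    ∃ ε : EdgeMarks Λ' T.1.1, ∀ z w, boundary T (vertexMark T ε) z w
      = boundary T (fun v' => ∑ v ∈ s, (pointMass T v v' + pointMass T (f v) v')) z w := by
  induction s using Finset.induction_on with
  | empty =>
    refine ⟨0, fun z w => ?_⟩
    rw [vertexMark_zero]
    simp only [Finset.sum_empty]
    rfl
  | insert v s hv ih =>
    obtain ⟨ε, hε⟩ := ih
    obtain ⟨ε', hε'⟩ := exists_marks_of_reachable T (hf v)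
    refine ⟨ε' + ε, fun z w => ?_⟩
    rw [vertexMark_add, boundary_add, hε, hε', ← boundary_add]
    simp only [Finset.sum_insert hv]
    rfl

/-- If every component contains an even number of the points `zb(k)`, then joining each of these
points to a chosen root of its component yields marks for which all classes are balanced. -/
theorem exists_balanced_of_mem_pairingEvent (h : T ∈ pairingEvent Λ Λ' A B) :
    ∃ ε : EdgeMarks Λ' T.1.1, Balanced T (extendMark ε) 1 := by
  classical
  obtain ⟨ε, hε⟩ := exists_marks_of_finset (Λ' := Λ') T
    (fun v => ((tangledGraph Λ' T).connectedComponentMk v).out)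
    (fun v => SimpleGraph.ConnectedComponent.exact (Quot.out_eq _).symm)
    (Finset.univ.filter fun v => v ∈ bPoints T)
  refine ⟨ε, (balanced_one_iff T ε).2 fun z w => ?_⟩
  rw [hε]
  congr 1
  funext v
  exact sum_add_root (tangledGraph Λ' T) (bPoints T) h (pointMass T) (fun v => if_pos rfl)
    (fun v v' hv => if_neg hv.symm) v

/-- The other end of an edge between two sites; all other points are fixed. -/
def opposite : TVertex T → TVertex T
  | some ⟨x, .inl ⟨⟨some y, hy⟩, k⟩⟩ =>
    some ⟨⟨y, Finset.mem_eraseNone.2 hy⟩,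
      .inl ⟨⟨some x.1, Finset.mem_eraseNone.1 x.2⟩, Fin.cast (by rw [Sym2.eq_swap]) k⟩⟩
  | v => v

theorem vertexMark_outside (ε : EdgeMarks Λ' T.1.1) (z : Site Λ) (hz : some z.1 ∉ Λ')
    (x : Block Λ T.1.1 A B z.1) : vertexMark T ε (some ⟨z, x⟩) = 0 := by
  rcases x with q | q
  · exact dif_neg fun h => hz ((mem_pairsIn.1 h).2 _ (Sym2.mem_mk_left _ _))
  · exact vertexMark_inr T ε z q

theorem bIndicator_outside (hB : ∀ x, x ∉ Λ' → B x = 0) (z : Site Λ) (hz : some z.1 ∉ Λ')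
    (x : Block Λ T.1.1 A B z.1) : bIndicator T (some ⟨z, x⟩) = 0 := by
  refine if_neg ?_
  rcases x with q | q | q
  · exact notMem_bPoints_inl T z q
  · exact notMem_bPoints_inr_inl T z q
  · exact (Fin.cast (hB _ hz) q.down).elim0

/-- If no half-edge in a set closed under links is joined to the ghost, the marked half-edges of the
set come in pairs of opposite ends. -/
theorem sum_vertexMark_closed (ε : EdgeMarks Λ' T.1.1) (S : TVertex T → Prop)
    [DecidablePred S]
    (hS : ∀ v v', Link Λ' T v v' → (S v ↔ S v')) (hnone : ¬ S none) :
    ∑ v with S v, vertexMark T ε v = 0 := by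
  classical
  rw [← Finset.sum_filter_ne_zero, Finset.filter_filter]
  -- The two ends of a marked edge have the same mark, and belong both to `S` or both not.
  have key : ∀ v, S v → vertexMark T ε v ≠ 0 →
      S (opposite T v) ∧ vertexMark T ε (opposite T v) = vertexMark T ε v ∧
        opposite T v ≠ v ∧ opposite T (opposite T v) = v := by
    rintro (_ | ⟨x, ⟨⟨y, hy⟩, k⟩ | q⟩) hv h0
    · exact absurd hv hnone
    · have he : s(some x.1, y) ∈ pairsIn Λ' := by
        by_contra he
        exact h0 (dif_neg he)
      have hx := (mem_pairsIn.1 he).2 _ (Sym2.mem_mk_left _ _)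
      have hy' := (mem_pairsIn.1 he).2 _ (Sym2.mem_mk_right _ _)
      rcases y with _ | y
      · exact absurd ((hS _ _ (Link.ghost x hx hy hy' k)).1 hv) hnone
      · refine ⟨(hS _ _ (Link.edge x ⟨y, Finset.mem_eraseNone.2 hy⟩ hx hy' k _ rfl)).1 hv,
          ?_, ?_, rfl⟩
        · change extendMark ε s(some y, some x.1) _ = extendMark ε s(some x.1, some y) _
          have hgen : ∀ (e e' : Sym2 (Option V)) (h : e = e') (k : Fin (T.1.1 e)),
              extendMark ε e' (Fin.cast (by rw [h]) k) = extendMark ε e k := by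
            rintro e _ rfl k
            rfl
          exact hgen _ _ Sym2.eq_swap k
        · intro h
          have := (Sigma.mk.inj (Option.some.inj h)).1
          exact (mem_pairsIn.1 he).1
            (Sym2.mk_isDiag_iff.2 (congrArg (fun z : Site Λ => some z.1) this).symm)
    · exact absurd (vertexMark_inr T ε x q) h0
  refine Finset.sum_involution (fun v _ => opposite T v) ?_ ?_ ?_ ?_
  · intro v hv
    obtain ⟨h1, h2⟩ := (Finset.mem_filter.1 hv).2
    rw [(key v h1 h2).2.1, CharTwo.add_self_eq_zero]
  · intro v hv _
    obtain ⟨h1, h2⟩ := (Finset.mem_filter.1 hv).2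
    exact (key v h1 h2).2.2.1
  · intro v hv
    obtain ⟨h1, h2⟩ := (Finset.mem_filter.1 hv).2
    refine Finset.mem_filter.2 ⟨Finset.mem_univ _, (key v h1 h2).1, ?_⟩
    rw [(key v h1 h2).2.1]
    exact h2
  · intro v hv
    obtain ⟨h1, h2⟩ := (Finset.mem_filter.1 hv).2
    exact (key v h1 h2).2.2.2

theorem sum_bIndicator_closed (hB : ∀ x, x ∉ Λ' → B x = 0) {ε : EdgeMarks Λ' T.1.1}
    (hε : Balanced T (extendMark ε) 1) (S : TVertex T → Prop)
    [DecidablePred S]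
    (hS : ∀ v v', Link Λ' T v v' → (S v ↔ S v')) (hnone : ¬ S none) :
    ∑ v with S v, bIndicator T v = 0 := by
  classical
  have h1 := sum_vertexMark_closed T ε S hS hnone
  have h2 : ∑ v with S v, (vertexMark T ε v + bIndicator T v) = 0 := by
    rw [Finset.sum_filter, Fintype.sum_option, if_neg hnone, zero_add, Fintype.sum_sigma]
    refine Finset.sum_eq_zero fun z _ => ?_
    rw [← Finset.sum_filter]
    by_cases hz : some z.1 ∈ Λ'
    · refine sum_saturated_eq_zero (T.2 z).1 _ _
        (fun p q hpq => hS _ _ (Link.tangle z p q hz hpq)) fun w _ => ?_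
      have := (balanced_one_iff T ε).1 hε z w
      rw [← CharTwo.add_eq_zero, ← boundary_add] at this
      exact this
    · refine Finset.sum_eq_zero fun x _ => ?_
      rw [vertexMark_outside T ε z hz, bIndicator_outside T hB z hz, add_zero]
  rwa [Finset.sum_add_distrib, h1, zero_add] at h2

theorem sum_site {M : Type*} [AddCommMonoid M] (Λ : Finset (Option V)) (f : Option V → M)
    (hf : f none = 0) : ∑ x : Site Λ, f (some x.1) = ∑ x ∈ Λ, f x :=
  prod_site (M := Multiplicative M) Λ f hf

theorem sum_bIndicator (hΛ : Λ' ⊆ Λ) (hB : IsMoment Λ' B) : ∑ v, bIndicator T v = 0 := by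
  classical
  rw [Fintype.sum_option, Fintype.sum_sigma]
  have h1 : ∀ z : Site Λ, ∑ x : Block Λ T.1.1 A B z.1, bIndicator T (some ⟨z, x⟩)
      = (B (some z.1) : ZMod 2) := by
    intro z
    rw [Fintype.sum_sum_type, Fintype.sum_sum_type]
    simp only [bIndicator, notMem_bPoints_inl, notMem_bPoints_inr_inl, mem_bPoints_inr_inr, if_true,
      if_false, Finset.sum_const_zero, zero_add, Finset.sum_const, Finset.card_univ,
      Fintype.card_ulift, Fintype.card_fin, nsmul_one]
  have h2 : bIndicator T none = (B none : ZMod 2) := by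
    have hiff : (none : TVertex T) ∈ bPoints T ↔ B none = 1 := by
      constructor
      · rintro (⟨z, k, h⟩ | h)
        · cases h
        · exact h.2
      · exact fun h => Or.inr ⟨rfl, h⟩
    rw [bIndicator, if_congr hiff rfl rfl]
    have := hB.2.1
    interval_cases B none <;> rfl
  simp only [h1, h2]
  have h3 : ∑ x : Site Λ, (B (some x.1) : ZMod 2) = ∑ x ∈ Λ.erase none, (B x : ZMod 2) := by
    have h := sum_site Λ (fun x => if x = none then (0 : ZMod 2) else (B x : ZMod 2)) (if_pos rfl)
    simp only [reduceCtorEq, if_false] at h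
    have h' := Finset.sum_erase Λ (a := none)
      (f := fun x : Option V => if x = none then (0 : ZMod 2) else (B x : ZMod 2)) (if_pos rfl)
    rw [h, ← h']
    exact Finset.sum_congr rfl fun x hx => if_neg (Finset.mem_erase.1 hx).1
  have h4 : ∑ x ∈ Λ, (B x : ZMod 2) = 0 := by
    rw [← Finset.sum_subset hΛ fun x _ hx => by rw [hB.1 x hx, Nat.cast_zero], ← Nat.cast_sum]
    exact ZMod.natCast_eq_zero_iff_even.2 hB.2.2
  rw [h3, ← h4]
  by_cases hg : none ∈ Λ
  · exact Finset.add_sum_erase Λ (fun x => (B x : ZMod 2)) hg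
  · rw [hB.1 none fun h => hg (hΛ h), Nat.cast_zero, zero_add, Finset.erase_eq_of_notMem hg]

/-- If the classes are balanced, summation over the classes of a component shows that the number of
its points `zb(k)` has the parity of its marked half-edges, which is even. The component of the
ghost is left out, and treated by the total parity of the moment. -/
theorem mem_pairingEvent_of_balanced (hΛ : Λ' ⊆ Λ) (hB : IsMoment Λ' B)
    {ε : EdgeMarks Λ' T.1.1} (hε : Balanced T (extendMark ε) 1) :
    T ∈ pairingEvent Λ Λ' A B := by
  classical
  intro C
  have hlink : ∀ v v', Link Λ' T v v' → (v ∈ C.supp ↔ v' ∈ C.supp) := by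
    intro v v' h
    by_cases hv : v = v'
    · rw [hv]
    · exact SimpleGraph.ConnectedComponent.mem_supp_congr_adj C
        ((SimpleGraph.fromRel_adj _ _ _).2 ⟨hv, Or.inl h⟩)
  suffices h : ∑ v with v ∈ C.supp, bIndicator T v = 0 by
    refine (even_ncard_iff_sum (fun v => v ∈ C.supp ∩ bPoints T)).2 ?_
    rw [← h]
    simp only [Finset.sum_filter, Set.mem_inter_iff, ite_and, bIndicator]
  by_cases hn : none ∈ C.supp
  · -- The component of the ghost is the complement of the union of the others.
    have h1 := sum_bIndicator_closed T hB.1 hε (fun v => v ∉ C.supp)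
      (fun v v' h => not_congr (hlink v v' h)) (not_not_intro hn)
    have h2 := Finset.sum_filter_add_sum_filter_not Finset.univ (fun v => v ∈ C.supp)
      (bIndicator T)
    rwa [h1, add_zero, sum_bIndicator T hΛ hB] at h2
  · exact sum_bIndicator_closed T hB.1 hε _ hlink hn

open Classical in
/-- **Switching for a tangled current.** The sets of edges with odd boundary at the points `zb(k)`
form a coset of the sets of edges with even boundary if there is one at all, which is the case if
and only if every component contains an even number of the points `zb(k)`. -/
theorem markCount_one (hΛ : Λ' ⊆ Λ) (hB : IsMoment Λ' B) :
    markCount Λ' T 1 = if T ∈ pairingEvent Λ Λ' A B then markCount Λ' T 0 else 0 := by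
  split_ifs with h
  · obtain ⟨ε₀, h₀⟩ := exists_balanced_of_mem_pairingEvent T h
    rw [balanced_one_iff] at h₀
    refine Nat.card_congr ((Equiv.addRight ε₀).subtypeEquiv fun ε => ?_)
    rw [balanced_one_iff, balanced_zero_iff]
    refine forall_congr' fun z => forall_congr' fun w => ?_
    rw [Equiv.coe_addRight, vertexMark_add, boundary_add, h₀, CharTwo.add_eq_zero]
  · have : IsEmpty {ε : EdgeMarks Λ' T.1.1 // Balanced T (extendMark ε) 1} :=
      ⟨fun ε => h (mem_pairingEvent_of_balanced T hΛ hB ε.2)⟩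
    exact Nat.card_of_isEmpty

instance instFiniteEdgeMarks (n : Sym2 (Option V) → ℕ) : Finite (EdgeMarks Λ' n) := by
  classical
  infer_instance

theorem markCount_zero_pos : 0 < markCount Λ' T 0 := by
  have : Nonempty {ε : EdgeMarks Λ' T.1.1 // Balanced T (extendMark ε) 0} := by
    refine ⟨0, (balanced_zero_iff T 0).2 fun z w => ?_⟩
    rw [vertexMark_zero]
    exact Finset.sum_const_zero
  exact Nat.card_pos

/-- The event in terms of edge markings. In this form its invariance under the numbering of the
edges is plain. -/
theorem mem_pairingEvent_iff (hΛ : Λ' ⊆ Λ) (hB : IsMoment Λ' B) :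
    T ∈ pairingEvent Λ Λ' A B ↔ markCount Λ' T 1 ≠ 0 := by
  rw [markCount_one T hΛ hB]
  split_ifs with h
  · exact iff_of_true h (markCount_zero_pos T).ne'
  · exact iff_of_false h fun h => h rfl

end Switching

/-! ### Marked tangled currents and pairs of currents -/

theorem sum_class_congr {X Y : Type u} [Fintype X] [Fintype Y] (e : X ≃ Y) (r : EvenPart X)
    (m : Y → ZMod 2) (w : Y) [DecidablePred fun y => (r.congr e).1 y w]
    [DecidablePred fun x => r.1 x (e.symm w)] :
    ∑ y with (r.congr e).1 y w, m y = ∑ x with r.1 x (e.symm w), m (e x) := by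
  rw [Finset.sum_filter, Finset.sum_filter, ← Equiv.sum_comp e]
  refine Finset.sum_congr rfl fun x _ => if_congr ?_ rfl rfl
  rw [EvenPart.congr_rel, Equiv.symm_apply_apply]

/-- The number of points with mark one. -/
def ones {m : ℕ} (f : Fin m → ZMod 2) : ℕ := Fintype.card {k // f k = 1}

/-- Two markings with the same number of marked points differ by a permutation. -/
theorem exists_perm_of_ones_eq {m : ℕ} (f f' : Fin m → ZMod 2) (h : ones f = ones f') :
    ∃ σ : Equiv.Perm (Fin m), f' = f ∘ σ.symm := by
  have h01 : ∀ x : ZMod 2, x = 0 ↔ ¬ x = 1 := by decide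
  have h0 : Fintype.card {k // f k = 0} = Fintype.card {k // f' k = 0} := by
    have e1 := Fintype.card_subtype_compl (fun k => f k = 1)
    have e2 := Fintype.card_subtype_compl (fun k => f' k = 1)
    simp only [← h01] at e1 e2
    rw [e1, e2]
    exact congrArg _ h
  have e : ∀ c : ZMod 2, Nonempty ({k // f' k = c} ≃ {k // f k = c}) := fun c =>
    match c with
    | 0 => ⟨(Fintype.equivOfCardEq h0).symm⟩
    | 1 => ⟨(Fintype.equivOfCardEq h).symm⟩
  refine ⟨(Equiv.ofFiberEquiv fun c => (e c).some).symm, funext fun k => ?_⟩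
  exact (Equiv.ofFiberEquiv_map (fun c => (e c).some) k).symm

theorem card_ones_eq (m k : ℕ) : Fintype.card {f : Fin m → ZMod 2 // ones f = k} = m.choose k := by
  have h01 : ∀ x : ZMod 2, x = 1 ∨ x = 0 := by decide
  have h := Fintype.card_finset_len (α := Fin m) k
  rw [Fintype.card_fin] at h
  rw [← h]
  refine Fintype.card_congr
    { toFun := fun f => ⟨Finset.univ.filter fun i => f.1 i = 1, by
        exact (Fintype.card_subtype _).symm.trans f.2⟩
      invFun := fun s => ⟨fun i => if i ∈ s.1 then 1 else 0, by
        refine Eq.trans ?_ s.2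
        rw [ones, Fintype.card_subtype]
        congr 1
        ext i
        simp⟩
      left_inv := fun f => ?_
      right_inv := fun s => ?_ }
  · refine Subtype.ext (funext fun i => ?_)
    rcases h01 (f.1 i) with h | h <;> simp [h]
  · refine Subtype.ext ?_
    ext i
    simp

section Pairs

variable {Λ Λ' : Finset (Option V)} {A B : Option V → ℕ}

theorem ones_extendMark {n : Sym2 (Option V) → ℕ} (ε : EdgeMarks Λ' n) (e : Sym2 (Option V)) :
    ones (extendMark ε e) = open Classical in
      if he : e ∈ pairsIn Λ' then ones (ε ⟨e, he⟩) else 0 := by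
  classical
  split_ifs with he
  · unfold ones extendMark
    simp only [he, dif_pos]
  · unfold ones extendMark
    simp [he]

/-- The sum of the two currents of a pair. -/
def totalCurrent (hΛ : Λ' ⊆ Λ) (p : CurrentPair Λ Λ' A B) :
    {n : Sym2 (Option V) → ℕ // IsCurrent Λ n} :=
  ⟨p.1.1 + p.1.2, fun e he => by
    by_cases h1 : p.1.1 e = 0
    · have h2 : p.1.2 e ≠ 0 := fun h2 => he (by simp [h1, h2])
      exact ⟨(p.2.2.1 e h2).1, fun x hx => hΛ ((p.2.2.1 e h2).2 x hx)⟩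
    · exact p.2.1 e h1⟩

/-- The marking of the edges of the second current, which are numbered after those of the
first. -/
def secondMark (hΛ : Λ' ⊆ Λ) (p : CurrentPair Λ Λ' A B) (e : Sym2 (Option V))
    (k : Fin ((totalCurrent hΛ p).1 e)) : ZMod 2 :=
  if p.1.1 e ≤ k then 1 else 0

theorem ones_secondMark (hΛ : Λ' ⊆ Λ) (p : CurrentPair Λ Λ' A B) (e : Sym2 (Option V)) :
    ones (secondMark hΛ p e) = p.1.2 e := by
  have h : ∀ a b : ℕ, Fintype.card {k : Fin (a + b) //
      (if a ≤ (k : ℕ) then (1 : ZMod 2) else 0) = 1} = b := by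
    intro a b
    rw [Fintype.card_congr (finSumFinEquiv.subtypeEquiv (p := fun s : Fin a ⊕ Fin b =>
      s.isRight = true) fun s => ?_).symm]
    · rw [Fintype.card_congr (β := Fin b)
        ⟨fun x => x.1.getRight x.2, fun x => ⟨.inr x, rfl⟩, ?_, fun x => rfl⟩, Fintype.card_fin]
      rintro ⟨x | y, hx⟩
      · cases hx
      · rfl
    · rcases s with s | s
      · simp [not_le.2 s.2]
      · simp
  exact h _ _

open Classical in
/-- The sum of `G` over the tanglings of the current `n` for which the marks are balanced. -/
noncomputable def balancedSum (G : TangledCurrent Λ A B → ℝ)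
    (n : {n : Sym2 (Option V) → ℕ // IsCurrent Λ n})
    (δ : (e : Sym2 (Option V)) → Fin (n.1 e) → ZMod 2) : ℝ :=
  ∑ τ : (z : Site Λ) → EvenPart (Block Λ n.1 A B z),
    if Balanced (⟨n, τ⟩ : TangledCurrent Λ A B) δ 1 then G ⟨n, τ⟩ else 0

theorem blockMark_blockAdd_inl (hΛ : Λ' ⊆ Λ) (p : CurrentPair Λ Λ' A B) (z : Site Λ)
    (q : SBlock Λ p.1.1 A z.1) :
    blockMark (A := A) (B := B) (secondMark hΛ p) 1 z.1
      (blockAdd Λ p.1.1 p.1.2 A B z.1 (.inl q)) = 0 := by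
  rcases q with ⟨y, k⟩ | q
  · exact if_neg (not_le.2 k.2)
  · rfl

theorem blockMark_blockAdd_inr (hΛ : Λ' ⊆ Λ) (p : CurrentPair Λ Λ' A B) (z : Site Λ)
    (q : SBlock Λ p.1.2 B z.1) :
    blockMark (A := A) (B := B) (secondMark hΛ p) 1 z.1
      (blockAdd Λ p.1.1 p.1.2 A B z.1 (.inr q)) = 1 := by
  rcases q with ⟨y, k⟩ | q
  · exact if_pos (Nat.le_add_right _ _)
  · rfl

open Classical in
/-- Admissibility of a partition of a block amounts to an even number of points of the second
current in each class. -/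
theorem exists_admPart_iff (hΛ : Λ' ⊆ Λ) (p : CurrentPair Λ Λ' A B) (z : Site Λ)
    (r : EvenPart (Block Λ (totalCurrent hΛ p).1 A B z.1)) :
    (∃ s : AdmPart (SBlock Λ p.1.1 A z.1) (SBlock Λ p.1.2 B z.1),
      s.toEvenPart.congr (blockAdd Λ p.1.1 p.1.2 A B z.1) = r)
    ↔ ∀ w, ∑ x with r.1 x w, blockMark (secondMark hΛ p) 1 z.1 x = 0 := by
  set e := blockAdd Λ p.1.1 p.1.2 A B z.1 with he
  obtain ⟨r', rfl⟩ := (EvenPart.congrEquiv e).surjective r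
  have h1 : (∃ s : AdmPart (SBlock Λ p.1.1 A z.1) (SBlock Λ p.1.2 B z.1),
      s.toEvenPart.congr e = EvenPart.congrEquiv e r')
      ↔ ∃ s : AdmPart (SBlock Λ p.1.1 A z.1) (SBlock Λ p.1.2 B z.1), s.toEvenPart = r' :=
    exists_congr fun s => (EvenPart.congrEquiv e).injective.eq_iff
  rw [h1, exists_toEvenPart_eq]
  refine e.forall_congr fun {w} => ?_
  rw [even_ncard_iff_sum]
  refine Eq.congr ?_ rfl
  refine Eq.trans ?_ (sum_class_congr e r' (blockMark (secondMark hΛ p) 1 z.1) (e w)).symm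
  rw [Finset.sum_filter, Finset.sum_filter, Equiv.symm_apply_apply]
  refine Eq.trans ?_ (Fintype.sum_sum_type _).symm
  simp only [he, blockMark_blockAdd_inl, blockMark_blockAdd_inr, ite_self, Finset.sum_const_zero,
    zero_add]

open Classical in
/-- The tanglings of a pair of currents are the tanglings of its sum for which the second current
is balanced. -/
theorem sum_tangling_eq (hΛ : Λ' ⊆ Λ) (p : CurrentPair Λ Λ' A B)
    (G : TangledCurrent Λ A B → ℝ) :
    ∑ t : Tangling p, G (assemble hΛ p t)
      = balancedSum G (totalCurrent hΛ p) (secondMark hΛ p) := by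
  rw [balancedSum, ← Finset.sum_filter]
  refine Finset.sum_bij (fun t _ z => (t z).toEvenPart.congr (blockAdd Λ p.1.1 p.1.2 A B z.1))
    ?_ ?_ ?_ fun _ _ => rfl
  · intro t _
    refine Finset.mem_filter.2 ⟨Finset.mem_univ _, fun z => ?_⟩
    exact (exists_admPart_iff hΛ p z _).1 ⟨t z, rfl⟩
  · intro t _ t' _ h
    funext z
    exact AdmPart.toEvenPart_injective ((EvenPart.congrEquiv _).injective (congrFun h z))
  · intro τ hτ
    have h := fun z => (exists_admPart_iff hΛ p z (τ z)).2 ((Finset.mem_filter.1 hτ).2 z)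
    choose t ht using h
    exact ⟨t, Finset.mem_univ _, funext ht⟩

theorem balanced_relabel (T : TangledCurrent Λ A B)
    (σ : (e : Sym2 (Option V)) → Equiv.Perm (Fin (T.1.1 e)))
    (δ : (e : Sym2 (Option V)) → Fin (T.1.1 e) → ZMod 2) (b : ZMod 2) :
    Balanced (relabel T σ) (fun e => δ e ∘ (σ e).symm) b ↔ Balanced T δ b := by
  classical
  refine forall_congr' fun z => ?_
  let e : Block Λ T.1.1 A B z.1 ≃ Block Λ T.1.1 A B z.1 :=
    Equiv.sumCongr (Equiv.sigmaCongrRight fun y : Λ => σ s(some z.1, y.1)) (Equiv.refl _)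
  refine (e.forall_congr (p := fun w => ∑ x with (T.2 z).1 x w, blockMark δ b z.1 x = 0)
    (q := fun w => ∑ x with ((T.2 z).congr e).1 x w,
      blockMark (fun e => δ e ∘ (σ e).symm) b z.1 x = 0) fun {w} => Eq.congr ?_ rfl).symm
  refine Eq.trans ?_ (sum_class_congr e (T.2 z) _ (e w)).symm
  rw [Equiv.symm_apply_apply]
  refine Finset.sum_congr rfl fun x _ => ?_
  rcases x with ⟨y, k⟩ | q
  · exact (congrArg (δ _) ((σ _).symm_apply_apply k)).symm
  · rfl

theorem balancedSum_relabel (G : TangledCurrent Λ A B → ℝ)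
    (hG : ∀ (T : TangledCurrent Λ A B) (σ : (e : Sym2 (Option V)) → Equiv.Perm (Fin (T.1.1 e))),
      G (relabel T σ) = G T)
    (n : {n : Sym2 (Option V) → ℕ // IsCurrent Λ n})
    (δ : (e : Sym2 (Option V)) → Fin (n.1 e) → ZMod 2)
    (σ : (e : Sym2 (Option V)) → Equiv.Perm (Fin (n.1 e))) :
    balancedSum G n (fun e => δ e ∘ (σ e).symm) = balancedSum G n δ := by
  classical
  refine (Fintype.sum_equiv (Equiv.piCongrRight fun z : Site Λ => EvenPart.congrEquiv
    (Equiv.sumCongr (Equiv.sigmaCongrRight fun y : Λ => σ s(some z.1, y.1))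
      (Equiv.refl (Pts.{u} (A (some z.1)) ⊕ Pts.{u} (B (some z.1)))))) _ _ fun τ => ?_).symm
  have h1 := balanced_relabel (⟨n, τ⟩ : TangledCurrent Λ A B) σ δ 1
  have h2 := hG (⟨n, τ⟩ : TangledCurrent Λ A B) σ
  refine (if_congr h1.symm h2.symm rfl).trans rfl

/-- For a function that ignores the numbering of the edges, only the numbers of marked edges
matter. -/
theorem balancedSum_congr (G : TangledCurrent Λ A B → ℝ)
    (hG : ∀ (T : TangledCurrent Λ A B) (σ : (e : Sym2 (Option V)) → Equiv.Perm (Fin (T.1.1 e))),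
      G (relabel T σ) = G T)
    (n : {n : Sym2 (Option V) → ℕ // IsCurrent Λ n})
    (δ δ' : (e : Sym2 (Option V)) → Fin (n.1 e) → ZMod 2) (h : ∀ e, ones (δ e) = ones (δ' e)) :
    balancedSum G n δ' = balancedSum G n δ := by
  choose σ hσ using fun e => exists_perm_of_ones_eq (δ e) (δ' e) (h e)
  rw [← balancedSum_relabel G hG n δ σ]
  exact congrArg _ (funext hσ)

noncomputable instance instFintypeEdgeMarks (n : Sym2 (Option V) → ℕ) : Fintype (EdgeMarks Λ' n) :=
  Fintype.ofFinite _

open Classical in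
theorem card_marks (n m : Sym2 (Option V) → ℕ) :
    Fintype.card {ε : EdgeMarks Λ' n // ∀ e, ones (ε e) = m e.1}
      = ∏ e ∈ pairsIn Λ', (n e).choose (m e) := by
  rw [← Finset.prod_coe_sort]
  simp only [← card_ones_eq]
  rw [← Fintype.card_pi]
  exact Fintype.card_congr (Equiv.subtypePiEquivPi
    (p := fun (e : pairsIn Λ') (f : Fin (n e.1) → ZMod 2) => ones f = m e.1))

/-- The product of the edge weights of two currents is that of their sum, times binomial
coefficients. -/
theorem edgeWeight_mul (c : Sym2 (Option V) → ℝ) (hΛ : Λ' ⊆ Λ) (p : CurrentPair Λ Λ' A B) :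
    edgeWeight c Λ p.1.1 * edgeWeight c Λ' p.1.2
      = edgeWeight c Λ (totalCurrent hΛ p).1
        * ((∏ e ∈ pairsIn Λ', ((totalCurrent hΛ p).1 e).choose (p.1.2 e) : ℕ) : ℝ) := by
  have h1 : edgeWeight c Λ' p.1.2 = edgeWeight c Λ p.1.2 :=
    Finset.prod_subset (pairsIn_mono hΛ) fun e _ he => by simp [p.2.2.1.eq_zero he]
  have h2 : ∏ e ∈ pairsIn Λ', ((totalCurrent hΛ p).1 e).choose (p.1.2 e)
      = ∏ e ∈ pairsIn Λ, ((totalCurrent hΛ p).1 e).choose (p.1.2 e) :=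
    Finset.prod_subset (pairsIn_mono hΛ) fun e _ he => by simp [p.2.2.1.eq_zero he]
  rw [h1, h2, Nat.cast_prod, edgeWeight, edgeWeight, edgeWeight, ← Finset.prod_mul_distrib,
    ← Finset.prod_mul_distrib]
  refine Finset.prod_congr rfl fun e _ => ?_
  have h3 : (totalCurrent hΛ p).1 e = p.1.1 e + p.1.2 e := rfl
  have h4 := Nat.add_choose_mul_factorial_mul_factorial (p.1.1 e) (p.1.2 e)
  have h5 : (((p.1.1 e + p.1.2 e).choose (p.1.2 e) : ℕ) : ℝ) * (p.1.1 e).factorial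
      * (p.1.2 e).factorial = (p.1.1 e + p.1.2 e).factorial := by
    exact_mod_cast h4
  rw [h3, ← h5, pow_add]
  have : (((p.1.1 e + p.1.2 e).choose (p.1.2 e) : ℕ) : ℝ) ≠ 0 :=
    Nat.cast_ne_zero.2 (Nat.choose_pos (Nat.le_add_left _ _)).ne'
  field_simp

open Classical in
/-- The binomial coefficients produced by the weights of a pair of currents count the choices of
the edges of the second current, all of which contribute equally. -/
theorem edgeWeight_mul_sum_tangling (c : Sym2 (Option V) → ℝ) (hΛ : Λ' ⊆ Λ)
    (p : CurrentPair Λ Λ' A B) (G : TangledCurrent Λ A B → ℝ)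
    (hG : ∀ (T : TangledCurrent Λ A B) (σ : (e : Sym2 (Option V)) → Equiv.Perm (Fin (T.1.1 e))),
      G (relabel T σ) = G T) :
    edgeWeight c Λ p.1.1 * edgeWeight c Λ' p.1.2 * ∑ t : Tangling p, G (assemble hΛ p t)
      = ∑ ε : EdgeMarks Λ' (totalCurrent hΛ p).1,
        if ∀ e, ones (ε e) = p.1.2 e.1 then edgeWeight c Λ (totalCurrent hΛ p).1
          * balancedSum G (totalCurrent hΛ p) (extendMark ε) else 0 := by
  have h1 : ∀ ε : EdgeMarks Λ' (totalCurrent hΛ p).1, (∀ e, ones (ε e) = p.1.2 e.1) →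
      balancedSum G (totalCurrent hΛ p) (extendMark ε)
        = balancedSum G (totalCurrent hΛ p) (secondMark hΛ p) := by
    intro ε hε
    refine balancedSum_congr G hG _ _ _ fun e => ?_
    rw [ones_secondMark, ones_extendMark]
    split_ifs with he
    · exact (hε ⟨e, he⟩).symm
    · exact p.2.2.1.eq_zero he
  rw [← Finset.sum_filter]
  refine Eq.trans ?_ (Finset.sum_congr rfl fun ε hε => congrArg (edgeWeight c Λ _ * ·)
    (h1 ε (Finset.mem_filter.1 hε).2)).symm
  rw [Finset.sum_const, ← Fintype.card_subtype, card_marks, edgeWeight_mul c hΛ p,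
    sum_tangling_eq, nsmul_eq_mul]
  ring

end Pairs

section Fibres

variable {Λ Λ' : Finset (Option V)} {A B : Option V → ℕ}

/-! ### The sum over pairs of currents with a given sum -/

theorem sum_eq_ones {m : ℕ} (f : Fin m → ZMod 2) : ∑ k, f k = (ones f : ZMod 2) := by
  have h01 : ∀ x : ZMod 2, x = if x = 1 then 1 else 0 := by decide
  rw [Finset.sum_congr rfl fun k _ => h01 (f k), ones, Fintype.card_subtype, Finset.sum_boole]

/-- The number of marked edges between two vertices. -/
noncomputable def markedCurrent {n : Sym2 (Option V) → ℕ} (ε : EdgeMarks Λ' n) :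
    Sym2 (Option V) → ℕ := fun e => ones (extendMark ε e)

theorem isCurrent_markedCurrent {n : Sym2 (Option V) → ℕ} (ε : EdgeMarks Λ' n) :
    IsCurrent Λ' (markedCurrent ε) := by
  intro e he
  refine mem_pairsIn.1 ?_
  by_contra h
  exact he ((ones_extendMark ε e).trans (dif_neg h))

theorem markedCurrent_le {n : Sym2 (Option V) → ℕ} (ε : EdgeMarks Λ' n) (e : Sym2 (Option V)) :
    markedCurrent ε e ≤ n e :=
  (Fintype.card_subtype_le fun k => extendMark ε e k = 1).trans_eq (Fintype.card_fin _)

theorem IsCurrent.degree_eq (hΛ : Λ' ⊆ Λ) {n : Sym2 (Option V) → ℕ} (hn : IsCurrent Λ' n)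
    (x : V) : degree Λ n x = degree Λ' n x := by
  refine (Finset.sum_subset hΛ fun y _ hy => ?_).symm
  by_contra h
  exact hy ((hn _ h).2 _ (Sym2.mem_mk_right _ _))

theorem degree_add (n m : Sym2 (Option V) → ℕ) (x : V) :
    degree Λ (n + m) x = degree Λ n x + degree Λ m x :=
  Finset.sum_add_distrib

theorem card_halfEdge (n : Sym2 (Option V) → ℕ) (z : V) :
    Fintype.card (HalfEdge Λ n z) = degree Λ n z := by
  simp only [HalfEdge, Fintype.card_sigma, Fintype.card_fin]
  exact Finset.sum_coe_sort Λ fun y => n s(some z, y)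

theorem card_sBlock (n : Sym2 (Option V) → ℕ) (z : V) :
    Nat.card (SBlock Λ n A z) = degree Λ n z + A (some z) := by
  rw [Nat.card_eq_fintype_card, Fintype.card_sum, card_halfEdge, Fintype.card_ulift,
    Fintype.card_fin]

/-- Summing the balance condition over the classes of a block gives the parity of the source. -/
theorem even_degree_of_balanced (T : TangledCurrent Λ A B) {ε : EdgeMarks Λ' T.1.1}
    (h : Balanced T (extendMark ε) 1) (z : Site Λ) :
    Even (degree Λ (markedCurrent ε) z + B (some z.1)) := by
  classical
  have h1 := sum_saturated_eq_zero (T.2 z).1 (blockMark (extendMark ε) 1 z.1)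
    (fun _ => True) (fun _ _ _ => Iff.rfl) fun w _ => h z w
  rw [Finset.filter_true, Fintype.sum_sum_type, Fintype.sum_sum_type, Fintype.sum_sigma] at h1
  simp only [blockMark, Sum.elim_inl, Sum.elim_inr, sum_eq_ones, Finset.sum_const_zero, zero_add,
    Finset.sum_const, Finset.card_univ, Fintype.card_ulift, Fintype.card_fin, nsmul_one] at h1
  rw [← ZMod.natCast_eq_zero_iff_even, ← h1, Nat.cast_add, degree, Nat.cast_sum,
    ← Finset.sum_coe_sort Λ]
  rfl

theorem even_degree_add_add (T : TangledCurrent Λ A B) (z : Site Λ) :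
    Even (degree Λ T.1.1 z + (A (some z.1) + B (some z.1))) := by
  have h := even_ncard_of_saturated (T.2 z).1 (fun _ => True) (fun w _ => (T.2 z).2 w)
    fun _ _ _ => Iff.rfl
  have h' : Nat.card (Block Λ T.1.1 A B z.1)
      = degree Λ T.1.1 z + (A (some z.1) + B (some z.1)) := by
    rw [Nat.card_eq_fintype_card, Fintype.card_sum, Fintype.card_sum, card_halfEdge,
      Fintype.card_ulift, Fintype.card_ulift, Fintype.card_fin, Fintype.card_fin]
  rwa [Set.ofPred_true, Set.ncard_univ, h'] at h

/-- Balanced marks split a tangled current into a pair of currents with the right sources. -/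
theorem exists_currentPair (hΛ : Λ' ⊆ Λ) (T : TangledCurrent Λ A B) {ε : EdgeMarks Λ' T.1.1}
    (h : Balanced T (extendMark ε) 1) :
    ∃ p : CurrentPair Λ Λ' A B, totalCurrent hΛ p = T.1 ∧ p.1.2 = markedCurrent ε := by
  have hadd : (T.1.1 - markedCurrent ε) + markedCurrent ε = T.1.1 :=
    funext fun e => Nat.sub_add_cancel (markedCurrent_le ε e)
  refine ⟨⟨(T.1.1 - markedCurrent ε, markedCurrent ε), ?_, isCurrent_markedCurrent ε,
    sources_eq_of_even fun x => ?_, sources_eq_of_even fun x => ?_⟩, Subtype.ext hadd, rfl⟩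
  · intro e he
    exact T.1.2 e fun h0 => he (by simp [h0])
  · change Even (degree Λ (T.1.1 - markedCurrent ε) x.1 + A (some x.1))
    have h1 := even_degree_add_add T x
    have h2 := even_degree_of_balanced T h x
    have h3 := degree_add (Λ := Λ) (T.1.1 - markedCurrent ε) (markedCurrent ε) x
    rw [hadd] at h3
    rw [Nat.even_iff] at h1 h2 ⊢
    omega
  · rw [← (isCurrent_markedCurrent ε).degree_eq hΛ]
    exact even_degree_of_balanced T h
      ⟨x.1, Finset.mem_eraseNone.2 (hΛ (Finset.mem_eraseNone.1 x.2))⟩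

theorem markedCurrent_eq_iff (p : CurrentPair Λ Λ' A B) {n : Sym2 (Option V) → ℕ}
    (ε : EdgeMarks Λ' n) : p.1.2 = markedCurrent ε ↔ ∀ e, ones (ε e) = p.1.2 e.1 := by
  constructor
  · intro h e
    rw [h, markedCurrent, ones_extendMark, dif_pos e.2]
  · intro h
    funext e
    rw [markedCurrent, ones_extendMark]
    split_ifs with he
    · exact (h ⟨e, he⟩).symm
    · exact p.2.2.1.eq_zero he

open Classical in
/-- The factor by which a tangled current is counted in the sum over pairs of currents is the
number of its balanced markings. -/
theorem sum_balancedSum (G : TangledCurrent Λ A B → ℝ)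
    (n : {n : Sym2 (Option V) → ℕ // IsCurrent Λ n}) :
    ∑ ε : EdgeMarks Λ' n.1, balancedSum G n (extendMark ε)
      = ∑ τ : (z : Site Λ) → EvenPart (Block Λ n.1 A B z),
        G ⟨n, τ⟩ * markCount Λ' (⟨n, τ⟩ : TangledCurrent Λ A B) 1 := by
  classical
  unfold balancedSum
  rw [Finset.sum_comm]
  refine Finset.sum_congr rfl fun τ _ => ?_
  rw [← Finset.sum_filter, Finset.sum_const, ← Fintype.card_subtype, nsmul_eq_mul, mul_comm]
  exact congrArg (fun k : ℕ => G ⟨n, τ⟩ * (k : ℝ)) Nat.card_eq_fintype_card.symm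

open Classical in
/-- The sum over the pairs of currents with sum `n`. A marking contributes for at most one pair, and
for exactly one if its balanced sum is not empty. -/
theorem hasSum_fibre (c : Sym2 (Option V) → ℝ) (hΛ : Λ' ⊆ Λ) (G : TangledCurrent Λ A B → ℝ)
    (hG : LabelInvariant G) (n : {n : Sym2 (Option V) → ℕ // IsCurrent Λ n}) :
    HasSum (fun q : {p : CurrentPair Λ Λ' A B // totalCurrent hΛ p = n} =>
        edgeWeight c Λ q.1.1.1 * edgeWeight c Λ' q.1.1.2
          * ∑ t : Tangling q.1, G (assemble hΛ q.1 t))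
      (edgeWeight c Λ n.1 * ∑ τ : (z : Site Λ) → EvenPart (Block Λ n.1 A B z),
        G ⟨n, τ⟩ * markCount Λ' (⟨n, τ⟩ : TangledCurrent Λ A B) 1) := by
  classical
  rw [← sum_balancedSum, Finset.mul_sum]
  have h1 : ∀ q : {p : CurrentPair Λ Λ' A B // totalCurrent hΛ p = n},
      edgeWeight c Λ q.1.1.1 * edgeWeight c Λ' q.1.1.2
          * ∑ t : Tangling q.1, G (assemble hΛ q.1 t)
        = ∑ ε : EdgeMarks Λ' n.1, if q.1.1.2 = markedCurrent ε
          then edgeWeight c Λ n.1 * balancedSum G n (extendMark ε) else 0 := by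
    rintro ⟨p, rfl⟩
    refine (edgeWeight_mul_sum_tangling c hΛ p G hG).trans (Finset.sum_congr rfl fun ε _ => ?_)
    exact if_congr (markedCurrent_eq_iff p ε).symm rfl rfl
  simp only [h1]
  refine hasSum_sum fun ε _ => ?_
  by_cases h : ∃ τ, Balanced (⟨n, τ⟩ : TangledCurrent Λ A B) (extendMark ε) 1
  · obtain ⟨τ, hτ⟩ := h
    obtain ⟨p, hp1, hp2⟩ := exists_currentPair hΛ ⟨n, τ⟩ hτ
    have h2 := hasSum_single (f := fun q : {p : CurrentPair Λ Λ' A B // totalCurrent hΛ p = n} =>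
      if q.1.1.2 = markedCurrent ε then edgeWeight c Λ n.1 * balancedSum G n (extendMark ε) else 0)
      ⟨p, hp1⟩ fun q hq => if_neg fun hq2 => hq ?_
    · simp only [hp2, if_true] at h2
      exact h2
    · have hsnd : q.1.1.2 = p.1.2 := hq2.trans hp2.symm
      refine Subtype.ext (Subtype.ext (Prod.ext ?_ hsnd))
      have h3 : q.1.1.1 + q.1.1.2 = p.1.1 + p.1.2 :=
        congrArg (fun m : {n : Sym2 (Option V) → ℕ // IsCurrent Λ n} => m.1) (q.2.trans hp1.symm)
      rw [hsnd] at h3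
      exact add_right_cancel h3
  · have h0 : balancedSum G n (extendMark ε) = 0 :=
      Finset.sum_eq_zero fun τ _ => if_neg fun hτ => h ⟨τ, hτ⟩
    simp only [h0, mul_zero, ite_self]
    exact hasSum_zero

open Classical in
/-- The sum over pairs of currents and their tanglings, as a sum over tangled currents. -/
theorem hasSum_tangledCurrent (c : Sym2 (Option V) → ℝ) (hΛ : Λ' ⊆ Λ)
    (G : TangledCurrent Λ A B → ℝ) (hG : LabelInvariant G) {s : ℝ}
    (hs : HasSum (fun p : CurrentPair Λ Λ' A B => edgeWeight c Λ p.1.1 * edgeWeight c Λ' p.1.2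
      * ∑ t : Tangling p, G (assemble hΛ p t)) s) :
    HasSum (fun n : {n : Sym2 (Option V) → ℕ // IsCurrent Λ n} => edgeWeight c Λ n.1
      * ∑ τ : (z : Site Λ) → EvenPart (Block Λ n.1 A B z),
        G ⟨n, τ⟩ * markCount Λ' (⟨n, τ⟩ : TangledCurrent Λ A B) 1) s :=
  ((Equiv.sigmaFiberEquiv (totalCurrent (A := A) (B := B) hΛ)).hasSum_iff.2 hs).sigma
    fun n => hasSum_fibre c hΛ G hG n

end Fibres

/-! ### The tangling measures -/

/-- Nonnegative weights of even partitions, invariant under bijections, whose sum over the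
admissible partitions of two sets is the product of the two single-site moments. -/
structure IsTanglingWeight (g a : ℝ) (W : (X : Type u) → EvenPart X → ℝ) : Prop where
  nonneg : ∀ X r, 0 ≤ W X r
  congr : ∀ (X Y : Type u) (e : X ≃ Y) (r : EvenPart X), W Y (r.congr e) = W X r
  sum_eq : ∀ (X Y : Type u) [Finite X] [Finite Y],
    spinMoment g a (Nat.card X) * spinMoment g a (Nat.card Y)
      = ∑ r : AdmPart X Y, W (X ⊕ Y) r.toEvenPart

instance instMeasurableSingletonClassAdmPart (X Y : Type u) :
    MeasurableSingletonClass (AdmPart X Y) := ⟨fun _ => trivial⟩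

open Classical in
/-- The measure on admissible partitions proportional to the weight `W`. It is zero if one of the
sets is infinite. -/
noncomputable def tanglingLaw (g a : ℝ) (W : (X : Type u) → EvenPart X → ℝ) (X Y : Type u) :
    Measure (AdmPart X Y) :=
  if h : Finite X ∧ Finite Y then
    haveI := h.1
    haveI := h.2
    Measure.sum fun r : AdmPart X Y => ENNReal.ofReal (W (X ⊕ Y) r.toEvenPart
      / (spinMoment g a (Nat.card X) * spinMoment g a (Nat.card Y))) • Measure.dirac r
  else 0

section Law

variable {g a : ℝ} {W : (X : Type u) → EvenPart X → ℝ}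

theorem tanglingLaw_singleton (X Y : Type u) [hX : Finite X] [hY : Finite Y] (r : AdmPart X Y) :
    tanglingLaw g a W X Y {r} = ENNReal.ofReal (W (X ⊕ Y) r.toEvenPart
      / (spinMoment g a (Nat.card X) * spinMoment g a (Nat.card Y))) := by
  classical
  rw [tanglingLaw, dif_pos ⟨hX, hY⟩, Measure.sum_apply _ (measurableSet_singleton r), tsum_fintype,
    Finset.sum_eq_single r]
  · simp
  · intro s _ hs
    simp [hs]
  · simp

theorem AdmPart.congr_symm_congr {X X' Y Y' : Type u} (e : X ≃ X') (f : Y ≃ Y')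
    (r : AdmPart X Y) : (r.congr e f).congr e.symm f.symm = r := by
  refine Subtype.ext (Setoid.ext fun x y => ?_)
  change r.1 ((Equiv.sumCongr e f).symm ((Equiv.sumCongr e.symm f.symm).symm x))
    ((Equiv.sumCongr e f).symm ((Equiv.sumCongr e.symm f.symm).symm y)) ↔ r.1 x y
  have h : ∀ x, (Equiv.sumCongr e f).symm ((Equiv.sumCongr e.symm f.symm).symm x) = x := by
    rintro (x | x) <;> simp
  rw [h, h]

theorem AdmPart.congr_toEvenPart {X X' Y Y' : Type u} [Finite X] [Finite Y] [Finite X']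
    [Finite Y'] (e : X ≃ X') (f : Y ≃ Y') (r : AdmPart X Y) :
    (r.congr e f).toEvenPart = r.toEvenPart.congr (Equiv.sumCongr e f) :=
  Subtype.ext (Setoid.ext fun _ _ => Iff.rfl)

theorem map_tanglingLaw (hW : IsTanglingWeight g a W) (X X' Y Y' : Type u) [Finite X] [Finite Y]
    (e : X ≃ X') (f : Y ≃ Y') :
    (tanglingLaw g a W X Y).map (AdmPart.congr e f) = tanglingLaw g a W X' Y' := by
  have := Finite.of_equiv _ e
  have := Finite.of_equiv _ f
  refine Measure.ext_of_singleton fun r => ?_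
  obtain ⟨s, rfl⟩ : ∃ s : AdmPart X Y, s.congr e f = r :=
    ⟨r.congr e.symm f.symm, AdmPart.congr_symm_congr e.symm f.symm r⟩
  have h1 : AdmPart.congr e f ⁻¹' {s.congr e f} = {s} := by
    ext t
    refine ⟨fun h => ?_, fun h => congrArg _ h⟩
    have := congrArg (AdmPart.congr e.symm f.symm) (show t.congr e f = s.congr e f from h)
    rwa [AdmPart.congr_symm_congr, AdmPart.congr_symm_congr] at this
  rw [Measure.map_apply measurable_from_top (measurableSet_singleton _), h1,
    tanglingLaw_singleton, tanglingLaw_singleton, AdmPart.congr_toEvenPart, hW.congr,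
    Nat.card_congr e, Nat.card_congr f]

theorem isProbabilityMeasure_tanglingLaw (hg : 0 < g) (hW : IsTanglingWeight g a W)
    (X Y : Type u) [Finite X] [Finite Y] (hX : Even (Nat.card X)) (hY : Even (Nat.card Y)) :
    IsProbabilityMeasure (tanglingLaw g a W X Y) := by
  have h0 := (mul_pos (spinMoment_pos hg a hX) (spinMoment_pos hg a hY))
  constructor
  rw [← Finset.coe_univ, ← sum_measure_singleton]
  simp only [tanglingLaw_singleton]
  rw [← ENNReal.ofReal_sum_of_nonneg fun r _ => div_nonneg (hW.nonneg _ _) h0.le,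
    ← Finset.sum_div, ← hW.sum_eq, div_self h0.ne', ENNReal.ofReal_one]

end Law

/-! ### The expansion of the expectation for a pair of currents -/

section Expansion

variable {g a β : ℝ} {W : (X : Type u) → EvenPart X → ℝ} {J : Sym2 V → ℝ} {h : V → ℝ}
  {Λ Λ' : Finset (Option V)} {A B : Option V → ℕ}

/-- The product over the sites of the weights of the partitions of their blocks. -/
noncomputable def tangleWeight (W : (X : Type u) → EvenPart X → ℝ) (T : TangledCurrent Λ A B) :
    ℝ :=
  ∏ z : Site Λ, W _ (T.2 z)

theorem tangleWeight_relabel (hW : IsTanglingWeight g a W) (T : TangledCurrent Λ A B)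
    (σ : (e : Sym2 (Option V)) → Equiv.Perm (Fin (T.1.1 e))) :
    tangleWeight W (relabel T σ) = tangleWeight W T :=
  Finset.prod_congr rfl fun _ _ => hW.congr _ _ _ _

theorem tangleWeight_regroup (hW : IsTanglingWeight g a W)
    (T : TangledCurrent Λ (addMoment A B) 0) : tangleWeight W (regroup T) = tangleWeight W T :=
  Finset.prod_congr rfl fun _ _ => hW.congr _ _ _ _

theorem tangleWeight_assemble (hW : IsTanglingWeight g a W) (hΛ : Λ' ⊆ Λ)
    (p : CurrentPair Λ Λ' A B) (t : Tangling p) :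
    tangleWeight W (assemble hΛ p t) = ∏ z : Site Λ, W _ (t z).toEvenPart :=
  Finset.prod_congr rfl fun _ _ => hW.congr _ _ _ _

theorem even_card_snd (hΛ : Λ' ⊆ Λ) (hB : ∀ x, x ∉ Λ' → B x = 0) (p : CurrentPair Λ Λ' A B)
    (z : Site Λ) : Even (Nat.card (SBlock Λ p.1.2 B z.1)) := by
  rw [card_sBlock, p.2.2.1.degree_eq hΛ]
  by_cases hz : some z.1 ∈ Λ'
  · exact even_degree_add p.2.2.2.2 ⟨z.1, Finset.mem_eraseNone.2 hz⟩
  · rw [hB _ hz, degree, Finset.sum_eq_zero fun y _ => p.2.2.1.eq_zero fun hy => hz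
      ((mem_pairsIn.1 hy).2 _ (Sym2.mem_mk_left _ _))]
    exact Even.zero

theorem isProbabilityMeasure_tanglingMeasure (hg : 0 < g) (hW : IsTanglingWeight g a W)
    (hΛ : Λ' ⊆ Λ) (hB : ∀ x, x ∉ Λ' → B x = 0) (p : CurrentPair Λ Λ' A B) :
    IsProbabilityMeasure (tanglingMeasure (tanglingLaw g a W) p) := by
  have : ∀ z : Site Λ, IsProbabilityMeasure
      (tanglingLaw g a W (SBlock Λ p.1.1 A z) (SBlock Λ p.1.2 B z)) := fun z =>
    isProbabilityMeasure_tanglingLaw hg hW _ _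
      (by rw [card_sBlock]; exact even_degree_add p.2.2.2.1 z) (even_card_snd hΛ hB p z)
  unfold tanglingMeasure
  infer_instance

theorem prod_spinMoment_extend (hg : 0 < g) (hΛ : Λ' ⊆ Λ) (hB : ∀ x, x ∉ Λ' → B x = 0)
    {n : Sym2 (Option V) → ℕ} (hn : IsCurrent Λ' n) :
    ∏ x : Site Λ', spinMoment g a (degree Λ' n x + B (some x.1))
      = ∏ x : Site Λ, spinMoment g a (degree Λ n x + B (some x.1)) := by
  classical
  rw [Finset.prod_coe_sort (Finset.eraseNone Λ')
      fun x => spinMoment g a (degree Λ' n x + B (some x)),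
    Finset.prod_coe_sort (Finset.eraseNone Λ)
      fun x => spinMoment g a (degree Λ n x + B (some x))]
  simp only [hn.degree_eq hΛ]
  refine Finset.prod_subset (fun x hx => Finset.mem_eraseNone.2 (hΛ (Finset.mem_eraseNone.1 hx)))
    fun x _ hx => ?_
  have hx' : some x ∉ Λ' := fun h => hx (Finset.mem_eraseNone.2 h)
  rw [hB _ hx', degree, Finset.sum_eq_zero fun y _ => hn.eq_zero fun hy => hx'
      ((mem_pairsIn.1 hy).2 _ (Sym2.mem_mk_left _ _))]
  exact spinMoment_zero hg a

open Classical in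
/-- The single-site moments in the weights of the two currents cancel against the normalization
of the tangling measures. -/
theorem pairWeight_mul_integral (hg : 0 < g) (hW : IsTanglingWeight g a W)
    (hΛ : Λ' ⊆ Λ) (hB : ∀ x, x ∉ Λ' → B x = 0) (p : CurrentPair Λ Λ' A B)
    (F : TangledCurrent Λ A B → ℝ) :
    pairWeight g a β J h p * ∫ t, F (assemble hΛ p t) ∂(tanglingMeasure (tanglingLaw g a W) p)
      = edgeWeight (coupling β J h) Λ p.1.1 * edgeWeight (coupling β J h) Λ' p.1.2
        * ∑ t : Tangling p, tangleWeight W (assemble hΛ p t) * F (assemble hΛ p t) := by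
  have hprob := isProbabilityMeasure_tanglingMeasure hg hW hΛ hB p
  have hev : ∀ z : Site Λ, Even (Nat.card (SBlock Λ p.1.1 A z.1)) := fun z => by
    rw [card_sBlock]; exact even_degree_add p.2.2.2.1 z
  have : ∀ z : Site Λ, IsProbabilityMeasure
      (tanglingLaw g a W (SBlock Λ p.1.1 A z) (SBlock Λ p.1.2 B z)) := fun z =>
    isProbabilityMeasure_tanglingLaw hg hW _ _ (hev z) (even_card_snd hΛ hB p z)
  have hm : ∀ t : Tangling p, (tanglingMeasure (tanglingLaw g a W) p).real {t}
      = tangleWeight W (assemble hΛ p t) / ((∏ x : Site Λ, spinMoment g a (degree Λ p.1.1 x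
        + A (some x.1))) * ∏ x : Site Λ, spinMoment g a (degree Λ p.1.2 x + B (some x.1))) := by
    intro t
    rw [measureReal_def, tanglingMeasure, Measure.pi_singleton, ENNReal.toReal_prod,
      tangleWeight_assemble hW, ← Finset.prod_mul_distrib, ← Finset.prod_div_distrib]
    refine Finset.prod_congr rfl fun z _ => ?_
    rw [tanglingLaw_singleton, ENNReal.toReal_ofReal, card_sBlock, card_sBlock]
    exact div_nonneg (hW.nonneg _ _) (mul_nonneg (spinMoment_nonneg hg a _)
      (spinMoment_nonneg hg a _))
  rw [integral_fintype (Integrable.of_finite)]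
  simp only [hm, smul_eq_mul]
  rw [pairWeight, weight_eq g a β J h A p.2.1, weight_eq g a β J h B p.2.2.1,
    prod_spinMoment_extend hg hΛ hB p.2.2.1, Finset.mul_sum, Finset.mul_sum]
  refine Finset.sum_congr rfl fun t _ => ?_
  have h1 : ∏ x : Site Λ, spinMoment g a (degree Λ p.1.1 x + A (some x.1)) ≠ 0 :=
    Finset.prod_ne_zero_iff.2 fun z _ => (spinMoment_pos hg a (even_degree_add p.2.2.2.1 z)).ne'
  have h2 : ∏ x : Site Λ, spinMoment g a (degree Λ p.1.2 x + B (some x.1)) ≠ 0 :=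
    Finset.prod_ne_zero_iff.2 fun z _ => by
      have := even_card_snd hΛ hB p z
      rw [card_sBlock] at this
      exact (spinMoment_pos hg a this).ne'
  field_simp

theorem norm_pairWeight_mul_integral_le (hg : 0 < g) (hW : IsTanglingWeight g a W) (hβ : 0 < β)
    (hJ : ∀ e, 0 ≤ J e) (hh : ∀ x, 0 ≤ h x) (hΛ : Λ' ⊆ Λ) (hB : ∀ x, x ∉ Λ' → B x = 0)
    (p : CurrentPair Λ Λ' A B) (F : TangledCurrent Λ A B → ℝ) {C : ℝ} (hF : ∀ T, |F T| ≤ C) :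
    ‖pairWeight g a β J h p
        * ∫ t, F (assemble hΛ p t) ∂(tanglingMeasure (tanglingLaw g a W) p)‖
      ≤ pairWeight g a β J h p * C := by
  have := isProbabilityMeasure_tanglingMeasure hg hW hΛ hB p
  rw [norm_mul, Real.norm_of_nonneg (pairWeight_nonneg hg a hβ hJ hh p)]
  refine mul_le_mul_of_nonneg_left ?_ (pairWeight_nonneg hg a hβ hJ hh p)
  refine (norm_integral_le_of_norm_le_const (C := C)
    (Filter.Eventually.of_forall fun t => hF _)).trans_eq ?_
  rw [probReal_univ, mul_one]

theorem summable_pairWeight_mul_integral (hg : 0 < g) (hW : IsTanglingWeight g a W) (hβ : 0 < β)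
    (hJ : ∀ e, 0 ≤ J e) (hh : ∀ x, 0 ≤ h x) (hΛ : Λ' ⊆ Λ) (hB : ∀ x, x ∉ Λ' → B x = 0)
    (F : TangledCurrent Λ A B → ℝ) {C : ℝ} (hF : ∀ T, |F T| ≤ C) :
    Summable fun p : CurrentPair Λ Λ' A B => pairWeight g a β J h p
        * ∫ t, F (assemble hΛ p t) ∂(tanglingMeasure (tanglingLaw g a W) p) :=
  Summable.of_norm_bounded
    ((hasSum_pairWeight hg a hβ hJ hh Λ Λ' A B).summable.mul_right C)
    fun p => norm_pairWeight_mul_integral_le hg hW hβ hJ hh hΛ hB p F hF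

open Classical in
theorem tsum_pairWeight_mul_integral (hg : 0 < g) (hW : IsTanglingWeight g a W) (hβ : 0 < β)
    (hJ : ∀ e, 0 ≤ J e) (hh : ∀ x, 0 ≤ h x) (hΛ : Λ' ⊆ Λ) (hB : ∀ x, x ∉ Λ' → B x = 0)
    (F : TangledCurrent Λ A B → ℝ) (hinv : LabelInvariant F) {C : ℝ} (hF : ∀ T, |F T| ≤ C) :
    ∑' p : CurrentPair Λ Λ' A B, pairWeight g a β J h p
        * ∫ t, F (assemble hΛ p t) ∂(tanglingMeasure (tanglingLaw g a W) p)
      = ∑' n : {n : Sym2 (Option V) → ℕ // IsCurrent Λ n}, edgeWeight (coupling β J h) Λ n.1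
        * ∑ τ : (z : Site Λ) → EvenPart (Block Λ n.1 A B z),
          tangleWeight W (⟨n, τ⟩ : TangledCurrent Λ A B) * F ⟨n, τ⟩
            * markCount Λ' (⟨n, τ⟩ : TangledCurrent Λ A B) 1 := by
  have h1 := (summable_pairWeight_mul_integral hg hW hβ hJ hh hΛ hB F hF).hasSum
  have h2 : ∀ p : CurrentPair Λ Λ' A B, _ := fun p =>
    pairWeight_mul_integral (β := β) (J := J) (h := h) hg hW hΛ hB p F
  refine (hasSum_tangledCurrent (coupling β J h) hΛ (fun T => tangleWeight W T * F T)
    (fun T σ => ?_) ?_).tsum_eq.symm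
  · exact congrArg₂ (· * ·) (tangleWeight_relabel hW T σ) (hinv T σ)
  · simpa only [h2] using h1

end Expansion

/-! ### Regrouping the additional points -/

section Regroup

variable {Λ Λ' : Finset (Option V)} {A B : Option V → ℕ}

/-- A tangled current for `(A + B, 0)` has no points `zb(k)`, so their mark is irrelevant, and the
additional points receive the mark zero on both sides. -/
theorem balanced_regroup (T : TangledCurrent Λ (addMoment A B) 0)
    (δ : (e : Sym2 (Option V)) → Fin (T.1.1 e) → ZMod 2) :
    Balanced (regroup T) δ 0 ↔ Balanced T δ 1 := by
  classical
  refine forall_congr' fun z => ?_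
  let e := blockRegroup Λ T.1.1 A B z.1
  refine (e.forall_congr (p := fun w => ∑ x with (T.2 z).1 x w, blockMark δ 1 z.1 x = 0)
    (q := fun w => ∑ x with ((T.2 z).congr e).1 x w, blockMark δ 0 z.1 x = 0)
    fun {w} => Eq.congr ?_ rfl).symm
  refine Eq.trans ?_ (sum_class_congr e (T.2 z) _ (e w)).symm
  rw [Equiv.symm_apply_apply]
  refine Finset.sum_congr rfl fun x _ => ?_
  rcases x with q | q | q
  · rfl
  · have h0 : ∀ y : Pts.{u} (A (some z.1)) ⊕ Pts.{u} (B (some z.1)),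
        blockMark (Λ := Λ) δ 0 z.1 (.inr y) = 0 := by rintro (y | y) <;> rfl
    exact (h0 _).symm
  · exact q.down.elim0

theorem markCount_regroup (T : TangledCurrent Λ (addMoment A B) 0) :
    markCount Λ' (regroup T) 0 = markCount Λ' T 1 :=
  Nat.card_congr (Equiv.subtypeEquivRight fun ε => balanced_regroup T (extendMark ε))

theorem regroup_relabel (T : TangledCurrent Λ (addMoment A B) 0)
    (σ : (e : Sym2 (Option V)) → Equiv.Perm (Fin (T.1.1 e))) :
    regroup (relabel T σ) = relabel (regroup T) σ := by
  refine congrArg (Sigma.mk T.1) (funext fun z => Subtype.ext (Setoid.ext fun x y => ?_))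
  rcases x with x | x <;> rcases y with y | y <;> exact Iff.rfl

theorem markCount_relabel (T : TangledCurrent Λ A B)
    (σ : (e : Sym2 (Option V)) → Equiv.Perm (Fin (T.1.1 e))) (b : ZMod 2) :
    markCount Λ' (relabel T σ) b = markCount Λ' T b := by
  refine (Nat.card_congr ((Equiv.piCongrRight fun e : pairsIn Λ' =>
    (σ e.1).arrowCongr (Equiv.refl (ZMod 2))).subtypeEquiv fun ε => ?_)).symm
  rw [← balanced_relabel T σ]
  refine iff_of_eq (congrArg (fun δ => Balanced (relabel T σ) δ b) ?_)
  rfl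

theorem relabel_mem_pairingEvent (hΛ : Λ' ⊆ Λ) (hB : IsMoment Λ' B) (T : TangledCurrent Λ A B)
    (σ : (e : Sym2 (Option V)) → Equiv.Perm (Fin (T.1.1 e))) :
    relabel T σ ∈ pairingEvent Λ Λ' A B ↔ T ∈ pairingEvent Λ Λ' A B := by
  rw [mem_pairingEvent_iff _ hΛ hB, mem_pairingEvent_iff _ hΛ hB, markCount_relabel]

theorem labelInvariant_indicator_regroup (hΛ : Λ' ⊆ Λ) (hB : IsMoment Λ' B)
    {F : TangledCurrent Λ A B → ℝ} (hF : LabelInvariant F) :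
    LabelInvariant fun T : TangledCurrent Λ (addMoment A B) 0 =>
      (pairingEvent Λ Λ' A B).indicator F (regroup T) := by
  classical
  intro T σ
  dsimp only
  rw [regroup_relabel]
  have h := relabel_mem_pairingEvent hΛ hB (regroup T) σ
  by_cases hT : regroup T ∈ pairingEvent Λ Λ' A B
  · rw [Set.indicator_of_mem hT, Set.indicator_of_mem (h.2 hT)]
    exact hF _ _
  · rw [Set.indicator_of_notMem hT, Set.indicator_of_notMem fun h' => hT (h.1 h')]

theorem abs_indicator_le {F : TangledCurrent Λ A B → ℝ} {C : ℝ} (hF : ∀ T, |F T| ≤ C)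
    (s : Set (TangledCurrent Λ A B)) (T : TangledCurrent Λ A B) : |s.indicator F T| ≤ C := by
  classical
  rw [Set.indicator_apply]
  split_ifs
  · exact hF T
  · rw [abs_zero]
    exact (abs_nonneg _).trans (hF T)

open Classical in
/-- The switching identity for a given sum of the two currents. -/
theorem sum_tangleWeight_regroup {g a : ℝ} {W : (X : Type u) → EvenPart X → ℝ}
    (hW : IsTanglingWeight g a W) (hΛ : Λ' ⊆ Λ) (hB : IsMoment Λ' B)
    (F : TangledCurrent Λ A B → ℝ) (n : {n : Sym2 (Option V) → ℕ // IsCurrent Λ n}) :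
    ∑ τ : (z : Site Λ) → EvenPart (Block Λ n.1 (addMoment A B) 0 z),
        tangleWeight W (⟨n, τ⟩ : TangledCurrent Λ (addMoment A B) 0)
          * (pairingEvent Λ Λ' A B).indicator F (regroup ⟨n, τ⟩)
          * markCount Λ' (⟨n, τ⟩ : TangledCurrent Λ (addMoment A B) 0) 1
      = ∑ τ : (z : Site Λ) → EvenPart (Block Λ n.1 A B z),
          tangleWeight W (⟨n, τ⟩ : TangledCurrent Λ A B) * F ⟨n, τ⟩
            * markCount Λ' (⟨n, τ⟩ : TangledCurrent Λ A B) 1 := by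
  refine Fintype.sum_equiv (Equiv.piCongrRight fun z : Site Λ =>
    EvenPart.congrEquiv (blockRegroup Λ n.1 A B z.1)) _ _ fun τ => ?_
  have key : ∀ T : TangledCurrent Λ (addMoment A B) 0,
      tangleWeight W T * (pairingEvent Λ Λ' A B).indicator F (regroup T) * markCount Λ' T 1
        = tangleWeight W (regroup T) * F (regroup T) * markCount Λ' (regroup T) 1 := by
    intro T
    rw [markCount_one _ hΛ hB, tangleWeight_regroup hW, markCount_regroup, Set.indicator_apply]
    split_ifs <;> simp
  exact key ⟨n, τ⟩

end Regroup

section Switching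

variable {g a β : ℝ} {W : (X : Type u) → EvenPart X → ℝ} {J : Sym2 V → ℝ} {h : V → ℝ}
  {Λ Λ' : Finset (Option V)} {A B : Option V → ℕ}

/-- Both sides of the switching identity are sums over tangled currents, and agree for each value
of the sum of the two currents. -/
theorem tsum_pairWeight_switching (hg : 0 < g) (hW : IsTanglingWeight g a W) (hβ : 0 < β)
    (hJ : ∀ e, 0 ≤ J e) (hh : ∀ x, 0 ≤ h x) (hΛ : Λ' ⊆ Λ) (hB : IsMoment Λ' B)
    (F : TangledCurrent Λ A B → ℝ) (hinv : LabelInvariant F) {C : ℝ} (hF : ∀ T, |F T| ≤ C) :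
    ∑' p : CurrentPair Λ Λ' A B, pairWeight g a β J h p
        * ∫ t, F (assemble hΛ p t) ∂(tanglingMeasure (tanglingLaw g a W) p)
      = ∑' p : CurrentPair Λ Λ' (addMoment A B) 0, pairWeight g a β J h p
        * ∫ t, (pairingEvent Λ Λ' A B).indicator F (regroup (assemble hΛ p t))
          ∂(tanglingMeasure (tanglingLaw g a W) p) := by
  rw [tsum_pairWeight_mul_integral hg hW hβ hJ hh hΛ hB.1 F hinv hF,
    tsum_pairWeight_mul_integral (B := 0) hg hW hβ hJ hh hΛ (fun _ _ => rfl)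
      (fun T => (pairingEvent Λ Λ' A B).indicator F (regroup T))
      (labelInvariant_indicator_regroup hΛ hB hinv) (fun T => abs_indicator_le hF _ _)]
  exact tsum_congr fun n => congrArg _ (sum_tangleWeight_regroup hW hΛ hB F n).symm

/-! ### The laws of the random tangled currents -/

theorem tsum_pairWeight (hg : 0 < g) (hβ : 0 < β) (hJ : ∀ e, 0 ≤ J e) (hh : ∀ x, 0 ≤ h x) :
    ∑' p : CurrentPair Λ Λ' A B, pairWeight g a β J h p
      = partFun g a β J h Λ A * partFun g a β J h Λ' B :=
  (hasSum_pairWeight hg a hβ hJ hh Λ Λ' A B).tsum_eq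

theorem isProbabilityMeasure_map_assemble (hg : 0 < g) (hW : IsTanglingWeight g a W)
    (hΛ : Λ' ⊆ Λ) (hB : ∀ x, x ∉ Λ' → B x = 0) (p : CurrentPair Λ Λ' A B) :
    IsProbabilityMeasure ((tanglingMeasure (tanglingLaw g a W) p).map (assemble hΛ p)) :=
  have := isProbabilityMeasure_tanglingMeasure hg hW hΛ hB p
  Measure.isProbabilityMeasure_map (measurable_of_countable _).aemeasurable

theorem isProbabilityMeasure_tangledLaw (hg : 0 < g) (hW : IsTanglingWeight g a W) (hβ : 0 < β)
    (hJ : ∀ e, 0 ≤ J e) (hh : ∀ x, 0 ≤ h x) (hΛ : Λ' ⊆ Λ) (hB : ∀ x, x ∉ Λ' → B x = 0)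
    (hZ : partFun g a β J h Λ A * partFun g a β J h Λ' B ≠ 0) :
    IsProbabilityMeasure (tangledLaw (tanglingLaw g a W) g a β J h hΛ A B) := by
  constructor
  have h1 : ∀ p : CurrentPair Λ Λ' A B,
      (tanglingMeasure (tanglingLaw g a W) p).map (assemble hΛ p) Set.univ = 1 := fun p =>
    (isProbabilityMeasure_map_assemble hg hW hΛ hB p).measure_univ
  have h2 := hasSum_pairWeight hg a hβ hJ hh Λ Λ' A B
  rw [tangledLaw, Measure.sum_apply _ MeasurableSet.univ]
  simp only [Measure.smul_apply, h1, smul_eq_mul, mul_one]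
  rw [← ENNReal.ofReal_tsum_of_nonneg _ (h2.summable.div_const _), tsum_div_const, h2.tsum_eq,
    div_self hZ, ENNReal.ofReal_one]
  exact fun p => div_nonneg (pairWeight_nonneg hg a hβ hJ hh p)
    (tsum_nonneg fun p => pairWeight_nonneg hg a hβ hJ hh p)

theorem integral_tangledLaw (hg : 0 < g) (hW : IsTanglingWeight g a W) (hβ : 0 < β)
    (hJ : ∀ e, 0 ≤ J e) (hh : ∀ x, 0 ≤ h x) (hΛ : Λ' ⊆ Λ) (hB : ∀ x, x ∉ Λ' → B x = 0)
    (hZ : partFun g a β J h Λ A * partFun g a β J h Λ' B ≠ 0)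
    (F : TangledCurrent Λ A B → ℝ) {C : ℝ} (hF : ∀ T, |F T| ≤ C) :
    ∫ T, F T ∂(tangledLaw (tanglingLaw g a W) g a β J h hΛ A B)
      = (∑' p : CurrentPair Λ Λ' A B, pairWeight g a β J h p
        * ∫ t, F (assemble hΛ p t) ∂(tanglingMeasure (tanglingLaw g a W) p))
        / (partFun g a β J h Λ A * partFun g a β J h Λ' B) := by
  have := isProbabilityMeasure_tangledLaw hg hW hβ hJ hh hΛ hB hZ
  have hint : Integrable F (tangledLaw (tanglingLaw g a W) g a β J h hΛ A B) :=
    Integrable.of_bound (measurable_from_top : Measurable F).aestronglyMeasurable C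
      (Filter.Eventually.of_forall hF)
  rw [tangledLaw] at hint ⊢
  rw [integral_sum_measure hint, ← tsum_div_const]
  refine tsum_congr fun p => ?_
  rw [integral_smul_measure, integral_map (measurable_of_countable _).aemeasurable
    (measurable_from_top : Measurable F).aestronglyMeasurable, ENNReal.toReal_ofReal,
    tsum_pairWeight hg hβ hJ hh, smul_eq_mul]
  · ring
  · exact div_nonneg (pairWeight_nonneg hg a hβ hJ hh p)
      (tsum_nonneg fun p => pairWeight_nonneg hg a hβ hJ hh p)

/-- The ratio of correlations is the ratio of the total weights of the pairs of currents. If the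
denominator vanishes, both sides are zero by convention. -/
theorem corr_ratio (hg : 0 < g) (hβ : 0 < β) (hJ : ∀ e, 0 ≤ J e) (hh : ∀ x, 0 ≤ h x)
    (A B D : Option V → ℕ) :
    corr g a β J h Λ A * corr g a β J h Λ' B / corr g a β J h Λ D
      = partFun g a β J h Λ A * partFun g a β J h Λ' B
        / (partFun g a β J h Λ D * partFun g a β J h Λ' 0) := by
  have h1 := (partFun_zero_pos hg a hβ hJ hh Λ).ne'
  rw [corr_eq, corr_eq, corr_eq]
  by_cases hD : partFun g a β J h Λ D = 0
  · simp [hD]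
  · field_simp

theorem partFun_ne_zero {D : Option V → ℕ} (hD : corr g a β J h Λ D ≠ 0) :
    partFun g a β J h Λ D ≠ 0 := fun h0 => hD (by rw [corr_eq, h0, zero_div])

/-- The switching identity divided by the partition functions. If the total weight for `(A, B)`
vanishes, so do all pair weights, and both sides are zero. -/
theorem corr_mul_integral_tangledLaw (hg : 0 < g) (hW : IsTanglingWeight g a W) (hβ : 0 < β)
    (hJ : ∀ e, 0 ≤ J e) (hh : ∀ x, 0 ≤ h x) (hΛ : Λ' ⊆ Λ) (hB : IsMoment Λ' B)
    (hAB : corr g a β J h Λ (addMoment A B) ≠ 0)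
    (F : TangledCurrent Λ A B → ℝ) (hinv : LabelInvariant F) {C : ℝ} (hF : ∀ T, |F T| ≤ C) :
    corr g a β J h Λ A * corr g a β J h Λ' B / corr g a β J h Λ (addMoment A B)
        * ∫ T, F T ∂(tangledLaw (tanglingLaw g a W) g a β J h hΛ A B)
      = ∫ T, (pairingEvent Λ Λ' A B).indicator F (regroup T)
          ∂(tangledLaw (tanglingLaw g a W) g a β J h hΛ (addMoment A B) 0) := by
  have hZ : partFun g a β J h Λ (addMoment A B) * partFun g a β J h Λ' 0 ≠ 0 :=
    mul_ne_zero (partFun_ne_zero hAB) (partFun_zero_pos hg a hβ hJ hh Λ').ne'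
  rw [corr_ratio hg hβ hJ hh, integral_tangledLaw (B := 0) hg hW hβ hJ hh hΛ (fun _ _ => rfl) hZ
    (fun T => (pairingEvent Λ Λ' A B).indicator F (regroup T)) fun T => abs_indicator_le hF _ _,
    ← tsum_pairWeight_switching hg hW hβ hJ hh hΛ hB F hinv hF]
  by_cases h0 : partFun g a β J h Λ A * partFun g a β J h Λ' B = 0
  · have h1 := hasSum_pairWeight hg a hβ hJ hh Λ Λ' A B
    rw [h0, hasSum_zero_iff_of_nonneg fun p => pairWeight_nonneg hg a hβ hJ hh p] at h1
    have h2 : ∀ p : CurrentPair Λ Λ' A B, pairWeight g a β J h p = 0 := congrFun h1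
    simp only [h0, h2, zero_div, zero_mul, tsum_zero]
  · rw [integral_tangledLaw hg hW hβ hJ hh hΛ hB.1 h0 F hF, mul_comm,
      div_mul_div_cancel₀ h0]

end Switching

end Phi4

open Phi4 in
theorem theorem3p4 (g a : ℝ) (hg : 0 < g) :
    ∃ ρ : (X Y : Type u) → Measure (AdmPart X Y),
      -- probability measures on admissible partitions
      (∀ (X Y : Type u) [Finite X] [Finite Y], Even (Nat.card X) → Even (Nat.card Y) →
        IsProbabilityMeasure (ρ X Y)) ∧
      -- up to relabelling, they depend only on the numbers of points of the two parts
      (∀ (X X' Y Y' : Type u) [Finite X] [Finite Y] (e : X ≃ X') (f : Y ≃ Y'),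
        (ρ X Y).map (AdmPart.congr e f) = ρ X' Y') ∧
      ∀ (V : Type u) (J : Sym2 V → ℝ) (h : V → ℝ) (β : ℝ),
        (∀ e, 0 ≤ J e) → (∀ x, 0 ≤ h x) → 0 < β →
        ∀ (Λ Λ' : Finset (Option V)) (hΛ : Λ' ⊆ Λ) (A B : Option V → ℕ),
          IsMoment Λ A → IsMoment Λ' B →
          -- the switching identity
          (∀ F : TangledCurrent Λ A B → ℝ, LabelInvariant F → (∃ C, ∀ T, |F T| ≤ C) →
            (Summable fun p : CurrentPair Λ Λ' A B =>
              pairWeight g a β J h p * ∫ t, F (assemble hΛ p t) ∂(tanglingMeasure ρ p)) ∧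
            (Summable fun p : CurrentPair Λ Λ' (addMoment A B) 0 =>
              pairWeight g a β J h p *
                ∫ t, (pairingEvent Λ Λ' A B).indicator F (regroup (assemble hΛ p t))
                  ∂(tanglingMeasure ρ p)) ∧
            ∑' p : CurrentPair Λ Λ' A B,
              pairWeight g a β J h p * ∫ t, F (assemble hΛ p t) ∂(tanglingMeasure ρ p)
            = ∑' p : CurrentPair Λ Λ' (addMoment A B) 0,
              pairWeight g a β J h p *
                ∫ t, (pairingEvent Λ Λ' A B).indicator F (regroup (assemble hΛ p t))
                  ∂(tanglingMeasure ρ p)) ∧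
          -- the laws of the random tangled currents are well defined
          (corr g a β J h Λ A ≠ 0 → corr g a β J h Λ' B ≠ 0 →
            IsProbabilityMeasure (tangledLaw ρ g a β J h hΛ A B)) ∧
          (corr g a β J h Λ (addMoment A B) ≠ 0 →
            IsProbabilityMeasure (tangledLaw ρ g a β J h hΛ (addMoment A B) 0) ∧
            -- the probabilistic form of the identity
            (∀ F : TangledCurrent Λ A B → ℝ, LabelInvariant F → (∃ C, ∀ T, |F T| ≤ C) →
              corr g a β J h Λ A * corr g a β J h Λ' B / corr g a β J h Λ (addMoment A B)
                * ∫ T, F T ∂(tangledLaw ρ g a β J h hΛ A B)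
              = ∫ T, (pairingEvent Λ Λ' A B).indicator F (regroup T)
                  ∂(tangledLaw ρ g a β J h hΛ (addMoment A B) 0)) ∧
            -- ratios of correlations are connection probabilities
            corr g a β J h Λ A * corr g a β J h Λ' B / corr g a β J h Λ (addMoment A B)
              = (tangledLaw ρ g a β J h hΛ (addMoment A B) 0).real
                  {T | regroup T ∈ pairingEvent Λ Λ' A B}) := by
  obtain ⟨W, hW₀, hW₁, hW₂⟩ := exists_tangling_weight.{u} hg a
  have hW : IsTanglingWeight g a W := ⟨hW₀, hW₁, hW₂⟩
  refine ⟨tanglingLaw g a W, fun X Y _ _ hX hY => isProbabilityMeasure_tanglingLaw hg hW X Y hX hY,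
    fun X X' Y Y' _ _ e f => map_tanglingLaw hW X X' Y Y' e f, ?_⟩
  intro V J h β hJ hh hβ Λ Λ' hΛ A B _ hB
  refine ⟨fun F hinv ⟨C, hF⟩ => ⟨?_, ?_, ?_⟩, fun hA' hB' => ?_, fun hAB => ⟨?_, ?_, ?_⟩⟩
  · exact summable_pairWeight_mul_integral hg hW hβ hJ hh hΛ hB.1 F hF
  · exact summable_pairWeight_mul_integral hg hW hβ hJ hh hΛ (fun _ _ => rfl)
      (fun T => (pairingEvent Λ Λ' A B).indicator F (regroup T)) fun T => abs_indicator_le hF _ _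
  · exact tsum_pairWeight_switching hg hW hβ hJ hh hΛ hB F hinv hF
  · exact isProbabilityMeasure_tangledLaw hg hW hβ hJ hh hΛ hB.1
      (mul_ne_zero (partFun_ne_zero hA') (partFun_ne_zero hB'))
  · exact isProbabilityMeasure_tangledLaw hg hW hβ hJ hh hΛ (fun _ _ => rfl)
      (mul_ne_zero (partFun_ne_zero hAB) (partFun_zero_pos hg a hβ hJ hh Λ').ne')
  · exact fun F hinv ⟨C, hF⟩ => corr_mul_integral_tangledLaw hg hW hβ hJ hh hΛ hB hAB F hinv hF
  · have h1 := corr_mul_integral_tangledLaw (A := A) hg hW hβ hJ hh hΛ hB hAB (fun _ => 1)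
      (fun _ _ => rfl) (C := 1) fun _ => abs_one.le
    have h2 : ∫ T, (pairingEvent Λ Λ' A B).indicator (fun _ => (1 : ℝ)) (regroup T)
          ∂(tangledLaw (tanglingLaw g a W) g a β J h hΛ (addMoment A B) 0)
        = (tangledLaw (tanglingLaw g a W) g a β J h hΛ (addMoment A B) 0).real
            {T | regroup T ∈ pairingEvent Λ Λ' A B} :=
      integral_indicator_one (μ := tangledLaw (tanglingLaw g a W) g a β J h hΛ (addMoment A B) 0)
        (s := {T | regroup T ∈ pairingEvent Λ Λ' A B}) trivial
    rw [← h2, ← h1]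
    -- If a correlation in the numerator vanishes, the law for `(A, B)` is the zero measure.
    by_cases h0 : corr g a β J h Λ A = 0 ∨ corr g a β J h Λ' B = 0
    · rw [mul_eq_zero.2 h0, zero_div, zero_mul]
    · rw [not_or] at h0
      have := isProbabilityMeasure_tangledLaw hg hW hβ hJ hh hΛ hB.1
        (mul_ne_zero (partFun_ne_zero h0.1) (partFun_ne_zero h0.2))
      rw [integral_const, probReal_univ, one_smul, mul_one]
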